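/- **Conventions.** Let $M$ be a smooth manifold, let $Y$ and $X$ be smooth (possibly infinite-dimensional) manifolds, and let $\pi\colon Y\to M$ and $\rho\colon X\to M$ be smooth maps that are locally split, i.e. every point of $M$ has a neighbourhood on which there is a smooth section. $Y^{[p]}$ denotes the $p$-fold fibre product of $Y$ over $M$. A bundle gerbe $(L,Y)$ over $M$ is a smooth hermitian line bundle $L\to Y^{[2]}$ with a smooth hermitian associative product $L_{(y_1,y_2)}\otimes L_{(y_2,y_3)}\cong L_{(y_1,y_3)}$ over $Y^{[3]}$. A hermitian line bundle $K\to Y$ defines the bundle gerbe $\delta(K)_{(y_1,y_2)}=K_{y_2}\otimes K_{y_1}^*$, with product given by the pairing. A trivialisation of $(P,Y)$ is a hermitian line bundle $K\to Y$ with an isomorphism of bundle gerbes $\delta(K)\cong P$. A stable isomorphism from $(L,Y)$ to $(J,X)$ is a trivialisation $t\colon\delta(K)\cong L^*\otimes J$ over $Y\times_M X$. An $L$-module is a smooth finite-rank hermitian vector bundle $E\to Y$ with a smooth hermitian isomorphism $L_{(y_1,y_2)}\otimes E_{y_2}\cong E_{y_1}$ over $Y^{[2]}$ that is compatible with the product of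 $L$. Two modules are isomorphic if there is a smooth isomorphism of vector bundles between them preserving the actions. $\mathrm{Mod}(L)$ is the commutative semigroup of isomorphism classes of $L$-modules under direct sum (including the zero module), and the bundle gerbe K-group $K(L)$ is its Grothendieck group. **Proposition.** Let $(L,Y)$ and $(J,X)$ be bundle gerbes over $M$. 1. A stable isomorphism $t\colon\delta(K)\cong L^*\otimes J$ induces a semigroup isomorphism $\Phi\colon\mathrm{Mod}(L)\to\mathrm{Mod}(J)$, in the following way. For every $L$-module $E$ there is a $J$-module $F$ together with a smooth hermitian isomorphism $\theta_{(y,x)}\colon K_{(y,x)}^*\otimes E_y\cong F_x$ of bundles over $Y\times_M X$ that is compatible with the actions: for all $z_1=(y_1,x_1)$, $z_2=(y_2,x_2)$ in $Y\times_MX$ over the same point of $M$, and all $k\in K_{z_2}$, $\xi\in K_{z_1}^*$, $l\in L_{(y_1,y_2)}$, $\eta\in K_{z_2}^*$, $e\in E_{y_2}$, $$t(k\otimes\xi)(l)\cdot\theta_{z_2}(\eta\otimes e)=\eta(k)\,\theta_{z_1}(\xi\otimes l\cdot e),$$ where $t(k\otimes \xi)(l)\in J_{(x_1,x_2)}$ is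 the contraction of $t(k\otimes\xi)\in L^*_{(y_1,y_2)}\otimes J_{(x_1,x_2)}$ with $l$. For every such $E$, $F$ one has $\Phi([E])=[F]$. Moreover, $\Phi$ induces an isomorphism of Grothendieck groups $K(L)\cong K(J)$, that is, one that carries the class of $m$ in $K(L)$ to the class of $\Phi(m)$ in $K(J)$ for all $m\in\mathrm{Mod}(L)$. 2. If $M$ is finite-dimensional, Hausdorff and $\sigma$-compact, and $(L,Y)$ and $(J,X)$ have the same Dixmier–Douady class in $H^3(M,\mathbb Z)$, then $K(L)\cong K(J)$. Here the Dixmier–Douady class is the class in Čech cohomology $H^3(M,\mathbb Z)$ defined as follows. Choose an open cover $\{U_a\}$ of $M$ with smooth local sections $s_a$ of $\pi$ over $U_a$, smooth unit sections $\sigma_{ab}$ of $(s_a,s_b)^{-1}L$ over $U_a\cap U_b$, and smooth functions $w_{abc}\colon U_a\cap U_b\cap U_c\to\mathbb R$ with $\sigma_{ab}\sigma_{bc}=e^{2\pi i w_{abc}}\sigma_{ac}$; the class is represented by the integral cocycle $w_{bcd}-w_{acd}+w_{abd}-w_{abc}$. -/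

import Mathlib

open scoped Manifold ContDiff TensorProduct InnerProductSpace

noncomputable section

namespace BundleGerbeTheory

/-! ### Finite-dimensional hermitian linear algebra -/

section LinearAlgebra

variable {U V W V' W' A B : Type*}
  [NormedAddCommGroup U] [InnerProductSpace ℂ U]
  [NormedAddCommGroup V] [InnerProductSpace ℂ V]
  [NormedAddCommGroup W] [InnerProductSpace ℂ W]
  [NormedAddCommGroup V'] [InnerProductSpace ℂ V']
  [NormedAddCommGroup W'] [InnerProductSpace ℂ W']
  [NormedAddCommGroup A] [InnerProductSpace ℂ A]
  [NormedAddCommGroup B] [InnerProductSpace ℂ B]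

instance completeSpace_of_finiteDimensional [FiniteDimensional ℂ V] : CompleteSpace V :=
  FiniteDimensional.complete ℂ V

/-- The dual `V*` of a finite-dimensional hermitian vector space, with the operator norm. -/
def HDual (V : Type*) [NormedAddCommGroup V] [InnerProductSpace ℂ V] : Type _ := StrongDual ℂ V

instance : NormedAddCommGroup (HDual V) := inferInstanceAs (NormedAddCommGroup (StrongDual ℂ V))

/-- The hermitian structure of the dual: `v ↦ ⟪v, ·⟫` is a conjugate-linear isometry. -/
instance [FiniteDimensional ℂ V] : InnerProductSpace ℂ (HDual V) where
  toNormedSpace := inferInstanceAs (NormedSpace ℂ (StrongDual ℂ V))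
  inner φ ψ := ⟪(InnerProductSpace.toDual ℂ V).symm ψ, (InnerProductSpace.toDual ℂ V).symm φ⟫_ℂ
  norm_sq_eq_re_inner φ := by
    refine Eq.trans ?_ (norm_sq_eq_re_inner (𝕜 := ℂ) _)
    exact (congrArg (· ^ 2) ((InnerProductSpace.toDual ℂ V).symm.norm_map φ)).symm
  conj_inner_symm φ ψ := inner_conj_symm _ _
  add_left φ ψ χ := by
    refine Eq.trans ?_ (inner_add_right _ _ _)
    exact congrArg _ (map_add (InnerProductSpace.toDual ℂ V).symm φ ψ)
  smul_left φ ψ c := by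
    refine Eq.trans ?_ (inner_smul_right _ _ _)
    exact congrArg _ (map_smulₛₗ (InnerProductSpace.toDual ℂ V).symm c φ)

/-- A linear form, as an element of the dual. -/
def HDual.ofLin [FiniteDimensional ℂ V] : (V →ₗ[ℂ] ℂ) ≃ₗ[ℂ] HDual V :=
  LinearMap.toContinuousLinearMap (𝕜 := ℂ) (E := V) (F' := ℂ)

/-- Evaluation of an element of the dual at a vector. -/
def HDual.ev [FiniteDimensional ℂ V] : HDual V →ₗ[ℂ] V →ₗ[ℂ] ℂ :=
  HDual.ofLin.symm.toLinearMap

@[simp] lemma HDual.ev_ofLin [FiniteDimensional ℂ V] (f : V →ₗ[ℂ] ℂ) : (HDual.ofLin f).ev = f :=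
  HDual.ofLin.symm_apply_apply f

@[ext] lemma HDual.ext [FiniteDimensional ℂ V] {φ ψ : HDual V} (h : φ.ev = ψ.ev) : φ = ψ :=
  HDual.ofLin.symm.injective h

/-- The conjugate-linear isometry `v ↦ ⟪v, ·⟫`. -/
def HDual.riesz (V : Type*) [NormedAddCommGroup V] [InnerProductSpace ℂ V]
    [FiniteDimensional ℂ V] : V ≃ₗᵢ⋆[ℂ] HDual V :=
  InnerProductSpace.toDual ℂ V

@[simp] lemma HDual.ev_riesz [FiniteDimensional ℂ V] (v w : V) : (HDual.riesz V v).ev w = ⟪v, w⟫_ℂ :=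
  rfl

lemma HDual.inner_riesz [FiniteDimensional ℂ V] (v w : V) :
    ⟪HDual.riesz V v, HDual.riesz V w⟫_ℂ = ⟪w, v⟫_ℂ := by
  change ⟪(InnerProductSpace.toDual ℂ V).symm (InnerProductSpace.toDual ℂ V w),
    (InnerProductSpace.toDual ℂ V).symm (InnerProductSpace.toDual ℂ V v)⟫_ℂ = _
  simp

lemma finrank_dual [FiniteDimensional ℂ V] :
    Module.finrank ℂ (HDual V) = Module.finrank ℂ V := by
  rw [← Subspace.dual_finrank_eq (K := ℂ) (V := V)]
  exact HDual.ofLin.symm.finrank_eq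

instance [FiniteDimensional ℂ V] : FiniteDimensional ℂ (HDual V) :=
  Module.Finite.equiv (HDual.ofLin (V := V))

/-- The orthonormal basis of the dual which is dual to an orthonormal basis. -/
def dualBasis [FiniteDimensional ℂ V] {ι : Type*} [Fintype ι] (b : OrthonormalBasis ι ℂ V) :
    OrthonormalBasis ι ℂ (HDual V) :=
  OrthonormalBasis.mk (v := fun i => HDual.riesz V (b i))
    (by
      classical
      rw [orthonormal_iff_ite]
      intro i j
      rw [HDual.inner_riesz, orthonormal_iff_ite.mp b.orthonormal]
      simp [eq_comm])
    (by
      intro φ _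
      rw [← (HDual.riesz V).apply_symm_apply φ,
        ← b.sum_repr ((HDual.riesz V).symm φ), map_sum]
      refine Submodule.sum_mem _ fun i _ => ?_
      rw [map_smulₛₗ]
      exact Submodule.smul_mem _ _ (Submodule.subset_span ⟨i, rfl⟩))

@[simp] lemma dualBasis_apply [FiniteDimensional ℂ V] {ι : Type*} [Fintype ι]
    (b : OrthonormalBasis ι ℂ V) (i : ι) :
    dualBasis b i = HDual.riesz V (b i) := by
  simp [dualBasis]

/-- A linear map out of a tensor product preserves inner products if it does on pure tensors. -/
lemma inner_map_tensor (f : V ⊗[ℂ] W →ₗ[ℂ] U)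
    (h : ∀ v w v' w', ⟪f (v ⊗ₜ w), f (v' ⊗ₜ w')⟫_ℂ = ⟪v, v'⟫_ℂ * ⟪w, w'⟫_ℂ) (x y : V ⊗[ℂ] W) :
    ⟪f x, f y⟫_ℂ = ⟪x, y⟫_ℂ := by
  induction x with
  | zero => simp
  | add x₁ x₂ h₁ h₂ => simp [inner_add_left, h₁, h₂]
  | tmul v w =>
    induction y with
    | zero => simp
    | add y₁ y₂ h₁ h₂ => simp [inner_add_right, h₁, h₂]
    | tmul v' w' => simp [h]

/-- The unitary isomorphism from a linear map which preserves inner products, between spaces of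
the same finite dimension. -/
def unitaryOfInner [FiniteDimensional ℂ V] [FiniteDimensional ℂ W] (f : V →ₗ[ℂ] W)
    (h : ∀ x y, ⟪f x, f y⟫_ℂ = ⟪x, y⟫_ℂ)
    (hr : Module.finrank ℂ V = Module.finrank ℂ W) : V ≃ₗᵢ[ℂ] W :=
  (f.isometryOfInner h).toLinearIsometryEquiv hr

@[simp] lemma unitaryOfInner_apply [FiniteDimensional ℂ V] [FiniteDimensional ℂ W] (f : V →ₗ[ℂ] W)
    (h : ∀ x y, ⟪f x, f y⟫_ℂ = ⟪x, y⟫_ℂ)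
    (hr : Module.finrank ℂ V = Module.finrank ℂ W) (x : V) : unitaryOfInner f h hr x = f x := rfl

/-- The linear map `V* ⊗ W* → (V ⊗ W)*` with `(φ ⊗ ψ)(v ⊗ w) = φ v * ψ w`. -/
def dualTensorLin [FiniteDimensional ℂ V] [FiniteDimensional ℂ W] :
    HDual V ⊗[ℂ] HDual W →ₗ[ℂ] HDual (V ⊗[ℂ] W) :=
  HDual.ofLin.toLinearMap ∘ₗ TensorProduct.dualDistrib ℂ V W ∘ₗ
    TensorProduct.map HDual.ev HDual.ev

@[simp] lemma dualTensorLin_apply [FiniteDimensional ℂ V] [FiniteDimensional ℂ W]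
    (φ : HDual V) (ψ : HDual W) (v : V) (w : W) :
    (dualTensorLin (φ ⊗ₜ ψ)).ev (v ⊗ₜ w) = φ.ev v * ψ.ev w := by
  simp only [dualTensorLin, LinearMap.comp_apply, LinearEquiv.coe_coe, HDual.ev_ofLin,
    TensorProduct.map_tmul, TensorProduct.dualDistrib_apply]

lemma dualTensorLin_riesz [FiniteDimensional ℂ V] [FiniteDimensional ℂ W] (v : V) (w : W) :
    dualTensorLin (HDual.riesz V v ⊗ₜ HDual.riesz W w) = HDual.riesz (V ⊗[ℂ] W) (v ⊗ₜ w) := by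
  apply HDual.ext
  apply TensorProduct.ext'
  intro v' w'
  simp

/-- The unitary isomorphism `V* ⊗ W* ≅ (V ⊗ W)*`. -/
def dualTensor [FiniteDimensional ℂ V] [FiniteDimensional ℂ W] :
    HDual V ⊗[ℂ] HDual W ≃ₗᵢ[ℂ] HDual (V ⊗[ℂ] W) :=
  unitaryOfInner dualTensorLin
    (inner_map_tensor _ fun φ ψ φ' ψ' => by
      obtain ⟨v, rfl⟩ := (HDual.riesz V).surjective φ
      obtain ⟨w, rfl⟩ := (HDual.riesz W).surjective ψ
      obtain ⟨v', rfl⟩ := (HDual.riesz V).surjective φ'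
      obtain ⟨w', rfl⟩ := (HDual.riesz W).surjective ψ'
      simp only [dualTensorLin_riesz, HDual.inner_riesz, TensorProduct.inner_tmul])
    (by rw [Module.finrank_tensorProduct, finrank_dual, finrank_dual, finrank_dual,
          Module.finrank_tensorProduct])

@[simp] lemma dualTensor_apply [FiniteDimensional ℂ V] [FiniteDimensional ℂ W]
    (φ : HDual V) (ψ : HDual W) (v : V) (w : W) :
    (dualTensor (φ ⊗ₜ ψ)).ev (v ⊗ₜ w) = φ.ev v * ψ.ev w := dualTensorLin_apply φ ψ v w

@[simp] lemma dualTensor_riesz [FiniteDimensional ℂ V] [FiniteDimensional ℂ W] (v : V) (w : W) :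
    dualTensor (HDual.riesz V v ⊗ₜ HDual.riesz W w) = HDual.riesz (V ⊗[ℂ] W) (v ⊗ₜ w) :=
  dualTensorLin_riesz v w

/-- The linear map `V* → W*`, `φ ↦ φ ∘ e⁻¹` induced by `e : V ≅ W`. -/
def dualCongrLin [FiniteDimensional ℂ V] [FiniteDimensional ℂ W] (e : V ≃ₗᵢ[ℂ] W) :
    HDual V →ₗ[ℂ] HDual W :=
  HDual.ofLin.toLinearMap ∘ₗ LinearMap.lcomp ℂ ℂ e.symm.toLinearEquiv.toLinearMap ∘ₗ HDual.ev

lemma dualCongrLin_apply [FiniteDimensional ℂ V] [FiniteDimensional ℂ W] (e : V ≃ₗᵢ[ℂ] W)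
    (φ : HDual V) (w : W) : (dualCongrLin e φ).ev w = φ.ev (e.symm w) := by
  simp only [dualCongrLin, LinearMap.comp_apply, LinearEquiv.coe_coe, HDual.ev_ofLin,
    LinearMap.lcomp_apply]
  rfl

lemma dualCongrLin_riesz [FiniteDimensional ℂ V] [FiniteDimensional ℂ W] (e : V ≃ₗᵢ[ℂ] W) (v : V) :
    dualCongrLin e (HDual.riesz V v) = HDual.riesz W (e v) := by
  apply HDual.ext
  ext w
  rw [dualCongrLin_apply, HDual.ev_riesz, HDual.ev_riesz, e.inner_map_eq_flip]

/-- The unitary isomorphism `V* ≅ W*`, `φ ↦ φ ∘ e⁻¹` induced by `e : V ≅ W`. -/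
def dualCongr [FiniteDimensional ℂ V] [FiniteDimensional ℂ W] (e : V ≃ₗᵢ[ℂ] W) :
    HDual V ≃ₗᵢ[ℂ] HDual W :=
  unitaryOfInner (dualCongrLin e)
    (fun φ ψ => by
      obtain ⟨v, rfl⟩ := (HDual.riesz V).surjective φ
      obtain ⟨w, rfl⟩ := (HDual.riesz V).surjective ψ
      simp only [dualCongrLin_riesz, HDual.inner_riesz, e.inner_map_map])
    (by rw [finrank_dual, finrank_dual, e.toLinearEquiv.finrank_eq])

@[simp] lemma dualCongr_apply [FiniteDimensional ℂ V] [FiniteDimensional ℂ W] (e : V ≃ₗᵢ[ℂ] W)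
    (φ : HDual V) (w : W) : (dualCongr e φ).ev w = φ.ev (e.symm w) := dualCongrLin_apply e φ w

@[simp] lemma dualCongr_riesz [FiniteDimensional ℂ V] [FiniteDimensional ℂ W] (e : V ≃ₗᵢ[ℂ] W)
    (v : V) : dualCongr e (HDual.riesz V v) = HDual.riesz W (e v) := dualCongrLin_riesz e v

/-- A linear map out of a fourfold tensor product preserves inner products if it does on pure
tensors. -/
lemma inner_map_tensor₄ (f : (V ⊗[ℂ] V') ⊗[ℂ] (W ⊗[ℂ] W') →ₗ[ℂ] U)
    (h : ∀ v v' w w' v₁ v₁' w₁ w₁',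
      ⟪f ((v ⊗ₜ v') ⊗ₜ (w ⊗ₜ w')), f ((v₁ ⊗ₜ v₁') ⊗ₜ (w₁ ⊗ₜ w₁'))⟫_ℂ =
        (⟪v, v₁⟫_ℂ * ⟪v', v₁'⟫_ℂ) * (⟪w, w₁⟫_ℂ * ⟪w', w₁'⟫_ℂ))
    (x y : (V ⊗[ℂ] V') ⊗[ℂ] (W ⊗[ℂ] W')) : ⟪f x, f y⟫_ℂ = ⟪x, y⟫_ℂ := by
  refine inner_map_tensor f (fun a b c d => ?_) x y
  induction a with
  | zero => simp
  | add x₁ x₂ h₁ h₂ =>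
    rw [TensorProduct.add_tmul, map_add, inner_add_left, inner_add_left, h₁, h₂, add_mul]
  | tmul a a' =>
  induction b with
  | zero => simp
  | add x₁ x₂ h₁ h₂ =>
    rw [TensorProduct.tmul_add, map_add, inner_add_left, inner_add_left, h₁, h₂, mul_add]
  | tmul b b' =>
  induction c with
  | zero => simp
  | add x₁ x₂ h₁ h₂ =>
    rw [TensorProduct.add_tmul, map_add, inner_add_right, inner_add_right, h₁, h₂, add_mul]
  | tmul c c' =>
  induction d with
  | zero => simp
  | add x₁ x₂ h₁ h₂ =>
    rw [TensorProduct.tmul_add, map_add, inner_add_right, inner_add_right, h₁, h₂, mul_add]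
  | tmul d d' => rw [h, TensorProduct.inner_tmul, TensorProduct.inner_tmul]

/-- The unitary isomorphism `(V ⊗ V') ⊗ (W ⊗ W') ≅ (V ⊗ W) ⊗ (V' ⊗ W')`. -/
def middleSwap [FiniteDimensional ℂ V] [FiniteDimensional ℂ W] [FiniteDimensional ℂ V']
    [FiniteDimensional ℂ W'] :
    (V ⊗[ℂ] V') ⊗[ℂ] (W ⊗[ℂ] W') ≃ₗᵢ[ℂ] (V ⊗[ℂ] W) ⊗[ℂ] (V' ⊗[ℂ] W') :=
  unitaryOfInner (V := (V ⊗[ℂ] V') ⊗[ℂ] (W ⊗[ℂ] W')) (W := (V ⊗[ℂ] W) ⊗[ℂ] (V' ⊗[ℂ] W'))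
    (TensorProduct.tensorTensorTensorComm ℂ V V' W W').toLinearMap
    (by
      refine inner_map_tensor₄ (U := (V ⊗[ℂ] W) ⊗[ℂ] (V' ⊗[ℂ] W')) _
        fun v v' w w' v₁ v₁' w₁ w₁' => ?_
      simp only [LinearEquiv.coe_coe, TensorProduct.tensorTensorTensorComm_tmul,
        TensorProduct.inner_tmul]
      ring)
    (TensorProduct.tensorTensorTensorComm ℂ V V' W W').finrank_eq

lemma dualMul_riesz [FiniteDimensional ℂ U] [FiniteDimensional ℂ V] [FiniteDimensional ℂ W]
    (e : V ⊗[ℂ] W ≃ₗᵢ[ℂ] U) (v : V) (w : W) :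
    (dualTensor.trans (dualCongr e)) (HDual.riesz V v ⊗ₜ HDual.riesz W w) =
      HDual.riesz U (e (v ⊗ₜ w)) := by
  rw [LinearIsometryEquiv.trans_apply, dualTensor_riesz, dualCongr_riesz]

/-- `(V ⊗ V') ⊗ (W ⊗ W') ≅ A ⊗ B` for `V ⊗ W ≅ A` and `V' ⊗ W' ≅ B`. -/
def interchange [FiniteDimensional ℂ V] [FiniteDimensional ℂ W] [FiniteDimensional ℂ V']
    [FiniteDimensional ℂ W'] (f : V ⊗[ℂ] W ≃ₗᵢ[ℂ] A) (g : V' ⊗[ℂ] W' ≃ₗᵢ[ℂ] B) :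
    (V ⊗[ℂ] V') ⊗[ℂ] (W ⊗[ℂ] W') ≃ₗᵢ[ℂ] A ⊗[ℂ] B :=
  middleSwap.trans (TensorProduct.congrIsometry f g)

@[simp] lemma interchange_tmul [FiniteDimensional ℂ V] [FiniteDimensional ℂ W]
    [FiniteDimensional ℂ V'] [FiniteDimensional ℂ W']
    (f : V ⊗[ℂ] W ≃ₗᵢ[ℂ] A) (g : V' ⊗[ℂ] W' ≃ₗᵢ[ℂ] B) (v : V) (v' : V') (w : W) (w' : W') :
    interchange f g ((v ⊗ₜ v') ⊗ₜ (w ⊗ₜ w')) = f (v ⊗ₜ w) ⊗ₜ g (v' ⊗ₜ w') := rfl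

/-- The contraction `(V ⊗ U*) ⊗ (W ⊗ V*) → W ⊗ U*`, `(v ⊗ ξ) ⊗ (w ⊗ η) ↦ η.ev v • (w ⊗ ξ)`. -/
def contractLin [FiniteDimensional ℂ U] [FiniteDimensional ℂ V] : (V ⊗[ℂ] HDual U) ⊗[ℂ] (W ⊗[ℂ] HDual V) →ₗ[ℂ]
    W ⊗[ℂ] HDual U :=
  TensorProduct.lift <| TensorProduct.lift <|
    LinearMap.mk₂ ℂ
      (fun v ξ => TensorProduct.lift <| LinearMap.mk₂ ℂ (fun w (η : HDual V) => η.ev v • (w ⊗ₜ[ℂ] ξ))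
        (fun w w' η => by simp [TensorProduct.add_tmul])
        (fun c w η => by rw [← TensorProduct.smul_tmul', smul_comm])
        (fun w η η' => by simp [add_smul])
        (fun c w η => by rw [map_smul, LinearMap.smul_apply, smul_assoc]))
      (fun v v' ξ => by ext w η; simp [add_smul])
      (fun c v ξ => by ext w η; simp [mul_smul])
      (fun v ξ ξ' => by ext w η; simp [TensorProduct.tmul_add])
      (fun c v ξ => by ext w η; simp [smul_comm c])

@[simp] lemma contractLin_tmul [FiniteDimensional ℂ U] [FiniteDimensional ℂ V] (v : V) (ξ : HDual U) (w : W) (η : HDual V) :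
    contractLin ((v ⊗ₜ[ℂ] ξ) ⊗ₜ[ℂ] (w ⊗ₜ[ℂ] η)) = η.ev v • (w ⊗ₜ[ℂ] ξ) := rfl

/-- On a hermitian line the pairing with the dual preserves inner products. -/
lemma line_pairing [FiniteDimensional ℂ V] (h : Module.finrank ℂ V = 1) (v v' : V)
    (η η' : HDual V) :
    (starRingEnd ℂ) (η.ev v) * η'.ev v' = ⟪v, v'⟫_ℂ * ⟪η, η'⟫_ℂ := by
  obtain ⟨u, rfl⟩ := (HDual.riesz V).surjective η
  obtain ⟨u', rfl⟩ := (HDual.riesz V).surjective η'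
  rw [HDual.inner_riesz]
  obtain ⟨e, he, hs⟩ := finrank_eq_one_iff'.mp h
  obtain ⟨a, rfl⟩ := hs v
  obtain ⟨b, rfl⟩ := hs v'
  obtain ⟨c, rfl⟩ := hs u
  obtain ⟨d, rfl⟩ := hs u'
  simp only [map_smulₛₗ, HDual.ev_riesz, inner_smul_left, inner_smul_right,
    LinearMap.smul_apply, smul_eq_mul, map_mul, RingHomCompTriple.comp_apply, RingHom.id_apply,
    inner_conj_symm]
  ring

/-- The contraction as a unitary isomorphism, when the contracted factor is a line. -/
def contract [FiniteDimensional ℂ U] [FiniteDimensional ℂ V] [FiniteDimensional ℂ W]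
    (h : Module.finrank ℂ V = 1) :
    (V ⊗[ℂ] HDual U) ⊗[ℂ] (W ⊗[ℂ] HDual V) ≃ₗᵢ[ℂ] W ⊗[ℂ] HDual U :=
  unitaryOfInner (V := (V ⊗[ℂ] HDual U) ⊗[ℂ] (W ⊗[ℂ] HDual V)) (W := W ⊗[ℂ] HDual U) contractLin
    (by
      refine inner_map_tensor₄ _ fun v ξ w η v' ξ' w' η' => ?_
      rw [contractLin_tmul, contractLin_tmul]
      refine (inner_smul_left (𝕜 := ℂ) (w ⊗ₜ[ℂ] ξ) (η'.ev v' • (w' ⊗ₜ[ℂ] ξ')) (η.ev v)).trans ?_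
      rw [show ⟪w ⊗ₜ[ℂ] ξ, η'.ev v' • (w' ⊗ₜ[ℂ] ξ')⟫_ℂ = _ from
        inner_smul_right (𝕜 := ℂ) (w ⊗ₜ[ℂ] ξ) (w' ⊗ₜ[ℂ] ξ') (η'.ev v'), TensorProduct.inner_tmul]
      linear_combination (⟪w, w'⟫_ℂ * ⟪ξ, ξ'⟫_ℂ) * line_pairing h v v' η η')
    (by
      rw [Module.finrank_tensorProduct, Module.finrank_tensorProduct, Module.finrank_tensorProduct,
        Module.finrank_tensorProduct, finrank_dual, finrank_dual, h, mul_one, one_mul, mul_comm])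

@[simp] lemma contract_tmul [FiniteDimensional ℂ U] [FiniteDimensional ℂ V]
    [FiniteDimensional ℂ W] (h : Module.finrank ℂ V = 1)
    (v : V) (ξ : HDual U) (w : W) (η : HDual V) :
    contract h ((v ⊗ₜ[ℂ] ξ) ⊗ₜ[ℂ] (w ⊗ₜ[ℂ] η)) = η.ev v • (w ⊗ₜ[ℂ] ξ) := rfl

/-- The diagonal map `V ⊗ (A ⊕ B) → A' ⊕ B'` for `V ⊗ A → A'` and `V ⊗ B → B'`. -/
def diagonal [FiniteDimensional ℂ V] [FiniteDimensional ℂ A] [FiniteDimensional ℂ B]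
    [FiniteDimensional ℂ V'] [FiniteDimensional ℂ W']
    (f : V ⊗[ℂ] A ≃ₗᵢ[ℂ] V') (g : V ⊗[ℂ] B ≃ₗᵢ[ℂ] W') :
    V ⊗[ℂ] WithLp 2 (A × B) ≃ₗᵢ[ℂ] WithLp 2 (V' × W') :=
  unitaryOfInner
    ((WithLp.linearEquiv 2 ℂ (V' × W')).symm.toLinearMap ∘ₗ
      LinearMap.prod
        (f.toLinearEquiv.toLinearMap ∘ₗ LinearMap.lTensor V
          (LinearMap.fst ℂ A B ∘ₗ (WithLp.linearEquiv 2 ℂ (A × B)).toLinearMap))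
        (g.toLinearEquiv.toLinearMap ∘ₗ LinearMap.lTensor V
          (LinearMap.snd ℂ A B ∘ₗ (WithLp.linearEquiv 2 ℂ (A × B)).toLinearMap)))
    (inner_map_tensor _ fun v w v' w' => by
      simp [mul_add])
    (by
      have hf := f.toLinearEquiv.finrank_eq
      have hg := g.toLinearEquiv.finrank_eq
      simp only [Module.finrank_tensorProduct] at hf hg
      rw [Module.finrank_tensorProduct, (WithLp.linearEquiv 2 ℂ (A × B)).finrank_eq,
        (WithLp.linearEquiv 2 ℂ (V' × W')).finrank_eq, Module.finrank_prod, Module.finrank_prod,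
        ← hf, ← hg, mul_add])

@[simp] lemma diagonal_tmul [FiniteDimensional ℂ V] [FiniteDimensional ℂ A]
    [FiniteDimensional ℂ B] [FiniteDimensional ℂ V'] [FiniteDimensional ℂ W']
    (f : V ⊗[ℂ] A ≃ₗᵢ[ℂ] V') (g : V ⊗[ℂ] B ≃ₗᵢ[ℂ] W') (v : V) (x : WithLp 2 (A × B)) :
    diagonal f g (v ⊗ₜ x) = WithLp.toLp 2 (f (v ⊗ₜ x.fst), g (v ⊗ₜ x.snd)) := rfl

lemma interchange_zero [FiniteDimensional ℂ V] [FiniteDimensional ℂ W]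
    [FiniteDimensional ℂ V'] [FiniteDimensional ℂ W'] (f : V ⊗[ℂ] W ≃ₗᵢ[ℂ] A)
    (g : V' ⊗[ℂ] W' ≃ₗᵢ[ℂ] B) : interchange f g 0 = 0 :=
  LinearMap.map_zero (interchange f g).toLinearEquiv.toLinearMap

lemma contract_zero [FiniteDimensional ℂ U] [FiniteDimensional ℂ V] [FiniteDimensional ℂ W]
    (h : Module.finrank ℂ V = 1) : contract (U := U) (W := W) h 0 = 0 :=
  LinearMap.map_zero (contract (U := U) (W := W) h).toLinearEquiv.toLinearMap

lemma interchange_assoc {V₁ V₂ V₃ V₁₂ V₂₃ V₁₂₃ W₁ W₂ W₃ W₁₂ W₂₃ W₁₂₃ : Type*}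
    [NormedAddCommGroup V₁] [InnerProductSpace ℂ V₁] [FiniteDimensional ℂ V₁]
    [NormedAddCommGroup V₂] [InnerProductSpace ℂ V₂] [FiniteDimensional ℂ V₂]
    [NormedAddCommGroup V₃] [InnerProductSpace ℂ V₃] [FiniteDimensional ℂ V₃]
    [NormedAddCommGroup V₁₂] [InnerProductSpace ℂ V₁₂] [FiniteDimensional ℂ V₁₂]
    [NormedAddCommGroup V₂₃] [InnerProductSpace ℂ V₂₃] [FiniteDimensional ℂ V₂₃]
    [NormedAddCommGroup V₁₂₃] [InnerProductSpace ℂ V₁₂₃]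
    [NormedAddCommGroup W₁] [InnerProductSpace ℂ W₁] [FiniteDimensional ℂ W₁]
    [NormedAddCommGroup W₂] [InnerProductSpace ℂ W₂] [FiniteDimensional ℂ W₂]
    [NormedAddCommGroup W₃] [InnerProductSpace ℂ W₃] [FiniteDimensional ℂ W₃]
    [NormedAddCommGroup W₁₂] [InnerProductSpace ℂ W₁₂] [FiniteDimensional ℂ W₁₂]
    [NormedAddCommGroup W₂₃] [InnerProductSpace ℂ W₂₃] [FiniteDimensional ℂ W₂₃]
    [NormedAddCommGroup W₁₂₃] [InnerProductSpace ℂ W₁₂₃]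
    (f₁ : V₁ ⊗[ℂ] V₂ ≃ₗᵢ[ℂ] V₁₂) (f₂ : V₂ ⊗[ℂ] V₃ ≃ₗᵢ[ℂ] V₂₃) (f₃ : V₁₂ ⊗[ℂ] V₃ ≃ₗᵢ[ℂ] V₁₂₃)
    (f₄ : V₁ ⊗[ℂ] V₂₃ ≃ₗᵢ[ℂ] V₁₂₃)
    (g₁ : W₁ ⊗[ℂ] W₂ ≃ₗᵢ[ℂ] W₁₂) (g₂ : W₂ ⊗[ℂ] W₃ ≃ₗᵢ[ℂ] W₂₃) (g₃ : W₁₂ ⊗[ℂ] W₃ ≃ₗᵢ[ℂ] W₁₂₃)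
    (g₄ : W₁ ⊗[ℂ] W₂₃ ≃ₗᵢ[ℂ] W₁₂₃)
    (hf : ∀ a b c, f₃ (f₁ (a ⊗ₜ b) ⊗ₜ c) = f₄ (a ⊗ₜ f₂ (b ⊗ₜ c)))
    (hg : ∀ a b c, g₃ (g₁ (a ⊗ₜ b) ⊗ₜ c) = g₄ (a ⊗ₜ g₂ (b ⊗ₜ c)))
    (a : V₁ ⊗[ℂ] W₁) (b : V₂ ⊗[ℂ] W₂) (c : V₃ ⊗[ℂ] W₃) :
    interchange f₃ g₃ (interchange f₁ g₁ (a ⊗ₜ b) ⊗ₜ c) =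
      interchange f₄ g₄ (a ⊗ₜ interchange f₂ g₂ (b ⊗ₜ c)) := by
  induction a with
  | zero => simp only [TensorProduct.zero_tmul, interchange_zero]
  | add x y hx hy => simp only [TensorProduct.add_tmul, map_add, hx, hy]
  | tmul a a' =>
  induction b with
  | zero => simp only [TensorProduct.zero_tmul, TensorProduct.tmul_zero, interchange_zero]
  | add x y hx hy => simp only [TensorProduct.add_tmul, TensorProduct.tmul_add, map_add, hx, hy]
  | tmul b b' =>
  induction c with
  | zero => simp only [TensorProduct.tmul_zero, interchange_zero]
  | add x y hx hy => simp only [TensorProduct.tmul_add, map_add, hx, hy]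
  | tmul c c' => simp only [interchange_tmul, hf, hg]

lemma contract_assoc {V₁ V₂ V₃ V₄ : Type*}
    [NormedAddCommGroup V₁] [InnerProductSpace ℂ V₁] [FiniteDimensional ℂ V₁]
    [NormedAddCommGroup V₂] [InnerProductSpace ℂ V₂] [FiniteDimensional ℂ V₂]
    [NormedAddCommGroup V₃] [InnerProductSpace ℂ V₃] [FiniteDimensional ℂ V₃]
    [NormedAddCommGroup V₄] [InnerProductSpace ℂ V₄] [FiniteDimensional ℂ V₄]
    (h₂ : Module.finrank ℂ V₂ = 1) (h₃ : Module.finrank ℂ V₃ = 1)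
    (a : V₂ ⊗[ℂ] HDual V₁) (b : V₃ ⊗[ℂ] HDual V₂) (c : V₄ ⊗[ℂ] HDual V₃) :
    contract h₃ (contract h₂ (a ⊗ₜ[ℂ] b) ⊗ₜ[ℂ] c) =
      contract h₂ (a ⊗ₜ[ℂ] contract h₃ (b ⊗ₜ[ℂ] c)) := by
  induction a with
  | zero => simp only [TensorProduct.zero_tmul, contract_zero]
  | add x y hx hy => simp only [TensorProduct.add_tmul, map_add, hx, hy]
  | tmul a a' =>
  induction b with
  | zero => simp only [TensorProduct.zero_tmul, TensorProduct.tmul_zero, contract_zero]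
  | add x y hx hy => simp only [TensorProduct.add_tmul, TensorProduct.tmul_add, map_add, hx, hy]
  | tmul b b' =>
  induction c with
  | zero => simp only [TensorProduct.tmul_zero, contract_zero]
  | add x y hx hy => simp only [TensorProduct.tmul_add, map_add, hx, hy]
  | tmul c c' =>
    rw [contract_tmul, contract_tmul, TensorProduct.tmul_smul, ← TensorProduct.smul_tmul']
    have e₁ := map_smul (contract (U := V₁) (W := V₄) h₃) (b'.ev a)
      ((b ⊗ₜ[ℂ] a') ⊗ₜ[ℂ] (c ⊗ₜ[ℂ] c'))
    have e₂ := map_smul (contract (U := V₁) (W := V₄) h₂) (c'.ev b)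
      ((a ⊗ₜ[ℂ] a') ⊗ₜ[ℂ] (c ⊗ₜ[ℂ] b'))
    refine e₁.trans (Eq.trans ?_ e₂.symm)
    rw [contract_tmul, contract_tmul]
    exact smul_comm _ _ _

/-- The contraction `V* ⊗ W → W` at a vector of `V`. -/
def evalAt {V W : Type*} [NormedAddCommGroup V] [InnerProductSpace ℂ V] [FiniteDimensional ℂ V]
    [NormedAddCommGroup W] [InnerProductSpace ℂ W] (v : V) : HDual V ⊗[ℂ] W →ₗ[ℂ] W :=
  (TensorProduct.lid ℂ W).toLinearMap ∘ₗ (HDual.ev.flip v).rTensor W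

lemma evalAt_tmul {V W : Type*} [NormedAddCommGroup V] [InnerProductSpace ℂ V]
    [FiniteDimensional ℂ V] [NormedAddCommGroup W] [InnerProductSpace ℂ W] (v : V) (φ : HDual V)
    (w : W) : evalAt v (φ ⊗ₜ[ℂ] w) = φ.ev v • w := rfl

/-- The sum of two linear maps. -/
def sumMap (f : V →ₗ[ℂ] V') (g : W →ₗ[ℂ] W') : WithLp 2 (V × W) →ₗ[ℂ] WithLp 2 (V' × W') :=
  (WithLp.linearEquiv 2 ℂ (V' × W')).symm.toLinearMap ∘ₗ f.prodMap g ∘ₗ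
    (WithLp.linearEquiv 2 ℂ (V × W)).toLinearMap

@[simp] lemma sumMap_apply (f : V →ₗ[ℂ] V') (g : W →ₗ[ℂ] W') (x : WithLp 2 (V × W)) :
    sumMap f g x = WithLp.toLp 2 (f x.fst, g x.snd) := rfl

/-- The sum of two linear isomorphisms. -/
def sumEquiv (f : V ≃ₗ[ℂ] V') (g : W ≃ₗ[ℂ] W') : WithLp 2 (V × W) ≃ₗ[ℂ] WithLp 2 (V' × W') :=
  ((WithLp.linearEquiv 2 ℂ (V × W)).trans (f.prodCongr g)).trans
    (WithLp.linearEquiv 2 ℂ (V' × W')).symm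

/-- `V ⊗ 0 ≅ 0`. -/
def unitZero (V : Type*) [NormedAddCommGroup V] [InnerProductSpace ℂ V] :
    V ⊗[ℂ] EuclideanSpace ℂ Empty ≃ₗᵢ[ℂ] EuclideanSpace ℂ Empty :=
  have h : ∀ x : V ⊗[ℂ] EuclideanSpace ℂ Empty, x = 0 := fun x => by
    induction x with
    | zero => rfl
    | add x y hx hy => rw [hx, hy, add_zero]
    | tmul v w => rw [Subsingleton.elim w 0, TensorProduct.tmul_zero]
  { toLinearEquiv := LinearEquiv.ofBijective (0 : _ →ₗ[ℂ] EuclideanSpace ℂ Empty)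
      ⟨fun x y _ => (h x).trans (h y).symm, fun _ => ⟨0, Subsingleton.elim _ _⟩⟩
    norm_map' := fun x => by rw [h x, map_zero, norm_zero, norm_zero] }

/-! Matrix entries of the maps above with respect to orthonormal bases. -/

section Entries

variable {ι κ μ ι' κ' μ' : Type*} [Fintype ι] [Fintype κ] [Fintype μ] [Fintype ι'] [Fintype κ']
  [Fintype μ'] [FiniteDimensional ℂ U] [FiniteDimensional ℂ V] [FiniteDimensional ℂ W]
  [FiniteDimensional ℂ V'] [FiniteDimensional ℂ W']

lemma entry_dual (e : V ⊗[ℂ] W ≃ₗᵢ[ℂ] U) (v : OrthonormalBasis ι ℂ V) (w : OrthonormalBasis κ ℂ W)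
    (u : OrthonormalBasis μ ℂ U) (i : ι × κ) (j : μ) :
    (starRingEnd ℂ) ⟪u j, e (v.tensorProduct w i)⟫_ℂ =
      ⟪dualBasis u j, dualCongr e
        (dualTensor ((dualBasis v).tensorProduct (dualBasis w) i))⟫_ℂ := by
  rw [inner_conj_symm, OrthonormalBasis.tensorProduct_apply',
    OrthonormalBasis.tensorProduct_apply', dualBasis_apply, dualBasis_apply, dualBasis_apply,
    dualTensor_riesz, dualCongr_riesz, HDual.inner_riesz]

lemma entry_interchange (f : V ⊗[ℂ] W ≃ₗᵢ[ℂ] A) (g : V' ⊗[ℂ] W' ≃ₗᵢ[ℂ] B)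
    (v : OrthonormalBasis ι ℂ V) (v' : OrthonormalBasis ι' ℂ V') (w : OrthonormalBasis κ ℂ W)
    (w' : OrthonormalBasis κ' ℂ W') (a : OrthonormalBasis μ ℂ A) (b : OrthonormalBasis μ' ℂ B)
    (i : (ι × ι') × (κ × κ')) (j : μ × μ') :
    ⟪a j.1, f (v.tensorProduct w (i.1.1, i.2.1))⟫_ℂ *
        ⟪b j.2, g (v'.tensorProduct w' (i.1.2, i.2.2))⟫_ℂ =
      ⟪a.tensorProduct b j, interchange f g
        ((v.tensorProduct v').tensorProduct (w.tensorProduct w') i)⟫_ℂ := by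
  simp only [OrthonormalBasis.tensorProduct_apply', interchange_tmul, TensorProduct.inner_tmul]

lemma entry_contract (h : Module.finrank ℂ V = 1) (v v₁ : OrthonormalBasis ι ℂ V)
    (u : OrthonormalBasis κ ℂ U) (u₁ : OrthonormalBasis κ' ℂ U) (w : OrthonormalBasis μ ℂ W)
    (w₁ : OrthonormalBasis μ' ℂ W) (i : (ι × κ) × (μ × ι)) (j : μ' × κ') :
    ⟪v₁ i.2.2, v i.1.1⟫_ℂ * (⟪w₁ j.1, w i.2.1⟫_ℂ * ⟪u i.1.2, u₁ j.2⟫_ℂ) =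
      ⟪w₁.tensorProduct (dualBasis u₁) j, contract h
        ((v.tensorProduct (dualBasis u)).tensorProduct (w.tensorProduct (dualBasis v₁)) i)⟫_ℂ := by
  simp only [OrthonormalBasis.tensorProduct_apply', contract_tmul, dualBasis_apply,
    HDual.ev_riesz]
  rw [show ⟪w₁ j.1 ⊗ₜ[ℂ] HDual.riesz U (u₁ j.2),
      ⟪v₁ i.2.2, v i.1.1⟫_ℂ • (w i.2.1 ⊗ₜ[ℂ] HDual.riesz U (u i.1.2))⟫_ℂ = _ from
    inner_smul_right (𝕜 := ℂ) (w₁ j.1 ⊗ₜ[ℂ] HDual.riesz U (u₁ j.2))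
      (w i.2.1 ⊗ₜ[ℂ] HDual.riesz U (u i.1.2)) _, TensorProduct.inner_tmul, HDual.inner_riesz]

lemma entry_diagonal [FiniteDimensional ℂ A] [FiniteDimensional ℂ B]
    (f : V ⊗[ℂ] A ≃ₗᵢ[ℂ] V') (g : V ⊗[ℂ] B ≃ₗᵢ[ℂ] W')
    (v : OrthonormalBasis ι ℂ V) (a : OrthonormalBasis κ ℂ A) (b : OrthonormalBasis κ' ℂ B)
    (v' : OrthonormalBasis μ ℂ V') (w' : OrthonormalBasis μ' ℂ W')
    (i₀ : ι) (i : κ ⊕ κ') (j : μ ⊕ μ') :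
    ⟪v'.prod w' j, diagonal f g (v.tensorProduct (a.prod b) (i₀, i))⟫_ℂ =
      Sum.elim (fun i => Sum.elim (fun j => ⟪v' j, f (v.tensorProduct a (i₀, i))⟫_ℂ) 0 j)
        (fun i => Sum.elim 0 (fun j => ⟪w' j, g (v.tensorProduct b (i₀, i))⟫_ℂ) j) i := by
  rcases i with i | i <;> rcases j with j | j <;> simp

end Entries

section SumEntries

variable {ι κ μ ι' κ' : Type*} [Fintype ι] [Fintype κ] [Fintype μ] [Fintype ι'] [Fintype κ']

lemma entry_sumMap (f : V →ₗ[ℂ] V') (g : W →ₗ[ℂ] W')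
    (v : OrthonormalBasis ι ℂ V) (w : OrthonormalBasis κ ℂ W) (v' : OrthonormalBasis ι' ℂ V')
    (w' : OrthonormalBasis κ' ℂ W') (i : ι ⊕ κ) (j : ι' ⊕ κ') :
    ⟪v'.prod w' j, sumMap f g (v.prod w i)⟫_ℂ =
      Sum.elim (fun i => Sum.elim (fun j => ⟪v' j, f (v i)⟫_ℂ) 0 j)
        (fun i => Sum.elim 0 (fun j => ⟪w' j, g (w i)⟫_ℂ) j) i := by
  rcases i with i | i <;> rcases j with j | j <;> simp

lemma entry_sumAssoc (v : OrthonormalBasis ι ℂ V) (w : OrthonormalBasis κ ℂ W)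
    (u : OrthonormalBasis μ ℂ U) (i : (ι ⊕ κ) ⊕ μ) (j : ι ⊕ (κ ⊕ μ)) :
    ⟪v.prod (w.prod u) j,
        LinearIsometryEquiv.withLpProdAssoc 2 ℂ V W U ((v.prod w).prod u i)⟫_ℂ =
      Sum.elim (Sum.elim (fun i => Sum.elim (fun j => ⟪v j, v i⟫_ℂ) 0 j)
          (fun i => Sum.elim 0 (Sum.elim (fun j => ⟪w j, w i⟫_ℂ) 0) j))
        (fun i => Sum.elim 0 (Sum.elim 0 (fun j => ⟪u j, u i⟫_ℂ)) j) i := by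
  rcases i with (i | i) | i <;> rcases j with j | j | j <;> simp

end SumEntries

end LinearAlgebra

/-! ### Smooth hermitian vector bundles over subsets of manifolds -/

section Bundles

variable {E H N : Type*} [NormedAddCommGroup E] [NormedSpace ℝ E] [TopologicalSpace H]
  {I : ModelWithCorners ℝ E H} [TopologicalSpace N] [ChartedSpace H N]
  {E' H' N' : Type*} [NormedAddCommGroup E'] [NormedSpace ℝ E'] [TopologicalSpace H']
  {I' : ModelWithCorners ℝ E' H'} [TopologicalSpace N'] [ChartedSpace H' N']
  {S D D' : Set N} {S' : Set N'}

variable (I) in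
/-- A complex function, given at the points of `S` lying in `D`, is smooth on `S ∩ D`. -/
def SmoothFun (S D : Set N) (f : ∀ s : S, (s : N) ∈ D → ℂ) : Prop :=
  ∃ g : N → ℂ, ContMDiffOn I 𝓘(ℝ, ℂ) ∞ g (S ∩ D) ∧ ∀ (s : S) (h : (s : N) ∈ D), g s = f s h

namespace SmoothFun

lemma congr {f f' : ∀ s : S, (s : N) ∈ D → ℂ} (hf : SmoothFun I S D f)
    (h : ∀ s hs, f s hs = f' s hs) : SmoothFun I S D f' := by
  obtain ⟨g, hg, hgf⟩ := hf
  exact ⟨g, hg, fun s hs => (hgf s hs).trans (h s hs)⟩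

lemma mono {f : ∀ s : S, (s : N) ∈ D → ℂ} (hf : SmoothFun I S D f) (h : D' ⊆ D) :
    SmoothFun I S D' (fun s hs => f s (h hs)) := by
  obtain ⟨g, hg, hgf⟩ := hf
  exact ⟨g, hg.mono (Set.inter_subset_inter_right _ h), fun s hs => hgf s (h hs)⟩

lemma const (c : ℂ) : SmoothFun I S D (fun _ _ => c) :=
  ⟨fun _ => c, contMDiffOn_const, fun _ _ => rfl⟩

lemma mul {f f' : ∀ s : S, (s : N) ∈ D → ℂ} (hf : SmoothFun I S D f) (hf' : SmoothFun I S D f') :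
    SmoothFun I S D (fun s hs => f s hs * f' s hs) := by
  obtain ⟨g, hg, hgf⟩ := hf
  obtain ⟨g', hg', hgf'⟩ := hf'
  refine ⟨fun x => g x * g' x, fun x hx => ?_, fun s hs => by simp [hgf s hs, hgf' s hs]⟩
  have h : ContDiff ℝ ∞ (fun p : ℂ × ℂ => p.1 * p.2) := contDiff_mul
  exact h.contMDiff.contMDiffAt.comp_contMDiffWithinAt x ((hg x hx).prodMk_space (hg' x hx))

lemma add {f f' : ∀ s : S, (s : N) ∈ D → ℂ} (hf : SmoothFun I S D f) (hf' : SmoothFun I S D f') :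
    SmoothFun I S D (fun s hs => f s hs + f' s hs) := by
  obtain ⟨g, hg, hgf⟩ := hf
  obtain ⟨g', hg', hgf'⟩ := hf'
  exact ⟨g + g', hg.add hg', fun s hs => by simp [hgf s hs, hgf' s hs]⟩

lemma sum {ι : Type*} (t : Finset ι) {f : ι → ∀ s : S, (s : N) ∈ D → ℂ}
    (hf : ∀ i, SmoothFun I S D (f i)) : SmoothFun I S D (fun s hs => ∑ i ∈ t, f i s hs) := by
  classical
  induction t using Finset.induction_on with
  | empty => simpa using const 0
  | insert a t ha ih =>
    refine ((hf a).add ih).congr fun s hs => ?_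
    rw [Finset.sum_insert ha]

lemma conj {f : ∀ s : S, (s : N) ∈ D → ℂ} (hf : SmoothFun I S D f) :
    SmoothFun I S D (fun s hs => (starRingEnd ℂ) (f s hs)) := by
  obtain ⟨g, hg, hgf⟩ := hf
  refine ⟨fun x => (starRingEnd ℂ) (g x), fun x hx => ?_, fun s hs => by simp [hgf s hs]⟩
  exact Complex.conjCLE.contDiff.contMDiff.contMDiffAt.comp_contMDiffWithinAt x (hg x hx)

lemma comp {f : ∀ s : S, (s : N) ∈ D → ℂ} (hf : SmoothFun I S D f) {φ : N' → N}
    (hφ : ContMDiff I' I ∞ φ) (hS : Set.MapsTo φ S' S) :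
    SmoothFun I' S' (φ ⁻¹' D) (fun s hs => f ⟨φ s, hS s.2⟩ hs) := by
  obtain ⟨g, hg, hgf⟩ := hf
  exact ⟨g ∘ φ, hg.comp hφ.contMDiffOn fun x hx => ⟨hS hx.1, hx.2⟩, fun s hs => hgf ⟨φ s, hS s.2⟩ hs⟩

/-- Smoothness is local. -/
lemma of_local {f : ∀ s : S, (s : N) ∈ D → ℂ}
    (h : ∀ x : S, (x : N) ∈ D → ∃ U : Set N, IsOpen U ∧ (x : N) ∈ U ∧
      SmoothFun I S (D ∩ U) (fun s hs => f s hs.1)) : SmoothFun I S D f := by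
  classical
  refine ⟨fun x => if h : x ∈ S ∧ x ∈ D then f ⟨x, h.1⟩ h.2 else 0, fun x hx => ?_,
    fun s hs => dif_pos ⟨s.2, hs⟩⟩
  obtain ⟨U, hU, hxU, g, hg, hgf⟩ := h ⟨x, hx.1⟩ hx.2
  have h1 := hg x ⟨hx.1, hx.2, hxU⟩
  have h2 : S ∩ (D ∩ U) ∈ nhdsWithin x (S ∩ D) := by
    rw [← Set.inter_assoc]
    exact Filter.inter_mem self_mem_nhdsWithin (mem_nhdsWithin_of_mem_nhds (hU.mem_nhds hxU))
  refine (h1.congr (fun y hy => ?_) ?_).mono_of_mem_nhdsWithin h2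
  · rw [dif_pos ⟨hy.1, hy.2.1⟩]
    exact (hgf ⟨y, hy.1⟩ hy.2).symm
  · rw [dif_pos (show x ∈ S ∧ x ∈ D from hx)]
    exact (hgf ⟨x, hx.1⟩ ⟨hx.2, hxU⟩).symm

end SmoothFun

variable (I) in
/-- A smooth hermitian vector bundle of finite rank over a subset `S` of a manifold: a family of
finite-dimensional hermitian vector spaces together with, around each point `p` of `S`, a local
orthonormal frame on `S ∩ dom p`, any two of these frames being related by a smooth
(unitary) matrix. -/
structure HermitianBundle (S : Set N) where
  fiber : S → Type
  [normedAddCommGroup : ∀ s, NormedAddCommGroup (fiber s)]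
  [innerProductSpace : ∀ s, InnerProductSpace ℂ (fiber s)]
  [finiteDimensional : ∀ s, FiniteDimensional ℂ (fiber s)]
  ι : S → Type
  [fintype : ∀ p, Fintype (ι p)]
  dom : S → Set N
  isOpen_dom : ∀ p, IsOpen (dom p)
  mem_dom : ∀ p : S, (p : N) ∈ dom p
  frame : ∀ p s : S, (s : N) ∈ dom p → OrthonormalBasis (ι p) ℂ (fiber s)
  smooth_frame : ∀ (p q : S) (i : ι p) (j : ι q),
    SmoothFun I S (dom p ∩ dom q) (fun s h => ⟪frame p s h.1 i, frame q s h.2 j⟫_ℂ)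

attribute [instance] HermitianBundle.normedAddCommGroup HermitianBundle.innerProductSpace
  HermitianBundle.finiteDimensional HermitianBundle.fintype

/-- A family of linear maps between the fibres of two bundles is smooth if its matrix entries with
respect to the local frames are smooth. -/
def IsSmoothFamily (A B : HermitianBundle I S) (φ : ∀ s, A.fiber s →ₗ[ℂ] B.fiber s) : Prop :=
  ∀ (p q : S) (i : A.ι p) (j : B.ι q), SmoothFun I S (A.dom p ∩ B.dom q)
    (fun s h => ⟪B.frame q s h.2 j, φ s (A.frame p s h.1 i)⟫_ℂ)

/-- It is enough to check smoothness in one pair of frames around each point. -/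
lemma IsSmoothFamily.of_diag {A B : HermitianBundle I S} {φ : ∀ s, A.fiber s →ₗ[ℂ] B.fiber s}
    (h : ∀ (p : S) (i : A.ι p) (j : B.ι p), SmoothFun I S (A.dom p ∩ B.dom p)
      (fun s h => ⟪B.frame p s h.2 j, φ s (A.frame p s h.1 i)⟫_ℂ)) : IsSmoothFamily A B φ := by
  intro p q i j
  refine SmoothFun.of_local fun x hx =>
    ⟨A.dom x ∩ B.dom x, (A.isOpen_dom x).inter (B.isOpen_dom x), ⟨A.mem_dom x, B.mem_dom x⟩, ?_⟩
  have key : SmoothFun I S ((A.dom p ∩ B.dom q) ∩ (A.dom x ∩ B.dom x)) (fun s hs =>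
      ∑ k, ∑ l, (⟪B.frame q s hs.1.2 j, B.frame x s hs.2.2 k⟫_ℂ *
        ⟪B.frame x s hs.2.2 k, φ s (A.frame x s hs.2.1 l)⟫_ℂ) *
          ⟪A.frame x s hs.2.1 l, A.frame p s hs.1.1 i⟫_ℂ) := by
    refine SmoothFun.sum _ fun k => SmoothFun.sum _ fun l => ?_
    refine SmoothFun.mul (SmoothFun.mul ?_ ?_) ?_
    · exact (B.smooth_frame q x j k).mono fun y hy => ⟨hy.1.2, hy.2.2⟩
    · exact (h x l k).mono fun y hy => hy.2
    · exact (A.smooth_frame x p l i).mono fun y hy => ⟨hy.2.1, hy.1.1⟩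
  refine key.congr fun s hs => ?_
  conv_rhs => rw [← (A.frame x s hs.2.1).sum_repr (A.frame p s hs.1.1 i), map_sum, inner_sum]
  rw [Finset.sum_comm]
  refine Finset.sum_congr rfl fun l _ => ?_
  rw [map_smul, inner_smul_right, ← Finset.sum_mul, OrthonormalBasis.sum_inner_mul_inner,
    OrthonormalBasis.repr_apply_apply, mul_comm]

lemma IsSmoothFamily.comp {A B C : HermitianBundle I S} {ψ : ∀ s, B.fiber s →ₗ[ℂ] C.fiber s}
    {φ : ∀ s, A.fiber s →ₗ[ℂ] B.fiber s} (hψ : IsSmoothFamily B C ψ) (hφ : IsSmoothFamily A B φ) :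
    IsSmoothFamily A C (fun s => ψ s ∘ₗ φ s) := by
  refine IsSmoothFamily.of_diag fun p i j => SmoothFun.of_local fun x hx =>
    ⟨B.dom x, B.isOpen_dom x, B.mem_dom x, ?_⟩
  refine SmoothFun.congr (f := fun s hs => ∑ k,
    ⟪C.frame p s hs.1.2 j, ψ s (B.frame x s hs.2 k)⟫_ℂ *
      ⟪B.frame x s hs.2 k, φ s (A.frame p s hs.1.1 i)⟫_ℂ) ?_ fun s hs => ?_
  · refine SmoothFun.sum _ fun k => SmoothFun.mul ?_ ?_
    · exact (hψ x p k j).mono fun y hy => ⟨hy.2, hy.1.2⟩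
    · exact (hφ p x i k).mono fun y hy => ⟨hy.1.1, hy.2⟩
  · rw [LinearMap.comp_apply]
    conv_rhs => rw [← (B.frame x s hs.2).sum_repr (φ s (A.frame p s hs.1.1 i)), map_sum,
      inner_sum]
    refine Finset.sum_congr rfl fun k _ => ?_
    rw [map_smul, inner_smul_right, OrthonormalBasis.repr_apply_apply, mul_comm]

/-- A hermitian isomorphism of hermitian vector bundles. -/
structure BundleIso (A B : HermitianBundle I S) where
  equiv : ∀ s, A.fiber s ≃ₗᵢ[ℂ] B.fiber s
  smooth : IsSmoothFamily A B (fun s => (equiv s).toLinearEquiv.toLinearMap)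

namespace BundleIso

/-- The identity isomorphism. -/
def refl (A : HermitianBundle I S) : BundleIso A A where
  equiv s := LinearIsometryEquiv.refl ℂ (A.fiber s)
  smooth p q i j := (A.smooth_frame q p j i).mono fun _ h => ⟨h.2, h.1⟩

/-- The inverse isomorphism. -/
def symm {A B : HermitianBundle I S} (f : BundleIso A B) : BundleIso B A where
  equiv s := (f.equiv s).symm
  smooth p q i j := (((f.smooth q p j i).mono fun _ h => ⟨h.2, h.1⟩).conj).congr fun s h => by
    rw [inner_conj_symm]
    exact (f.equiv s).inner_map_eq_flip _ _

/-- The composite of two isomorphisms. -/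
def trans {A B C : HermitianBundle I S} (f : BundleIso A B) (g : BundleIso B C) :
    BundleIso A C where
  equiv s := (f.equiv s).trans (g.equiv s)
  smooth := g.smooth.comp f.smooth

end BundleIso

namespace HermitianBundle

/-- The pull-back of a bundle along a smooth map. -/
def pullback (A : HermitianBundle I S) (f : N' → N) (hf : ContMDiff I' I ∞ f)
    (hS : Set.MapsTo f S' S) : HermitianBundle I' S' where
  fiber s := A.fiber ⟨f s, hS s.2⟩
  ι p := A.ι ⟨f p, hS p.2⟩
  dom p := f ⁻¹' A.dom ⟨f p, hS p.2⟩
  isOpen_dom _ := (A.isOpen_dom _).preimage hf.continuous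
  mem_dom p := A.mem_dom ⟨f p, hS p.2⟩
  frame p s h := A.frame ⟨f p, hS p.2⟩ ⟨f s, hS s.2⟩ h
  smooth_frame p q i j := (A.smooth_frame ⟨f p, hS p.2⟩ ⟨f q, hS q.2⟩ i j).comp hf hS

/-- The tensor product of two bundles. -/
def tensor (A B : HermitianBundle I S) : HermitianBundle I S where
  fiber s := A.fiber s ⊗[ℂ] B.fiber s
  ι p := A.ι p × B.ι p
  dom p := A.dom p ∩ B.dom p
  isOpen_dom p := (A.isOpen_dom p).inter (B.isOpen_dom p)
  mem_dom p := ⟨A.mem_dom p, B.mem_dom p⟩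
  frame p s h := (A.frame p s h.1).tensorProduct (B.frame p s h.2)
  smooth_frame p q i j := by
    refine (((A.smooth_frame p q i.1 j.1).mono (D' := (A.dom p ∩ B.dom p) ∩ (A.dom q ∩ B.dom q))
      fun _ h => ⟨h.1.1, h.2.1⟩).mul ((B.smooth_frame p q i.2 j.2).mono
        fun _ h => ⟨h.1.2, h.2.2⟩)).congr fun s hs => ?_
    rw [OrthonormalBasis.tensorProduct_apply', OrthonormalBasis.tensorProduct_apply',
      TensorProduct.inner_tmul]

/-- The dual bundle. -/
def dual (A : HermitianBundle I S) : HermitianBundle I S where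
  fiber s := HDual (A.fiber s)
  ι p := A.ι p
  dom p := A.dom p
  isOpen_dom p := A.isOpen_dom p
  mem_dom p := A.mem_dom p
  frame p s h := dualBasis (A.frame p s h)
  smooth_frame p q i j := by
    refine ((A.smooth_frame q p j i).mono fun _ h => ⟨h.2, h.1⟩).congr fun s hs => ?_
    rw [dualBasis_apply, dualBasis_apply, HDual.inner_riesz]

/-- The direct (orthogonal) sum of two bundles. -/
def sum (A B : HermitianBundle I S) : HermitianBundle I S where
  fiber s := WithLp 2 (A.fiber s × B.fiber s)
  ι p := A.ι p ⊕ B.ι p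
  dom p := A.dom p ∩ B.dom p
  isOpen_dom p := (A.isOpen_dom p).inter (B.isOpen_dom p)
  mem_dom p := ⟨A.mem_dom p, B.mem_dom p⟩
  frame p s h := (A.frame p s h.1).prod (B.frame p s h.2)
  smooth_frame p q i j := by
    rcases i with i | i <;> rcases j with j | j
    · refine ((A.smooth_frame p q i j).mono fun _ h => ⟨h.1.1, h.2.1⟩).congr fun s hs => ?_
      simp
    · refine (SmoothFun.const 0).congr fun s hs => ?_
      simp
    · refine (SmoothFun.const 0).congr fun s hs => ?_
      simp
    · refine ((B.smooth_frame p q i j).mono fun _ h => ⟨h.1.2, h.2.2⟩).congr fun s hs => ?_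
      simp

variable (I S) in
/-- The zero bundle. -/
def zero : HermitianBundle I S where
  fiber _ := EuclideanSpace ℂ Empty
  ι _ := Empty
  dom _ := Set.univ
  isOpen_dom _ := isOpen_univ
  mem_dom _ := Set.mem_univ _
  frame _ _ _ := EuclideanSpace.basisFun Empty ℂ
  smooth_frame _ _ i := i.elim

end HermitianBundle

end Bundles

section Constructions

variable {E H N : Type*} [NormedAddCommGroup E] [NormedSpace ℝ E] [TopologicalSpace H]
  {I : ModelWithCorners ℝ E H} [TopologicalSpace N] [ChartedSpace H N]
  {E' H' N' : Type*} [NormedAddCommGroup E'] [NormedSpace ℝ E'] [TopologicalSpace H']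
  {I' : ModelWithCorners ℝ E' H'} [TopologicalSpace N'] [ChartedSpace H' N']
  {S : Set N} {S' : Set N'} {A B C A' B' C' : HermitianBundle I S}

lemma IsSmoothFamily.sum {φ : ∀ s, A.fiber s →ₗ[ℂ] A'.fiber s}
    {ψ : ∀ s, B.fiber s →ₗ[ℂ] B'.fiber s} (hφ : IsSmoothFamily A A' φ)
    (hψ : IsSmoothFamily B B' ψ) :
    IsSmoothFamily (A.sum B) (A'.sum B') (fun s => sumMap (φ s) (ψ s)) :=
  IsSmoothFamily.of_diag fun p i j => by
    have key := fun (s : S) (h : (s : N) ∈ (A.dom p ∩ B.dom p) ∩ (A'.dom p ∩ B'.dom p)) =>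
      (entry_sumMap (φ s) (ψ s) (A.frame p s h.1.1) (B.frame p s h.1.2)
        (A'.frame p s h.2.1) (B'.frame p s h.2.2) i j).symm
    refine SmoothFun.congr ?_ key
    rcases i with i | i <;> rcases j with j | j
    · exact (hφ p p i j).mono fun _ h => ⟨h.1.1, h.2.1⟩
    · exact SmoothFun.const 0
    · exact SmoothFun.const 0
    · exact (hψ p p i j).mono fun _ h => ⟨h.1.2, h.2.2⟩

namespace BundleIso

/-- The pull-back of an isomorphism. -/
def pullback (φ : BundleIso A B) (f : N' → N) (hf : ContMDiff I' I ∞ f)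
    (hS : Set.MapsTo f S' S) : BundleIso (A.pullback f hf hS) (B.pullback f hf hS) where
  equiv s := φ.equiv ⟨f s, hS s.2⟩
  smooth p q i j := (φ.smooth ⟨f p, hS p.2⟩ ⟨f q, hS q.2⟩ i j).comp hf hS

/-- The isomorphism `A* ⊗ B* ≅ C*` dual to `A ⊗ B ≅ C`. -/
def dualTensor (φ : BundleIso (A.tensor B) C) : BundleIso (A.dual.tensor B.dual) C.dual where
  equiv s := (BundleGerbeTheory.dualTensor (V := A.fiber s) (W := B.fiber s)).trans
    (dualCongr (φ.equiv s))
  smooth := IsSmoothFamily.of_diag fun p i j => by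
    refine (φ.smooth p p i j).conj.congr fun s h => ?_
    exact entry_dual (φ.equiv s) (A.frame p s h.1.1) (B.frame p s h.1.2) (C.frame p s h.2) i j

/-- `(A ⊗ A') ⊗ (B ⊗ B') ≅ C ⊗ C'` for `A ⊗ B ≅ C` and `A' ⊗ B' ≅ C'`. -/
def interchange (φ : BundleIso (A.tensor B) C) (ψ : BundleIso (A'.tensor B') C') :
    BundleIso ((A.tensor A').tensor (B.tensor B')) (C.tensor C') where
  equiv s := BundleGerbeTheory.interchange (V := A.fiber s) (V' := A'.fiber s) (W := B.fiber s)
    (W' := B'.fiber s) (A := C.fiber s) (B := C'.fiber s) (φ.equiv s) (ψ.equiv s)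
  smooth := IsSmoothFamily.of_diag fun p i j => by
    refine (((φ.smooth p p (i.1.1, i.2.1) j.1).mono (D' := ((A.dom p ∩ A'.dom p) ∩
      (B.dom p ∩ B'.dom p)) ∩ (C.dom p ∩ C'.dom p))
        fun _ h => ⟨⟨h.1.1.1, h.1.2.1⟩, h.2.1⟩).mul
      ((ψ.smooth p p (i.1.2, i.2.2) j.2).mono
        fun _ h => ⟨⟨h.1.1.2, h.1.2.2⟩, h.2.2⟩)).congr fun s h => ?_
    exact entry_interchange (φ.equiv s) (ψ.equiv s) (A.frame p s h.1.1.1) (A'.frame p s h.1.1.2)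
      (B.frame p s h.1.2.1) (B'.frame p s h.1.2.2) (C.frame p s h.2.1) (C'.frame p s h.2.2) i j

/-- The contraction `(A ⊗ B*) ⊗ (C ⊗ A*) ≅ C ⊗ B*` for a line bundle `A`. -/
def contract (hA : ∀ s, Module.finrank ℂ (A.fiber s) = 1) :
    BundleIso ((A.tensor B.dual).tensor (C.tensor A.dual)) (C.tensor B.dual) where
  equiv s := BundleGerbeTheory.contract (U := B.fiber s) (V := A.fiber s) (W := C.fiber s) (hA s)
  smooth := IsSmoothFamily.of_diag fun p i j => by
    refine (((A.smooth_frame p p i.2.2 i.1.1).mono (D' := ((A.dom p ∩ B.dom p) ∩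
      (C.dom p ∩ A.dom p)) ∩ (C.dom p ∩ B.dom p)) fun _ h => ⟨h.1.1.1, h.1.1.1⟩).mul
      (((C.smooth_frame p p j.1 i.2.1).mono fun _ h => ⟨h.2.1, h.2.1⟩).mul
      ((B.smooth_frame p p i.1.2 j.2).mono fun _ h => ⟨h.2.2, h.2.2⟩))).congr fun s h => ?_
    exact entry_contract (hA s) (A.frame p s h.1.1.1) (A.frame p s h.1.2.2) (B.frame p s h.1.1.2)
      (B.frame p s h.2.2) (C.frame p s h.1.2.1) (C.frame p s h.2.1) i j

/-- The diagonal map `A ⊗ (B ⊕ B') ≅ C ⊕ C'` for `A ⊗ B ≅ C` and `A ⊗ B' ≅ C'`. -/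
def diagonal (φ : BundleIso (A.tensor B) C) (ψ : BundleIso (A.tensor B') C') :
    BundleIso (A.tensor (B.sum B')) (C.sum C') where
  equiv s := BundleGerbeTheory.diagonal (V := A.fiber s) (A := B.fiber s) (B := B'.fiber s)
    (V' := C.fiber s) (W' := C'.fiber s) (φ.equiv s) (ψ.equiv s)
  smooth := IsSmoothFamily.of_diag fun p i j => by
    have key := fun (s : S) (h : (s : N) ∈ (A.dom p ∩ (B.dom p ∩ B'.dom p)) ∩
        (C.dom p ∩ C'.dom p)) => (entry_diagonal (φ.equiv s) (ψ.equiv s) (A.frame p s h.1.1)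
      (B.frame p s h.1.2.1) (B'.frame p s h.1.2.2) (C.frame p s h.2.1) (C'.frame p s h.2.2)
      i.1 i.2 j).symm
    refine SmoothFun.congr ?_ key
    obtain ⟨i₀, i⟩ := i
    rcases i with i | i <;> rcases j with j | j
    · exact (φ.smooth p p (i₀, i) j).mono fun _ h => ⟨⟨h.1.1, h.1.2.1⟩, h.2.1⟩
    · exact SmoothFun.const 0
    · exact SmoothFun.const 0
    · exact (ψ.smooth p p (i₀, i) j).mono fun _ h => ⟨⟨h.1.1, h.1.2.2⟩, h.2.2⟩

/-- `A ⊕ B ≅ B ⊕ A`. -/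
def sumComm : BundleIso (A.sum B) (B.sum A) where
  equiv s := LinearIsometryEquiv.withLpProdComm 2 ℂ (A.fiber s) (B.fiber s)
  smooth := IsSmoothFamily.of_diag fun p i j => by
    rcases i with i | i <;> rcases j with j | j
    · refine (SmoothFun.const 0).congr fun s h => ?_
      change 0 = ⟪(B.frame p s h.2.1).prod (A.frame p s h.2.2) (Sum.inl j),
        LinearIsometryEquiv.withLpProdComm 2 ℂ (A.fiber s) (B.fiber s)
          ((A.frame p s h.1.1).prod (B.frame p s h.1.2) (Sum.inl i))⟫_ℂ
      simp
    · refine ((A.smooth_frame p p j i).mono fun _ h => ⟨h.1.1, h.1.1⟩).congr fun s h => ?_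
      change ⟪A.frame p s h.1.1 j, A.frame p s h.1.1 i⟫_ℂ =
        ⟪(B.frame p s h.2.1).prod (A.frame p s h.2.2) (Sum.inr j),
        LinearIsometryEquiv.withLpProdComm 2 ℂ (A.fiber s) (B.fiber s)
          ((A.frame p s h.1.1).prod (B.frame p s h.1.2) (Sum.inl i))⟫_ℂ
      simp
    · refine ((B.smooth_frame p p j i).mono fun _ h => ⟨h.1.2, h.1.2⟩).congr fun s h => ?_
      change ⟪B.frame p s h.1.2 j, B.frame p s h.1.2 i⟫_ℂ =
        ⟪(B.frame p s h.2.1).prod (A.frame p s h.2.2) (Sum.inl j),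
        LinearIsometryEquiv.withLpProdComm 2 ℂ (A.fiber s) (B.fiber s)
          ((A.frame p s h.1.1).prod (B.frame p s h.1.2) (Sum.inr i))⟫_ℂ
      simp
    · refine (SmoothFun.const 0).congr fun s h => ?_
      change 0 = ⟪(B.frame p s h.2.1).prod (A.frame p s h.2.2) (Sum.inr j),
        LinearIsometryEquiv.withLpProdComm 2 ℂ (A.fiber s) (B.fiber s)
          ((A.frame p s h.1.1).prod (B.frame p s h.1.2) (Sum.inr i))⟫_ℂ
      simp

/-- `(A ⊕ B) ⊕ C ≅ A ⊕ (B ⊕ C)`. -/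
def sumAssoc : BundleIso ((A.sum B).sum C) (A.sum (B.sum C)) where
  equiv s := LinearIsometryEquiv.withLpProdAssoc 2 ℂ (A.fiber s) (B.fiber s) (C.fiber s)
  smooth := IsSmoothFamily.of_diag fun p i j => by
    have key := fun (s : S) (h : (s : N) ∈ ((A.dom p ∩ B.dom p) ∩ C.dom p) ∩
        (A.dom p ∩ (B.dom p ∩ C.dom p))) =>
      (entry_sumAssoc (A.frame p s h.2.1) (B.frame p s h.2.2.1) (C.frame p s h.2.2.2) i j).symm
    refine SmoothFun.congr ?_ key
    rcases i with (i | i) | i <;> rcases j with j | j | j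
    · exact (A.smooth_frame p p j i).mono fun _ h => ⟨h.2.1, h.2.1⟩
    · exact SmoothFun.const 0
    · exact SmoothFun.const 0
    · exact SmoothFun.const 0
    · exact (B.smooth_frame p p j i).mono fun _ h => ⟨h.2.2.1, h.2.2.1⟩
    · exact SmoothFun.const 0
    · exact SmoothFun.const 0
    · exact SmoothFun.const 0
    · exact (C.smooth_frame p p j i).mono fun _ h => ⟨h.2.2.2, h.2.2.2⟩

/-- `A ⊕ 0 ≅ A`. -/
def sumZero : BundleIso (A.sum (HermitianBundle.zero I S)) A where
  equiv s := LinearIsometryEquiv.withLpProdUnique 2 ℂ (A.fiber s) (EuclideanSpace ℂ Empty)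
  smooth := IsSmoothFamily.of_diag fun p i j => by
    rcases i with i | i
    · refine ((A.smooth_frame p p j i).mono fun _ h => ⟨h.2, h.2⟩).congr fun s h => ?_
      change ⟪A.frame p s h.2 j, A.frame p s h.2 i⟫_ℂ =
        ⟪A.frame p s h.2 j, LinearIsometryEquiv.withLpProdUnique 2 ℂ (A.fiber s)
          (EuclideanSpace ℂ Empty)
          ((A.frame p s h.1.1).prod (EuclideanSpace.basisFun Empty ℂ) (Sum.inl i))⟫_ℂ
      simp
    · exact i.elim


end BundleIso
end Constructions

/-! ### Locally split maps and bundle gerbes -/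

section Gerbes

variable {EM HM : Type*} [NormedAddCommGroup EM] [NormedSpace ℝ EM] [TopologicalSpace HM]
  {IM : ModelWithCorners ℝ EM HM} {M : Type*} [TopologicalSpace M] [ChartedSpace HM M]
  {E H : Type*} [NormedAddCommGroup E] [NormedSpace ℝ E] [TopologicalSpace H]
  {I : ModelWithCorners ℝ E H} {N : Type*} [TopologicalSpace N] [ChartedSpace H N]
  {E' H' : Type*} [NormedAddCommGroup E'] [NormedSpace ℝ E'] [TopologicalSpace H']
  {I' : ModelWithCorners ℝ E' H'} {N' : Type*} [TopologicalSpace N'] [ChartedSpace H' N']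

variable (IM M I N) in
/-- A subset `carrier` of a manifold `N` together with a smooth map `proj : carrier → M` which
admits smooth local sections around every point of `M`. (The values of `proj` outside `carrier`
are irrelevant.) -/
structure SplitSpace where
  carrier : Set N
  proj : N → M
  smooth_proj : ContMDiffOn I IM ∞ proj carrier
  locally_split : ∀ x : M, ∃ U : Set M, IsOpen U ∧ x ∈ U ∧ ∃ s : M → N,
    ContMDiffOn IM I ∞ s U ∧ Set.MapsTo s U carrier ∧ ∀ u ∈ U, proj (s u) = u

namespace SplitSpace

variable (𝒴 : SplitSpace IM M I N) (𝒳 : SplitSpace IM M I' N')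

/-- The fibre product `Y^[2]`. -/
def sq : Set (N × N) := {p | p.1 ∈ 𝒴.carrier ∧ p.2 ∈ 𝒴.carrier ∧ 𝒴.proj p.1 = 𝒴.proj p.2}

/-- The threefold fibre product `Y^[3]`. -/
def cube : Set (N × N × N) :=
  {p | p.1 ∈ 𝒴.carrier ∧ p.2.1 ∈ 𝒴.carrier ∧ p.2.2 ∈ 𝒴.carrier ∧
    𝒴.proj p.1 = 𝒴.proj p.2.1 ∧ 𝒴.proj p.2.1 = 𝒴.proj p.2.2}

/-- The fibre product `Y ×_M X`, as a locally split space over `M`. -/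
def prod : SplitSpace IM M (I.prod I') (N × N') where
  carrier := {p | p.1 ∈ 𝒴.carrier ∧ p.2 ∈ 𝒳.carrier ∧ 𝒴.proj p.1 = 𝒳.proj p.2}
  proj p := 𝒴.proj p.1
  smooth_proj := 𝒴.smooth_proj.comp contMDiffOn_fst fun _ h => h.1
  locally_split x := by
    obtain ⟨U, hU, hxU, s, hs, hsm, hsp⟩ := 𝒴.locally_split x
    obtain ⟨V, hV, hxV, t, ht, htm, htp⟩ := 𝒳.locally_split x
    refine ⟨U ∩ V, hU.inter hV, ⟨hxU, hxV⟩, fun m => (s m, t m), ?_, ?_, fun u hu => hsp u hu.1⟩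
    · exact (hs.mono Set.inter_subset_left).prodMk (ht.mono Set.inter_subset_right)
    · intro u hu
      exact ⟨hsm hu.1, htm hu.2, (hsp u hu.1).trans (htp u hu.2).symm⟩

variable {𝒴} in
/-- The point `(y₁, y₂)` of `Y^[2]`. -/
abbrev pair {y₁ y₂ : 𝒴.carrier} (h : 𝒴.proj y₁ = 𝒴.proj y₂) : 𝒴.sq :=
  ⟨(y₁, y₂), y₁.2, y₂.2, h⟩

variable {𝒴} in
/-- The point `(y₁, y₂, y₃)` of `Y^[3]`. -/
abbrev triple {y₁ y₂ y₃ : 𝒴.carrier} (h : 𝒴.proj y₁ = 𝒴.proj y₂) (h' : 𝒴.proj y₂ = 𝒴.proj y₃) :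
    𝒴.cube :=
  ⟨(y₁, y₂, y₃), y₁.2, y₂.2, y₃.2, h, h'⟩

lemma mapsTo_cube₁₂ : Set.MapsTo (fun t : N × N × N => (t.1, t.2.1)) 𝒴.cube 𝒴.sq :=
  fun _ h => ⟨h.1, h.2.1, h.2.2.2.1⟩

lemma mapsTo_cube₂₃ : Set.MapsTo (fun t : N × N × N => (t.2.1, t.2.2)) 𝒴.cube 𝒴.sq :=
  fun _ h => ⟨h.2.1, h.2.2.1, h.2.2.2.2⟩

lemma mapsTo_cube₁₃ : Set.MapsTo (fun t : N × N × N => (t.1, t.2.2)) 𝒴.cube 𝒴.sq :=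
  fun _ h => ⟨h.1, h.2.2.1, h.2.2.2.1.trans h.2.2.2.2⟩

lemma mapsTo_prod_sq_fst : Set.MapsTo (fun p : (N × N') × (N × N') => (p.1.1, p.2.1))
    (𝒴.prod 𝒳).sq 𝒴.sq :=
  fun _ h => ⟨h.1.1, h.2.1.1, h.2.2⟩

lemma mapsTo_prod_sq_snd : Set.MapsTo (fun p : (N × N') × (N × N') => (p.1.2, p.2.2))
    (𝒴.prod 𝒳).sq 𝒳.sq :=
  fun _ h => ⟨h.1.2.1, h.2.1.2.1, h.1.2.2.symm.trans (h.2.2.trans h.2.1.2.2)⟩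

lemma mapsTo_prod_cube_fst :
    Set.MapsTo (fun t : (N × N') × (N × N') × (N × N') => (t.1.1, t.2.1.1, t.2.2.1))
      (𝒴.prod 𝒳).cube 𝒴.cube :=
  fun _ h => ⟨h.1.1, h.2.1.1, h.2.2.1.1, h.2.2.2.1, h.2.2.2.2⟩

lemma mapsTo_prod_cube_snd :
    Set.MapsTo (fun t : (N × N') × (N × N') × (N × N') => (t.1.2, t.2.1.2, t.2.2.2))
      (𝒴.prod 𝒳).cube 𝒳.cube :=
  fun _ h => ⟨h.1.2.1, h.2.1.2.1, h.2.2.1.2.1,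
    h.1.2.2.symm.trans (h.2.2.2.1.trans h.2.1.2.2),
    h.2.1.2.2.symm.trans (h.2.2.2.2.trans h.2.2.1.2.2)⟩

end SplitSpace

variable {𝒴 : SplitSpace IM M I N} {𝒳 : SplitSpace IM M I' N'}

/-- The bundle with fibre `A_(y₁, y₂)` over `Y^[3]`. -/
abbrev cube₁₂ (A : HermitianBundle (I.prod I) 𝒴.sq) :
    HermitianBundle (I.prod (I.prod I)) 𝒴.cube :=
  A.pullback (fun t : N × N × N => (t.1, t.2.1))
    (contMDiff_fst.prodMk (contMDiff_fst.comp contMDiff_snd)) 𝒴.mapsTo_cube₁₂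

/-- The bundle with fibre `A_(y₂, y₃)` over `Y^[3]`. -/
abbrev cube₂₃ (A : HermitianBundle (I.prod I) 𝒴.sq) :
    HermitianBundle (I.prod (I.prod I)) 𝒴.cube :=
  A.pullback (fun t : N × N × N => (t.2.1, t.2.2))
    ((contMDiff_fst.comp contMDiff_snd).prodMk (contMDiff_snd.comp contMDiff_snd)) 𝒴.mapsTo_cube₂₃

/-- The bundle with fibre `A_(y₁, y₃)` over `Y^[3]`. -/
abbrev cube₁₃ (A : HermitianBundle (I.prod I) 𝒴.sq) :
    HermitianBundle (I.prod (I.prod I)) 𝒴.cube :=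
  A.pullback (fun t : N × N × N => (t.1, t.2.2))
    (contMDiff_fst.prodMk (contMDiff_snd.comp contMDiff_snd)) 𝒴.mapsTo_cube₁₃

/-- A smooth hermitian product `A_(y₁, y₂) ⊗ A_(y₂, y₃) ≅ A_(y₁, y₃)`. -/
abbrev GerbeProduct (A : HermitianBundle (I.prod I) 𝒴.sq) :=
  BundleIso ((cube₁₂ A).tensor (cube₂₃ A)) (cube₁₃ A)

/-- The product at the point `(y₁, y₂, y₃)`. -/
def GerbeProduct.app {A : HermitianBundle (I.prod I) 𝒴.sq} (m : GerbeProduct A)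
    {y₁ y₂ y₃ : 𝒴.carrier} (h : 𝒴.proj y₁ = 𝒴.proj y₂) (h' : 𝒴.proj y₂ = 𝒴.proj y₃) :
    A.fiber (𝒴.pair h) ⊗[ℂ] A.fiber (𝒴.pair h') ≃ₗᵢ[ℂ] A.fiber (𝒴.pair (h.trans h')) :=
  m.equiv (𝒴.triple h h')

/-- Associativity of a product. -/
def GerbeProduct.IsAssoc {A : HermitianBundle (I.prod I) 𝒴.sq} (m : GerbeProduct A) : Prop :=
  ∀ (y₁ y₂ y₃ y₄ : 𝒴.carrier) (h₁ : 𝒴.proj y₁ = 𝒴.proj y₂) (h₂ : 𝒴.proj y₂ = 𝒴.proj y₃)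
    (h₃ : 𝒴.proj y₃ = 𝒴.proj y₄) (a : A.fiber (𝒴.pair h₁)) (b : A.fiber (𝒴.pair h₂))
    (c : A.fiber (𝒴.pair h₃)),
    m.app (h₁.trans h₂) h₃ (m.app h₁ h₂ (a ⊗ₜ b) ⊗ₜ c) =
      m.app h₁ (h₂.trans h₃) (a ⊗ₜ m.app h₂ h₃ (b ⊗ₜ c))

/-- The bundle with fibre `A_(y₁, y₂)` over `(Y ×_M X)^[2]`. -/
abbrev prodFst (A : HermitianBundle (I.prod I) 𝒴.sq) (𝒳 : SplitSpace IM M I' N') :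
    HermitianBundle ((I.prod I').prod (I.prod I')) (𝒴.prod 𝒳).sq :=
  A.pullback (fun p : (N × N') × (N × N') => (p.1.1, p.2.1))
    ((contMDiff_fst.comp contMDiff_fst).prodMk (contMDiff_fst.comp contMDiff_snd))
    (𝒴.mapsTo_prod_sq_fst 𝒳)

/-- The bundle with fibre `A_(x₁, x₂)` over `(Y ×_M X)^[2]`. -/
abbrev prodSnd (𝒴 : SplitSpace IM M I N) (A : HermitianBundle (I'.prod I') 𝒳.sq) :
    HermitianBundle ((I.prod I').prod (I.prod I')) (𝒴.prod 𝒳).sq :=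
  A.pullback (fun p : (N × N') × (N × N') => (p.1.2, p.2.2))
    ((contMDiff_snd.comp contMDiff_fst).prodMk (contMDiff_snd.comp contMDiff_snd))
    (𝒴.mapsTo_prod_sq_snd 𝒳)

/-- A product on `A` induces one on its pull-back to `(Y ×_M X)^[2]`. -/
def GerbeProduct.prodFst {A : HermitianBundle (I.prod I) 𝒴.sq} (m : GerbeProduct A)
    (𝒳 : SplitSpace IM M I' N') : GerbeProduct (prodFst A 𝒳) where
  equiv t := (m.pullback
    (fun t : (N × N') × (N × N') × (N × N') => (t.1.1, t.2.1.1, t.2.2.1))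
    ((contMDiff_fst.comp contMDiff_fst).prodMk
      ((contMDiff_fst.comp (contMDiff_fst.comp contMDiff_snd)).prodMk
        (contMDiff_fst.comp (contMDiff_snd.comp contMDiff_snd))))
    (𝒴.mapsTo_prod_cube_fst 𝒳)).equiv t
  smooth := (m.pullback
    (fun t : (N × N') × (N × N') × (N × N') => (t.1.1, t.2.1.1, t.2.2.1))
    ((contMDiff_fst.comp contMDiff_fst).prodMk
      ((contMDiff_fst.comp (contMDiff_fst.comp contMDiff_snd)).prodMk
        (contMDiff_fst.comp (contMDiff_snd.comp contMDiff_snd))))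
    (𝒴.mapsTo_prod_cube_fst 𝒳)).smooth

/-- A product on `A` induces one on its pull-back to `(Y ×_M X)^[2]`. -/
def GerbeProduct.prodSnd (𝒴 : SplitSpace IM M I N) {A : HermitianBundle (I'.prod I') 𝒳.sq}
    (m : GerbeProduct A) : GerbeProduct (prodSnd 𝒴 A) where
  equiv t := (m.pullback
    (fun t : (N × N') × (N × N') × (N × N') => (t.1.2, t.2.1.2, t.2.2.2))
    ((contMDiff_snd.comp contMDiff_fst).prodMk
      ((contMDiff_snd.comp (contMDiff_fst.comp contMDiff_snd)).prodMk
        (contMDiff_snd.comp (contMDiff_snd.comp contMDiff_snd))))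
    (𝒴.mapsTo_prod_cube_snd 𝒳)).equiv t
  smooth := (m.pullback
    (fun t : (N × N') × (N × N') × (N × N') => (t.1.2, t.2.1.2, t.2.2.2))
    ((contMDiff_snd.comp contMDiff_fst).prodMk
      ((contMDiff_snd.comp (contMDiff_fst.comp contMDiff_snd)).prodMk
        (contMDiff_snd.comp (contMDiff_snd.comp contMDiff_snd))))
    (𝒴.mapsTo_prod_cube_snd 𝒳)).smooth

/-- Products on `A` and `B` induce one on `A ⊗ B`. -/
def GerbeProduct.tensor {A B : HermitianBundle (I.prod I) 𝒴.sq} (m : GerbeProduct A)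
    (n : GerbeProduct B) : GerbeProduct (A.tensor B) :=
  BundleIso.interchange m n

lemma GerbeProduct.IsAssoc.prodFst {A : HermitianBundle (I.prod I) 𝒴.sq} {m : GerbeProduct A}
    (hm : m.IsAssoc) (𝒳 : SplitSpace IM M I' N') : (m.prodFst 𝒳).IsAssoc :=
  fun z₁ z₂ z₃ z₄ h₁ h₂ h₃ a b c => hm ⟨z₁.1.1, z₁.2.1⟩ ⟨z₂.1.1, z₂.2.1⟩ ⟨z₃.1.1, z₃.2.1⟩
    ⟨z₄.1.1, z₄.2.1⟩ h₁ h₂ h₃ a b c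

lemma GerbeProduct.IsAssoc.prodSnd (𝒴 : SplitSpace IM M I N)
    {A : HermitianBundle (I'.prod I') 𝒳.sq} {m : GerbeProduct A} (hm : m.IsAssoc) :
    (m.prodSnd 𝒴).IsAssoc :=
  fun z₁ z₂ z₃ z₄ h₁ h₂ h₃ a b c => hm ⟨z₁.1.2, z₁.2.2.1⟩ ⟨z₂.1.2, z₂.2.2.1⟩
    ⟨z₃.1.2, z₃.2.2.1⟩ ⟨z₄.1.2, z₄.2.2.1⟩ (z₁.2.2.2.symm.trans (h₁.trans z₂.2.2.2))
    (z₂.2.2.2.symm.trans (h₂.trans z₃.2.2.2)) (z₃.2.2.2.symm.trans (h₃.trans z₄.2.2.2)) a b c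

lemma GerbeProduct.IsAssoc.tensor {A B : HermitianBundle (I.prod I) 𝒴.sq} {m : GerbeProduct A}
    {n : GerbeProduct B} (hm : m.IsAssoc) (hn : n.IsAssoc) : (m.tensor n).IsAssoc :=
  fun y₁ y₂ y₃ y₄ h₁ h₂ h₃ a b c => interchange_assoc
    (m.app h₁ h₂) (m.app h₂ h₃) (m.app (h₁.trans h₂) h₃) (m.app h₁ (h₂.trans h₃))
    (n.app h₁ h₂) (n.app h₂ h₃) (n.app (h₁.trans h₂) h₃) (n.app h₁ (h₂.trans h₃))
    (hm y₁ y₂ y₃ y₄ h₁ h₂ h₃) (hn y₁ y₂ y₃ y₄ h₁ h₂ h₃) a b c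

/-- The product dual to a product. -/
def GerbeProduct.dual {A : HermitianBundle (I.prod I) 𝒴.sq} (m : GerbeProduct A) :
    GerbeProduct A.dual :=
  BundleIso.dualTensor m

lemma GerbeProduct.dual_app {A : HermitianBundle (I.prod I) 𝒴.sq} (m : GerbeProduct A)
    {y₁ y₂ y₃ : 𝒴.carrier} (h : 𝒴.proj y₁ = 𝒴.proj y₂) (h' : 𝒴.proj y₂ = 𝒴.proj y₃)
    (a : A.fiber (𝒴.pair h)) (b : A.fiber (𝒴.pair h')) :
    m.dual.app h h' (HDual.riesz (A.fiber (𝒴.pair h)) a ⊗ₜ[ℂ]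
      HDual.riesz (A.fiber (𝒴.pair h')) b) =
        HDual.riesz (A.fiber (𝒴.pair (h.trans h'))) (m.app h h' (a ⊗ₜ b)) :=
  dualMul_riesz (m.app h h') a b

lemma GerbeProduct.IsAssoc.dual {A : HermitianBundle (I.prod I) 𝒴.sq} {m : GerbeProduct A}
    (hm : m.IsAssoc) : m.dual.IsAssoc := by
  intro y₁ y₂ y₃ y₄ h₁ h₂ h₃ a b c
  obtain ⟨a, rfl⟩ := (HDual.riesz (A.fiber (𝒴.pair h₁))).surjective a
  obtain ⟨b, rfl⟩ := (HDual.riesz (A.fiber (𝒴.pair h₂))).surjective b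
  obtain ⟨c, rfl⟩ := (HDual.riesz (A.fiber (𝒴.pair h₃))).surjective c
  refine (congrArg (fun x => m.dual.app (h₁.trans h₂) h₃ (x ⊗ₜ HDual.riesz _ c))
    (m.dual_app h₁ h₂ a b)).trans ?_
  refine Eq.trans ?_ (congrArg (fun x => m.dual.app h₁ (h₂.trans h₃) (HDual.riesz _ a ⊗ₜ x))
    (m.dual_app h₂ h₃ b c)).symm
  refine (m.dual_app _ _ _ _).trans (Eq.trans ?_ (m.dual_app _ _ _ _).symm)
  exact congrArg _ (hm _ _ _ _ h₁ h₂ h₃ a b c)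

variable (𝒴) in
/-- A bundle gerbe `(L, Y)` over `M`: a hermitian line bundle over `Y^[2]` with an associative
smooth hermitian product. -/
structure BundleGerbe where
  bundle : HermitianBundle (I.prod I) 𝒴.sq
  rank_one : ∀ p, Module.finrank ℂ (bundle.fiber p) = 1
  product : GerbeProduct bundle
  assoc : GerbeProduct.IsAssoc product

namespace BundleGerbe

/-- The dual bundle gerbe `(L*, Y)`. -/
def dual (L : BundleGerbe 𝒴) : BundleGerbe 𝒴 where
  bundle := L.bundle.dual
  rank_one p := finrank_dual.trans (L.rank_one p)
  product := GerbeProduct.dual L.product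
  assoc := GerbeProduct.IsAssoc.dual L.assoc

/-- The product `(L ⊗ J, Y ×_M X)` of two bundle gerbes. -/
def prod (L : BundleGerbe 𝒴) (J : BundleGerbe 𝒳) : BundleGerbe (𝒴.prod 𝒳) where
  bundle := (prodFst L.bundle 𝒳).tensor (prodSnd 𝒴 J.bundle)
  rank_one p := (Module.finrank_tensorProduct (R := ℂ)).trans (by
    erw [L.rank_one, J.rank_one])
  product := (GerbeProduct.prodFst L.product 𝒳).tensor (GerbeProduct.prodSnd 𝒴 J.product)
  assoc := (GerbeProduct.IsAssoc.prodFst L.assoc 𝒳).tensor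
    (GerbeProduct.IsAssoc.prodSnd 𝒴 J.assoc)

/-- The bundle gerbe `δ(K)`, `δ(K)_(y₁, y₂) = K_{y₂} ⊗ K_{y₁}*`, of a hermitian line bundle on
`Y`, with the product given by the natural pairing. -/
def delta (K : HermitianBundle I 𝒴.carrier) (hK : ∀ y, Module.finrank ℂ (K.fiber y) = 1) :
    BundleGerbe 𝒴 where
  bundle :=
    (K.pullback (S' := 𝒴.sq) Prod.snd contMDiff_snd (fun _ h => h.2.1)).tensor
      (K.pullback (S' := 𝒴.sq) Prod.fst contMDiff_fst (fun _ h => h.1)).dual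
  rank_one p := (Module.finrank_tensorProduct (R := ℂ)).trans (by
    erw [finrank_dual, hK, hK])
  product := BundleIso.contract
    (A := K.pullback (S' := 𝒴.cube) (fun t : N × N × N => t.2.1)
      (contMDiff_fst.comp contMDiff_snd) (fun _ h => h.2.1))
    (B := K.pullback (S' := 𝒴.cube) (fun t : N × N × N => t.1) contMDiff_fst (fun _ h => h.1))
    (C := K.pullback (S' := 𝒴.cube) (fun t : N × N × N => t.2.2)
      (contMDiff_snd.comp contMDiff_snd) (fun _ h => h.2.2.1)) (fun _ => hK _)
  assoc y₁ y₂ y₃ y₄ h₁ h₂ h₃ a b c :=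
    contract_assoc (V₁ := K.fiber y₁) (V₂ := K.fiber y₂) (V₃ := K.fiber y₃) (V₄ := K.fiber y₄)
      (hK y₂) (hK y₃) a b c

end BundleGerbe

end Gerbes

/-! ### Stable isomorphisms -/

section Modules

variable {EM HM : Type*} [NormedAddCommGroup EM] [NormedSpace ℝ EM] [TopologicalSpace HM]
  {IM : ModelWithCorners ℝ EM HM} {M : Type*} [TopologicalSpace M] [ChartedSpace HM M]
  {E H : Type*} [NormedAddCommGroup E] [NormedSpace ℝ E] [TopologicalSpace H]
  {I : ModelWithCorners ℝ E H} {N : Type*} [TopologicalSpace N] [ChartedSpace H N]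
  {E' H' : Type*} [NormedAddCommGroup E'] [NormedSpace ℝ E'] [TopologicalSpace H']
  {I' : ModelWithCorners ℝ E' H'} {N' : Type*} [TopologicalSpace N'] [ChartedSpace H' N']
  {𝒴 : SplitSpace IM M I N} {𝒳 : SplitSpace IM M I' N'}

/-- An isomorphism of bundle gerbes over the same space `Y`, covering the identity of `Y`. -/
structure GerbeIso (P Q : BundleGerbe 𝒴) where
  iso : BundleIso P.bundle Q.bundle
  map_product : ∀ (y₁ y₂ y₃ : 𝒴.carrier) (h : 𝒴.proj y₁ = 𝒴.proj y₂)
    (h' : 𝒴.proj y₂ = 𝒴.proj y₃) (a : P.bundle.fiber (𝒴.pair h))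
    (b : P.bundle.fiber (𝒴.pair h')),
    iso.equiv (𝒴.pair (h.trans h')) (P.product.app h h' (a ⊗ₜ b)) =
      Q.product.app h h' (iso.equiv (𝒴.pair h) a ⊗ₜ iso.equiv (𝒴.pair h') b)

/-- A trivialisation of a bundle gerbe `P`: a hermitian line bundle `K` on `Y` and an
isomorphism `δ(K) ≅ P`. -/
structure Trivialisation (P : BundleGerbe 𝒴) where
  line : HermitianBundle I 𝒴.carrier
  rank_one : ∀ y, Module.finrank ℂ (line.fiber y) = 1
  iso : GerbeIso (BundleGerbe.delta line rank_one) P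

/-- A stable isomorphism from `(L, Y)` to `(J, X)`: a trivialisation of `L* ⊗ J` over
`Y ×_M X`. -/
abbrev StableIso (L : BundleGerbe 𝒴) (J : BundleGerbe 𝒳) := Trivialisation (L.dual.prod J)

/-! ### Bundle gerbe modules -/

/-- A bundle gerbe module: a hermitian vector bundle `E` of finite rank on `Y` and an
action `L_(y₁, y₂) ⊗ E_{y₂} ≅ E_{y₁}`, compatible with the product of `L`. -/
structure GerbeModule (L : BundleGerbe 𝒴) where
  bundle : HermitianBundle I 𝒴.carrier
  act : BundleIso
    (L.bundle.tensor (bundle.pullback (S' := 𝒴.sq) Prod.snd contMDiff_snd (fun _ h => h.2.1)))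
    (bundle.pullback (S' := 𝒴.sq) Prod.fst contMDiff_fst (fun _ h => h.1))
  act_assoc : ∀ (y₁ y₂ y₃ : 𝒴.carrier) (h : 𝒴.proj y₁ = 𝒴.proj y₂)
    (h' : 𝒴.proj y₂ = 𝒴.proj y₃) (a : L.bundle.fiber (𝒴.pair h))
    (b : L.bundle.fiber (𝒴.pair h')) (e : bundle.fiber y₃),
    act.equiv (𝒴.pair h) (a ⊗ₜ act.equiv (𝒴.pair h') (b ⊗ₜ e)) =
      act.equiv (𝒴.pair (h.trans h')) (L.product.app h h' (a ⊗ₜ b) ⊗ₜ e)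

namespace GerbeModule

variable {L : BundleGerbe 𝒴}

/-- The action at the point `(y₁, y₂)`. -/
def actAt (E : GerbeModule L) {y₁ y₂ : 𝒴.carrier} (h : 𝒴.proj y₁ = 𝒴.proj y₂) :
    L.bundle.fiber (𝒴.pair h) ⊗[ℂ] E.bundle.fiber y₂ ≃ₗᵢ[ℂ] E.bundle.fiber y₁ :=
  E.act.equiv (𝒴.pair h)

/-- Two bundle gerbe modules are isomorphic if they are isomorphic as (complex) vector bundles
by an isomorphism preserving the action. -/
def Isomorphic (E F : GerbeModule L) : Prop :=
  ∃ φ : ∀ y, E.bundle.fiber y ≃ₗ[ℂ] F.bundle.fiber y,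
    IsSmoothFamily E.bundle F.bundle (fun y => (φ y).toLinearMap) ∧
    IsSmoothFamily F.bundle E.bundle (fun y => (φ y).symm.toLinearMap) ∧
    ∀ (y₁ y₂ : 𝒴.carrier) (h : 𝒴.proj y₁ = 𝒴.proj y₂) (a : L.bundle.fiber (𝒴.pair h))
      (e : E.bundle.fiber y₂), φ y₁ (E.actAt h (a ⊗ₜ e)) = F.actAt h (a ⊗ₜ φ y₂ e)

lemma Isomorphic.of_iso {E F : GerbeModule L} (φ : BundleIso E.bundle F.bundle)
    (hφ : ∀ (y₁ y₂ : 𝒴.carrier) (h : 𝒴.proj y₁ = 𝒴.proj y₂) (a : L.bundle.fiber (𝒴.pair h))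
      (e : E.bundle.fiber y₂), φ.equiv y₁ (E.actAt h (a ⊗ₜ e)) = F.actAt h (a ⊗ₜ φ.equiv y₂ e)) :
    E.Isomorphic F :=
  ⟨fun y => (φ.equiv y).toLinearEquiv, φ.smooth, φ.symm.smooth, hφ⟩

lemma Isomorphic.refl (E : GerbeModule L) : E.Isomorphic E :=
  .of_iso (BundleIso.refl _) fun _ _ _ _ _ => rfl

lemma Isomorphic.symm {E F : GerbeModule L} (h : E.Isomorphic F) : F.Isomorphic E := by
  obtain ⟨φ, h₁, h₂, hφ⟩ := h
  refine ⟨fun y => (φ y).symm, h₂, h₁, fun y₁ y₂ h a e => ?_⟩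
  obtain ⟨e, rfl⟩ := (φ y₂).surjective e
  rw [← hφ, LinearEquiv.symm_apply_apply, LinearEquiv.symm_apply_apply]

lemma Isomorphic.trans {E F G : GerbeModule L} (h : E.Isomorphic F) (h' : F.Isomorphic G) :
    E.Isomorphic G := by
  obtain ⟨φ, h₁, h₂, hφ⟩ := h
  obtain ⟨ψ, h₁', h₂', hψ⟩ := h'
  refine ⟨fun y => (φ y).trans (ψ y), h₁'.comp h₁, h₂.comp h₂', fun y₁ y₂ h a e => ?_⟩
  rw [LinearEquiv.trans_apply, hφ, hψ, LinearEquiv.trans_apply]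

instance setoid (L : BundleGerbe 𝒴) : Setoid (GerbeModule L) where
  r := Isomorphic
  iseqv := ⟨Isomorphic.refl, Isomorphic.symm, Isomorphic.trans⟩

/-- The direct sum of two bundle gerbe modules. -/
def sum (E F : GerbeModule L) : GerbeModule L where
  bundle := E.bundle.sum F.bundle
  act :=
    { equiv := fun p => (BundleIso.diagonal E.act F.act).equiv p
      smooth := (BundleIso.diagonal E.act F.act).smooth }
  act_assoc y₁ y₂ y₃ h h' a b e := congrArg₂ (fun v w => WithLp.toLp 2 (v, w))
    (E.act_assoc y₁ y₂ y₃ h h' a b e.fst) (F.act_assoc y₁ y₂ y₃ h h' a b e.snd)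

/-- The zero module. -/
def zero (L : BundleGerbe 𝒴) : GerbeModule L where
  bundle := HermitianBundle.zero I 𝒴.carrier
  act :=
    { equiv := fun p => unitZero (L.bundle.fiber p)
      smooth := fun _ _ i => i.2.elim }
  act_assoc _ _ _ _ _ _ _ _ := Subsingleton.elim (α := EuclideanSpace ℂ Empty) _ _

end GerbeModule

/-- The semigroup `Mod(L)` of isomorphism classes of bundle gerbe modules. -/
def GerbeMod (L : BundleGerbe 𝒴) := Quotient (GerbeModule.setoid L)

namespace GerbeMod

variable {L : BundleGerbe 𝒴}

/-- The class of a bundle gerbe module. -/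
def mk (E : GerbeModule L) : GerbeMod L := Quotient.mk _ E

/-- The sum in `Mod(L)` is induced by the direct sum. -/
def add (x y : GerbeMod L) : GerbeMod L :=
  Quotient.map₂ GerbeModule.sum (by
    rintro E E' ⟨φ, h₁, h₂, hφ⟩ F F' ⟨ψ, h₃, h₄, hψ⟩
    refine ⟨fun y => sumEquiv (φ y) (ψ y), h₁.sum h₃, h₂.sum h₄, fun y₁ y₂ h a e => ?_⟩
    exact congrArg₂ (fun v w => WithLp.toLp 2 (v, w)) (hφ y₁ y₂ h a e.fst) (hψ y₁ y₂ h a e.snd)) x y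

instance : Add (GerbeMod L) := ⟨add⟩

instance : Zero (GerbeMod L) := ⟨mk (GerbeModule.zero L)⟩

instance : AddCommMonoid (GerbeMod L) where
  nsmul := nsmulRec
  add_assoc x y z := by
    induction x using Quotient.inductionOn
    induction y using Quotient.inductionOn
    induction z using Quotient.inductionOn
    exact Quotient.sound (.of_iso BundleIso.sumAssoc fun _ _ _ _ _ => rfl)
  zero_add x := by
    induction x using Quotient.inductionOn
    exact Quotient.sound
      (.of_iso (BundleIso.sumComm.trans BundleIso.sumZero) fun _ _ _ _ _ => rfl)
  add_zero x := by
    induction x using Quotient.inductionOn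
    exact Quotient.sound (.of_iso BundleIso.sumZero fun _ _ _ _ _ => rfl)
  add_comm x y := by
    induction x using Quotient.inductionOn
    induction y using Quotient.inductionOn
    exact Quotient.sound (.of_iso BundleIso.sumComm fun _ _ _ _ _ => rfl)

lemma mk_add_mk (E F : GerbeModule L) : mk E + mk F = mk (E.sum F) := rfl

end GerbeMod

/-- Bundle gerbe K-theory: the Grothendieck group of `Mod(L)`. -/
abbrev GerbeK (L : BundleGerbe 𝒴) := Algebra.GrothendieckAddGroup (GerbeMod L)

/-- Let `t : δ(K) ≅ L* ⊗ J` be a stable isomorphism. A `J`-module `F` is induced by an `L`-module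
`E` if `K*_(y, x) ⊗ E_y` is the pull-back of `F` to `Y ×_M X`, the action of `J` on `F`
being the one obtained from the action of `L` on `E` and from `t`: for `zᵢ = (yᵢ, xᵢ)` in the
same fibre, `k ∈ K_{z₂}`, `ξ ∈ K_{z₁}*`, `l ∈ L_(y₁, y₂)`, the element `t(k ⊗ ξ)(l)` of
`J_(x₁, x₂)` maps `η ⊗ e ∈ K_{z₂}* ⊗ E_{y₂} = F_{x₂}` to
`η(k) ξ ⊗ le ∈ K_{z₁}* ⊗ E_{y₁} = F_{x₁}`. -/
def StableIso.Induces {L : BundleGerbe 𝒴} {J : BundleGerbe 𝒳} (T : StableIso L J)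
    (E : GerbeModule L) (F : GerbeModule J) : Prop :=
  ∃ θ : BundleIso
      (T.line.dual.tensor (E.bundle.pullback (S' := (𝒴.prod 𝒳).carrier) Prod.fst contMDiff_fst
        (fun _ h => h.1)))
      (F.bundle.pullback (S' := (𝒴.prod 𝒳).carrier) Prod.snd contMDiff_snd (fun _ h => h.2.1)),
    ∀ (z₁ z₂ : (𝒴.prod 𝒳).carrier) (h : (𝒴.prod 𝒳).proj z₁ = (𝒴.prod 𝒳).proj z₂)
      (k : T.line.fiber z₂) (ξ : HDual (T.line.fiber z₁))
      (l : L.bundle.fiber (𝒴.pair (y₁ := ⟨z₁.1.1, z₁.2.1⟩) (y₂ := ⟨z₂.1.1, z₂.2.1⟩) h))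
      (η : HDual (T.line.fiber z₂)) (e : E.bundle.fiber ⟨z₂.1.1, z₂.2.1⟩),
      F.actAt (y₁ := ⟨z₁.1.2, z₁.2.2.1⟩) (y₂ := ⟨z₂.1.2, z₂.2.2.1⟩)
          (z₁.2.2.2.symm.trans (h.trans z₂.2.2.2))
          (evalAt l (T.iso.iso.equiv ((𝒴.prod 𝒳).pair h) (k ⊗ₜ ξ)) ⊗ₜ θ.equiv z₂ (η ⊗ₜ e)) =
        η.ev k • θ.equiv z₁ (ξ ⊗ₜ E.actAt (y₁ := ⟨z₁.1.1, z₁.2.1⟩) (y₂ := ⟨z₂.1.1, z₂.2.1⟩) h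
          (l ⊗ₜ e))

end Modules

/-! ### Integral Čech cohomology and the Dixmier-Douady class -/

section Cech

variable (M : Type*) [TopologicalSpace M]

/-- An open cover of `M`, indexed by the points of `M`. Every open cover is refined by such
a cover. -/
structure PointCover where
  set : M → Set M
  isOpen_set : ∀ x, IsOpen (set x)
  mem_set : ∀ x, x ∈ set x

namespace PointCover

variable {M}

/-- The intersection `U_{x₀} ∩ ⋯ ∩ U_{xₚ}`. -/
def inter (U : PointCover M) {p : ℕ} (x : Fin p → M) : Set M := {m | ∀ i, m ∈ U.set (x i)}

/-- `V` refines `U`, preserving indices. -/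
def Refines (V U : PointCover M) : Prop := ∀ x, V.set x ⊆ U.set x

/-- The common refinement of two covers. -/
def inf (U V : PointCover M) : PointCover M where
  set x := U.set x ∩ V.set x
  isOpen_set x := (U.isOpen_set x).inter (V.isOpen_set x)
  mem_set x := ⟨U.mem_set x, V.mem_set x⟩

/-- The group of integral Čech `p`-cochains of a cover. -/
abbrev Cochain (U : PointCover M) (p : ℕ) := ∀ x : Fin (p + 1) → M, LocallyConstant (U.inter x) ℤ

/-- The restriction of locally constant functions to a smaller set. -/
def restrict {A B : Set M} (h : A ⊆ B) : LocallyConstant B ℤ →+ LocallyConstant A ℤ where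
  toFun f := f.comap ⟨Set.inclusion h, continuous_inclusion h⟩
  map_zero' := rfl
  map_add' _ _ := rfl

lemma inter_subset_face (U : PointCover M) {p : ℕ} (x : Fin (p + 2) → M) (i : Fin (p + 2)) :
    U.inter x ⊆ U.inter (x ∘ i.succAbove) :=
  fun _ hm j => hm (i.succAbove j)

lemma Refines.inter_subset {V U : PointCover M} (h : V.Refines U) {p : ℕ} (x : Fin p → M) :
    V.inter x ⊆ U.inter x :=
  fun _ hm j => h _ (hm j)

/-- The Čech differential. -/
def d (U : PointCover M) (p : ℕ) : U.Cochain p →+ U.Cochain (p + 1) where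
  toFun c x := ∑ i : Fin (p + 2), (-1 : ℤ) ^ (i : ℕ) •
    restrict (U.inter_subset_face x i) (c (x ∘ i.succAbove))
  map_zero' := by
    ext x : 1
    simp
  map_add' c c' := by
    ext x : 1
    simp [Finset.sum_add_distrib]

/-- The restriction of cochains to a refinement. -/
def refine {V U : PointCover M} (h : V.Refines U) (p : ℕ) : U.Cochain p →+ V.Cochain p where
  toFun c x := restrict (h.inter_subset x) (c x)
  map_zero' := rfl
  map_add' _ _ := rfl

lemma d_refine {V U : PointCover M} (h : V.Refines U) (p : ℕ) (c : U.Cochain p) :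
    V.d p (refine h p c) = refine h (p + 1) (U.d p c) := by
  ext x : 1
  change (∑ i : Fin (p + 2), (-1 : ℤ) ^ (i : ℕ) • restrict (V.inter_subset_face x i)
    (restrict (h.inter_subset _) (c (x ∘ i.succAbove)))) = restrict (h.inter_subset x) (∑ i : Fin (p + 2), (-1 : ℤ) ^ (i : ℕ) •
    restrict (U.inter_subset_face x i) (c (x ∘ i.succAbove)))
  refine Eq.trans ?_ (map_sum (restrict (h.inter_subset x)) _ _).symm
  refine Finset.sum_congr rfl fun i _ => ?_
  refine Eq.trans ?_ (map_zsmul (restrict (h.inter_subset x)) _ _).symm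
  rfl

end PointCover

/-- Čech cocycles of degree `p + 1` on some open cover. -/
def Cocycle (p : ℕ) :=
  Σ U : PointCover M, {c : U.Cochain (p + 1) // U.d (p + 1) c = 0}

/-- Two cocycles are equivalent if they become cohomologous on a common refinement. -/
instance Cocycle.setoid (p : ℕ) : Setoid (Cocycle M p) where
  r a b := ∃ (V : PointCover M) (h : V.Refines a.1) (h' : V.Refines b.1) (β : V.Cochain p),
    PointCover.refine h (p + 1) a.2.1 - PointCover.refine h' (p + 1) b.2.1 = V.d p β
  iseqv :=
    { refl := fun a => ⟨a.1, fun _ => subset_rfl, fun _ => subset_rfl, 0, by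
        rw [map_zero, sub_self]⟩
      symm := by
        rintro a b ⟨V, h, h', β, hβ⟩
        exact ⟨V, h', h, -β, by rw [map_neg, ← hβ, neg_sub]⟩
      trans := by
        rintro a b c ⟨V, h₁, h₂, β, hβ⟩ ⟨W, h₃, h₄, γ, hγ⟩
        have hV : (V.inf W).Refines V := fun _ => Set.inter_subset_left
        have hW : (V.inf W).Refines W := fun _ => Set.inter_subset_right
        refine ⟨V.inf W, fun x => (hV x).trans (h₁ x), fun x => (hW x).trans (h₄ x),
          PointCover.refine hV p β + PointCover.refine hW p γ, ?_⟩
        rw [map_add, PointCover.d_refine, PointCover.d_refine, ← hβ, ← hγ, map_sub, map_sub]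
        have e₁ : PointCover.refine hV (p + 1) (PointCover.refine h₂ (p + 1) b.2.1) =
          PointCover.refine hW (p + 1) (PointCover.refine h₃ (p + 1) b.2.1) := rfl
        rw [e₁, sub_add_sub_cancel]
        rfl }

/-- The Čech cohomology group `H^{p+1}(M, ℤ)`, as the set of classes of cocycles. -/
def CechH (p : ℕ) := Quotient (Cocycle.setoid M p)

end Cech

section DixmierDouady

variable {EM HM : Type*} [NormedAddCommGroup EM] [NormedSpace ℝ EM] [TopologicalSpace HM]
  {IM : ModelWithCorners ℝ EM HM} {M : Type*} [TopologicalSpace M] [ChartedSpace HM M]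
  {E H : Type*} [NormedAddCommGroup E] [NormedSpace ℝ E] [TopologicalSpace H]
  {I : ModelWithCorners ℝ E H} {N : Type*} [TopologicalSpace N] [ChartedSpace H N]
  {𝒴 : SplitSpace IM M I N}

/-- Local data computing the Dixmier-Douady class of a bundle gerbe: an open cover `U` with
local sections `s_x` of `Y → M` over `U_x`, smooth unit sections `σ_xy` of
`(s_x, s_y)^{-1} L` over `U_x ∩ U_y`, and smooth real functions `w_xyz` on `U_x ∩ U_y ∩ U_z` with
`σ_xy σ_yz = exp (2 π i w_xyz) σ_xz`. The integral cocycle is the coboundary of `w`. -/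
structure DixmierDouadyData (L : BundleGerbe 𝒴) where
  cover : PointCover M
  sec : M → M → N
  smooth_sec : ∀ x, ContMDiffOn IM I ∞ (sec x) (cover.set x)
  sec_mem : ∀ x, ∀ m ∈ cover.set x, sec x m ∈ 𝒴.carrier
  proj_sec : ∀ x, ∀ m ∈ cover.set x, 𝒴.proj (sec x m) = m
  unit : ∀ (x y m : M) (hx : m ∈ cover.set x) (hy : m ∈ cover.set y),
    L.bundle.fiber (𝒴.pair (y₁ := ⟨sec x m, sec_mem x m hx⟩) (y₂ := ⟨sec y m, sec_mem y m hy⟩)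
      ((proj_sec x m hx).trans (proj_sec y m hy).symm))
  norm_unit : ∀ x y m hx hy, ‖unit x y m hx hy‖ = 1
  smooth_unit : ∀ (x y : M) (p : 𝒴.sq) (i : L.bundle.ι p),
    SmoothFun IM (cover.set x ∩ cover.set y) {m | (sec x m, sec y m) ∈ L.bundle.dom p}
      (fun m hm => ⟪L.bundle.frame p (𝒴.pair (y₁ := ⟨sec x m, sec_mem x m m.2.1⟩)
        (y₂ := ⟨sec y m, sec_mem y m m.2.2⟩)
        ((proj_sec x m m.2.1).trans (proj_sec y m m.2.2).symm)) hm i, unit x y m m.2.1 m.2.2⟫_ℂ)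
  w : (Fin 3 → M) → M → ℝ
  smooth_w : ∀ x, ContMDiffOn IM 𝓘(ℝ, ℝ) ∞ (w x) (cover.inter x)
  product_unit : ∀ (x : Fin 3 → M) (m : M) (hm : m ∈ cover.inter x),
    L.product.app _ _ (unit (x 0) (x 1) m (hm 0) (hm 1) ⊗ₜ unit (x 1) (x 2) m (hm 1) (hm 2)) =
      Complex.exp (2 * Real.pi * Complex.I * w x m) • unit (x 0) (x 2) m (hm 0) (hm 2)
  cocycle : {c : cover.Cochain 3 // cover.d 3 c = 0}
  cocycle_eq : ∀ (x : Fin 4 → M) (m : cover.inter x),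
    ((cocycle.1 x m : ℤ) : ℝ) = ∑ i : Fin 4, (-1) ^ (i : ℕ) * w (x ∘ i.succAbove) m

/-- `κ` is the Dixmier-Douady class of `L` in `H³(M, ℤ)`. -/
def IsDixmierDouadyClass (L : BundleGerbe 𝒴) (κ : CechH M 2) : Prop :=
  ∃ D : DixmierDouadyData L, κ = Quotient.mk _ ⟨D.cover, D.cocycle⟩

end DixmierDouady

/-! ### Honest manifolds -/

section Manifolds

variable {EM HM : Type*} [NormedAddCommGroup EM] [NormedSpace ℝ EM] [TopologicalSpace HM]
  {IM : ModelWithCorners ℝ EM HM} {M : Type*} [TopologicalSpace M] [ChartedSpace HM M]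
  {E H : Type*} [NormedAddCommGroup E] [NormedSpace ℝ E] [TopologicalSpace H]
  {I : ModelWithCorners ℝ E H} {N : Type*} [TopologicalSpace N] [ChartedSpace H N]

variable (I IM) in
/-- A smooth map `π : Y → M` is locally split if it admits smooth local sections around every
point of `M`. -/
def IsLocallySplit (π : N → M) : Prop :=
  ∀ x : M, ∃ U : Set M, IsOpen U ∧ x ∈ U ∧ ∃ s : M → N,
    ContMDiffOn IM I ∞ s U ∧ ∀ u ∈ U, π (s u) = u

/-- A manifold `Y` with a smooth locally split map to `M`. -/
def SplitSpace.ofMap (π : N → M) (hπ : ContMDiff I IM ∞ π) (hs : IsLocallySplit IM I π) :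
    SplitSpace IM M I N where
  carrier := Set.univ
  proj := π
  smooth_proj := hπ.contMDiffOn
  locally_split x := by
    obtain ⟨U, hU, hx, s, hs, h⟩ := hs x
    exact ⟨U, hU, hx, s, hs, Set.mapsTo_univ _ _, h⟩

end Manifolds

end BundleGerbeTheory

end

open BundleGerbeTheory

/-! Part 1 is descent. Write Z for the fibre product of Y and X over M. For z₁, z₂ in one fibre of Z
→ M, the stable isomorphism t identifies K_{z₂} ⊗ K_{z₁}* with L* ⊗ J. All these are hermitian
lines, so unit vectors κ₁, κ₂, l determine a unit vector j with t(κ₂ ⊗ κ₁*) = l* ⊗ j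
(`StableIso.Corr`). Letting j send κ₂* ⊗ e to κ₁* ⊗ le turns K* ⊗ E into a module over the pull-back
of J to Z: unitarity of t makes this independent of the choice of unit vectors, and compatibility of
t with products makes it associative. For two points of Z with the same x, the unit of J over the
diagonal acts as a canonical isomorphism between the fibres. These isomorphisms satisfy the cocycle
condition, so they are a descent datum along Z → X, and Z → X has local sections because Y → M has.
`exists_descent` then yields F.

The class of F depends only on that of E. An isomorphism E ≅ E' gives a map F_x → F'_x through each
y over x, and since these maps commute with the unit of J they do not depend on y
(`Twist.Ind.isomorphic`). The sum of two isomorphisms θ is again of this kind, so the map of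
semigroups is additive. Its inverse is the same construction with K instead of K*, because θ : K* ⊗
E ≅ F flips to K ⊗ F ≅ E (`BundleIso.exists_flip`). Both directions are instances of the structure
`Twist`, which isolates what the construction needs from t. The statement about K-groups is
functoriality of the Grothendieck group.

Part 2 reduces to part 1 by producing a stable isomorphism (`nonempty_stableIso`). If the integral
cocycles of L and J differ by dβ on a common refinement, then w - w' - β is a smooth real Čech
2-cocycle, hence a coboundary δg by a partition of unity (`PointCover.exists_cobounding`). The unit
sections τ_xy = exp(2πi g_xy) σ_xy* ⊗ σ'_xy of P = L* ⊗ J then satisfy τ_xy τ_yz = τ_xz exactly.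
Such a cocycle trivialises P: glue the lines P_(s_x, z) by means of τ to a line bundle with fibre
K_z = P_(s(z), z); multiplication K_{z₁} ⊗ P_(z₁, z₂) → K_{z₂} is an isomorphism P ≅ δ(K)
(`UnitCocycle.trivialisation`).

All bundles here are families of fibres over subsets of manifolds, with frames attached. Smoothness
is therefore handled pointwise, through smooth sections along maps (`SmAt`, `SecAt`), and a family
of maps is smooth when it carries a smooth frame to smooth sections. -/

noncomputable section

namespace BundleGerbeTheory

/-! ### Smoothness at a point of a map defined on a subset of a manifold -/

section SmoothAt

variable {E' H' N' : Type*} [NormedAddCommGroup E'] [NormedSpace ℝ E'] [TopologicalSpace H']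
  {I' : ModelWithCorners ℝ E' H'} [TopologicalSpace N'] [ChartedSpace H' N']
  {E H N : Type*} [NormedAddCommGroup E] [NormedSpace ℝ E] [TopologicalSpace H]
  {I : ModelWithCorners ℝ E H} [TopologicalSpace N] [ChartedSpace H N]
  {E₂ H₂ N₂ : Type*} [NormedAddCommGroup E₂] [NormedSpace ℝ E₂] [TopologicalSpace H₂]
  {I₂ : ModelWithCorners ℝ E₂ H₂} [TopologicalSpace N₂] [ChartedSpace H₂ N₂]
  {S : Set N} {T : Set N'} {T₂ : Set N₂}

variable (I' I) in
/-- Smoothness at a point of a map which is defined on a subset `T` of a manifold. -/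
def SmAt (f : T → N) (t₀ : T) : Prop :=
  ContMDiffWithinAt I' I ∞ (Function.extend Subtype.val f fun _ => f t₀) T t₀

namespace SmAt

/-- Only the germ along `T` matters, so the particular extension in the definition of `SmAt` may be
replaced by any other. -/
lemma of_contMDiffWithinAt {f : T → N} {t₀ : T} {g : N' → N}
    (hg : ContMDiffWithinAt I' I ∞ g T t₀) (h : ∀ᶠ t in nhds t₀, f t = g t) :
    SmAt I' I f t₀ := by
  refine hg.congr_of_eventuallyEq ?_ ?_
  · have h' : ∀ᶠ t : T in nhds t₀,
        Function.extend Subtype.val f (fun _ => f t₀) (t : N') = g t := by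
      filter_upwards [h] with t ht
      rw [Subtype.val_injective.extend_apply, ht]
    exact (eventually_nhds_subtype_iff T t₀ _).mp h'
  · rw [Subtype.val_injective.extend_apply]
    exact h.self_of_nhds

lemma exists_extension {f : T → N} {t₀ : T} (hf : SmAt I' I f t₀) :
    ∃ g : N' → N, ContMDiffWithinAt I' I ∞ g T t₀ ∧ ∀ t : T, g t = f t :=
  ⟨_, hf, fun _ => Subtype.val_injective.extend_apply _ _ _⟩

lemma congr {f f' : T → N} {t₀ : T} (hf : SmAt I' I f t₀) (h : ∀ᶠ t in nhds t₀, f' t = f t) :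
    SmAt I' I f' t₀ := by
  obtain ⟨g, hg, hgf⟩ := hf.exists_extension
  exact of_contMDiffWithinAt hg (h.mono fun t ht => ht.trans (hgf t).symm)

lemma continuousAt {f : T → N} {t₀ : T} (hf : SmAt I' I f t₀) : ContinuousAt f t₀ := by
  obtain ⟨g, hg, hgf⟩ := hf.exists_extension
  have h := (continuousWithinAt_iff_continuousAt_domRestrict g t₀.2).mp hg.continuousWithinAt
  exact h.congr (Filter.Eventually.of_forall hgf)

lemma continuousAt_subtype {f : T → S} {t₀ : T} (hf : SmAt I' I (fun t => (f t : N)) t₀) :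
    ContinuousAt f t₀ :=
  Topology.IsInducing.subtypeVal.continuousAt_iff.mpr hf.continuousAt

lemma comp {f : T → N} {φ : T₂ → T} {t₀ : T₂} (hf : SmAt I' I f (φ t₀))
    (hφ : SmAt I₂ I' (fun t => (φ t : N')) t₀) : SmAt I₂ I (fun t => f (φ t)) t₀ := by
  obtain ⟨g, hg, hgf⟩ := hf.exists_extension
  obtain ⟨ψ, hψ, hψφ⟩ := hφ.exists_extension
  refine of_contMDiffWithinAt (g := g ∘ ψ) (ContMDiffWithinAt.comp (t := T) (t₀ : N₂) ?_ hψ ?_) ?_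
  · rw [hψφ]; exact hg
  · intro x hx
    rw [hψφ ⟨x, hx⟩]
    exact (φ _).2
  · exact Filter.Eventually.of_forall fun t => by rw [Function.comp_apply, hψφ, hgf]

lemma contMDiffAt_comp {f : T → N} {t₀ : T} {g : N → N₂} (hg : ContMDiffAt I I₂ ∞ g (f t₀))
    (hf : SmAt I' I f t₀) : SmAt I' I₂ (fun t => g (f t)) t₀ := by
  obtain ⟨f', hf', hff'⟩ := hf.exists_extension
  refine of_contMDiffWithinAt (g := g ∘ f') ?_ (Filter.Eventually.of_forall fun t => by
    rw [Function.comp_apply, hff'])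
  refine ContMDiffAt.comp_contMDiffWithinAt _ ?_ hf'
  rw [hff']; exact hg

lemma of_contMDiffAt {g : N' → N} {t₀ : T} (hg : ContMDiffAt I' I ∞ g t₀) :
    SmAt I' I (fun t : T => g t) t₀ :=
  of_contMDiffWithinAt hg.contMDiffWithinAt (Filter.Eventually.of_forall fun _ => rfl)

lemma val (t₀ : T) : SmAt I' I' (fun t : T => (t : N')) t₀ :=
  of_contMDiffAt (g := fun t => t) contMDiffAt_id

lemma const (c : N) (t₀ : T) : SmAt I' I (fun _ : T => c) t₀ :=
  of_contMDiffAt (g := fun _ => c) contMDiffAt_const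

lemma prodMk {f : T → N} {g : T → N₂} {t₀ : T} (hf : SmAt I' I f t₀) (hg : SmAt I' I₂ g t₀) :
    SmAt I' (I.prod I₂) (fun t => (f t, g t)) t₀ := by
  obtain ⟨f', hf', hff'⟩ := hf.exists_extension
  obtain ⟨g', hg', hgg'⟩ := hg.exists_extension
  exact of_contMDiffWithinAt (g := fun t => (f' t, g' t)) (hf'.prodMk hg')
    (Filter.Eventually.of_forall fun t => by rw [hff', hgg'])

lemma fst {f : T → N × N₂} {t₀ : T} (hf : SmAt I' (I.prod I₂) f t₀) :
    SmAt I' I (fun t => (f t).1) t₀ :=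
  contMDiffAt_comp (g := Prod.fst) contMDiffAt_fst hf

lemma snd {f : T → N × N₂} {t₀ : T} (hf : SmAt I' (I.prod I₂) f t₀) :
    SmAt I' I₂ (fun t => (f t).2) t₀ :=
  contMDiffAt_comp (g := Prod.snd) contMDiffAt_snd hf

lemma mul {f g : T → ℂ} {t₀ : T} (hf : SmAt I' 𝓘(ℝ, ℂ) f t₀) (hg : SmAt I' 𝓘(ℝ, ℂ) g t₀) :
    SmAt I' 𝓘(ℝ, ℂ) (fun t => f t * g t) t₀ := by
  obtain ⟨f', hf', hff'⟩ := hf.exists_extension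
  obtain ⟨g', hg', hgg'⟩ := hg.exists_extension
  refine of_contMDiffWithinAt (g := fun t => f' t * g' t) ?_
    (Filter.Eventually.of_forall fun t => by rw [hff', hgg'])
  have h : ContDiff ℝ ∞ (fun p : ℂ × ℂ => p.1 * p.2) := contDiff_mul
  exact h.contMDiff.contMDiffAt.comp_contMDiffWithinAt (t₀ : N') (hf'.prodMk_space hg')

lemma add {f g : T → ℂ} {t₀ : T} (hf : SmAt I' 𝓘(ℝ, ℂ) f t₀) (hg : SmAt I' 𝓘(ℝ, ℂ) g t₀) :
    SmAt I' 𝓘(ℝ, ℂ) (fun t => f t + g t) t₀ := by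
  obtain ⟨f', hf', hff'⟩ := hf.exists_extension
  obtain ⟨g', hg', hgg'⟩ := hg.exists_extension
  exact of_contMDiffWithinAt (g := fun t => f' t + g' t) (hf'.add hg')
    (Filter.Eventually.of_forall fun t => by rw [hff', hgg'])

lemma sum {ι : Type*} (s : Finset ι) {f : ι → T → ℂ} {t₀ : T}
    (hf : ∀ i, SmAt I' 𝓘(ℝ, ℂ) (f i) t₀) : SmAt I' 𝓘(ℝ, ℂ) (fun t => ∑ i ∈ s, f i t) t₀ := by
  classical
  induction s using Finset.induction_on with
  | empty => simpa using const 0 t₀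
  | insert a s ha ih =>
    exact ((hf a).add ih).congr (Filter.Eventually.of_forall fun t => Finset.sum_insert ha)

lemma conj {f : T → ℂ} {t₀ : T} (hf : SmAt I' 𝓘(ℝ, ℂ) f t₀) :
    SmAt I' 𝓘(ℝ, ℂ) (fun t => (starRingEnd ℂ) (f t)) t₀ :=
  contMDiffAt_comp (g := fun z => (starRingEnd ℂ) z)
    Complex.conjCLE.contDiff.contMDiff.contMDiffAt hf

end SmAt

/-- With `SmoothFun.of_smAt` this translates between the partially defined functions that enter the
definition of a bundle and total functions smooth at a point, whose values away from `D` are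
arbitrary. -/
lemma SmoothFun.smAt {D : Set N} {f : ∀ s : S, (s : N) ∈ D → ℂ} (hf : SmoothFun I S D f)
    {s₀ : S} (hD : ∀ᶠ s : S in nhds s₀, (s : N) ∈ D) {f' : S → ℂ}
    (h : ∀ᶠ s : S in nhds s₀, ∀ hs : (s : N) ∈ D, f' s = f s hs) :
    SmAt I 𝓘(ℝ, ℂ) f' s₀ := by
  obtain ⟨g, hg, hgf⟩ := hf
  have hD' : D ∈ nhdsWithin (s₀ : N) S := (eventually_nhds_subtype_iff S s₀ (· ∈ D)).mp hD
  refine SmAt.of_contMDiffWithinAt (g := g) ((hg s₀ ⟨s₀.2, hD.self_of_nhds⟩).mono_of_mem_nhdsWithin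
    (Filter.inter_mem self_mem_nhdsWithin hD')) ?_
  filter_upwards [hD, h] with s hs hs'
  rw [hs' hs, hgf s hs]

lemma SmoothFun.of_smAt {D : Set N} {f : ∀ s : S, (s : N) ∈ D → ℂ}
    (h : ∀ s₀ : S, (s₀ : N) ∈ D → ∃ f' : S → ℂ, SmAt I 𝓘(ℝ, ℂ) f' s₀ ∧
      ∀ᶠ s : S in nhds s₀, ∀ hs : (s : N) ∈ D, f s hs = f' s) : SmoothFun I S D f := by
  classical
  refine ⟨fun x => if h : x ∈ S ∧ x ∈ D then f ⟨x, h.1⟩ h.2 else 0, fun x hx => ?_,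
    fun s hs => dif_pos ⟨s.2, hs⟩⟩
  obtain ⟨f', hf', hff'⟩ := h ⟨x, hx.1⟩ hx.2
  obtain ⟨g, hg, hgf⟩ := hf'.exists_extension
  refine (hg.mono Set.inter_subset_left).congr_of_eventuallyEq ?_ ?_
  · have h₁ : ∀ᶠ y in nhdsWithin x S, ∀ (hS : y ∈ S) (hD : y ∈ D), f ⟨y, hS⟩ hD = g y := by
      refine (eventually_nhds_subtype_iff S ⟨x, hx.1⟩
        (fun y => ∀ (hS : y ∈ S) (hD : y ∈ D), f ⟨y, hS⟩ hD = g y)).mp ?_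
      filter_upwards [hff'] with s hs _ hD
      rw [hgf s]
      exact hs hD
    filter_upwards [h₁.filter_mono (nhdsWithin_mono x Set.inter_subset_left),
      self_mem_nhdsWithin] with y hy hy'
    rw [dif_pos (show y ∈ S ∧ y ∈ D from hy')]
    exact hy hy'.1 hy'.2
  · rw [dif_pos (show x ∈ S ∧ x ∈ D from hx), hgf ⟨x, hx.1⟩]
    exact hff'.self_of_nhds hx.2

end SmoothAt

/-! ### Smooth sections of hermitian bundles along maps -/

section Sections

variable {E' H' N' : Type*} [NormedAddCommGroup E'] [NormedSpace ℝ E'] [TopologicalSpace H']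
  {I' : ModelWithCorners ℝ E' H'} [TopologicalSpace N'] [ChartedSpace H' N']
  {E H N : Type*} [NormedAddCommGroup E] [NormedSpace ℝ E] [TopologicalSpace H]
  {I : ModelWithCorners ℝ E H} [TopologicalSpace N] [ChartedSpace H N]
  {E₂ H₂ N₂ : Type*} [NormedAddCommGroup E₂] [NormedSpace ℝ E₂] [TopologicalSpace H₂]
  {I₂ : ModelWithCorners ℝ E₂ H₂} [TopologicalSpace N₂] [ChartedSpace H₂ N₂]
  {S : Set N} {T : Set N'} {T₂ : Set N₂}

open Classical in
/-- A coordinate of a vector in the local frame at `p`, and `0` outside the domain of the frame. -/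
def coef (A : HermitianBundle I S) (p s : S) (i : A.ι p) (v : A.fiber s) : ℂ :=
  if h : (s : N) ∈ A.dom p then ⟪A.frame p s h i, v⟫_ℂ else 0

lemma coef_of_mem (A : HermitianBundle I S) {p s : S} (h : (s : N) ∈ A.dom p) (i : A.ι p)
    (v : A.fiber s) : coef A p s i v = ⟪A.frame p s h i, v⟫_ℂ := dif_pos h

variable (I') in
/-- A section `σ` of a bundle along a map `φ`, which is smooth at a point. -/
def SecAt (A : HermitianBundle I S) (φ : T → S) (σ : ∀ t, A.fiber (φ t)) (t₀ : T) : Prop :=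
  SmAt I' I (fun t => (φ t : N)) t₀ ∧ ∀ p, (φ t₀ : N) ∈ A.dom p → ∀ i,
    SmAt I' 𝓘(ℝ, ℂ) (fun t => coef A p (φ t) i (σ t)) t₀

lemma eventually_mem_dom (A : HermitianBundle I S) {φ : T → S} {t₀ : T}
    (hφ : SmAt I' I (fun t => (φ t : N)) t₀) {p : S} (hp : (φ t₀ : N) ∈ A.dom p) :
    ∀ᶠ t in nhds t₀, (φ t : N) ∈ A.dom p :=
  hφ.continuousAt.eventually_mem ((A.isOpen_dom p).mem_nhds hp)

namespace SecAt

variable {A B : HermitianBundle I S} {φ : T → S} {t₀ : T}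

lemma congr {σ σ' : ∀ t, A.fiber (φ t)} (hσ : SecAt I' A φ σ t₀)
    (h : ∀ᶠ t in nhds t₀, σ' t = σ t) : SecAt I' A φ σ' t₀ :=
  ⟨hσ.1, fun p hp i => (hσ.2 p hp i).congr (h.mono fun t ht => by rw [ht])⟩

/-- Parseval in the frame attached to `φ t₀`. -/
lemma inner {σ τ : ∀ t, A.fiber (φ t)} (hσ : SecAt I' A φ σ t₀) (hτ : SecAt I' A φ τ t₀) :
    SmAt I' 𝓘(ℝ, ℂ) (fun t => ⟪σ t, τ t⟫_ℂ) t₀ := by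
  have hp := A.mem_dom (φ t₀)
  refine (SmAt.sum Finset.univ fun i =>
    (hσ.2 (φ t₀) hp i).conj.mul (hτ.2 (φ t₀) hp i)).congr ?_
  filter_upwards [eventually_mem_dom A hσ.1 hp] with t ht
  rw [← OrthonormalBasis.sum_inner_mul_inner (A.frame (φ t₀) (φ t) ht)]
  refine Finset.sum_congr rfl fun i _ => ?_
  rw [coef_of_mem A ht, coef_of_mem A ht, inner_conj_symm]

lemma smul {σ : ∀ t, A.fiber (φ t)} {c : T → ℂ} (hc : SmAt I' 𝓘(ℝ, ℂ) c t₀)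
    (hσ : SecAt I' A φ σ t₀) : SecAt I' A φ (fun t => c t • σ t) t₀ :=
  ⟨hσ.1, fun p hp i => (hc.mul (hσ.2 p hp i)).congr
    ((eventually_mem_dom A hσ.1 hp).mono fun t ht => by
      rw [coef_of_mem A ht, coef_of_mem A ht, inner_smul_right])⟩

lemma comp {σ : ∀ t, A.fiber (φ t)} {ψ : T₂ → T} {s₀ : T₂} (hσ : SecAt I' A φ σ (ψ s₀))
    (hψ : SmAt I₂ I' (fun t => (ψ t : N')) s₀) :
    SecAt I₂ A (fun t => φ (ψ t)) (fun t => σ (ψ t)) s₀ :=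
  ⟨SmAt.comp (φ := ψ) hσ.1 hψ, fun p hp i => SmAt.comp (φ := ψ) (hσ.2 p hp i) hψ⟩

end SecAt

variable (I') in
/-- A family of sections along a map, which is a smooth orthonormal frame near a point. -/
def FrameAt (A : HermitianBundle I S) {κ : Type*} [Fintype κ] (φ : T → S)
    (e : κ → ∀ t, A.fiber (φ t)) (t₀ : T) : Prop :=
  (∀ k, SecAt I' A φ (e k) t₀) ∧
    ∀ᶠ t in nhds t₀, ∃ b : OrthonormalBasis κ ℂ (A.fiber (φ t)), ∀ k, b k = e k t

/-- A section is smooth if its coordinates in a smooth frame are smooth. -/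
lemma SecAt.of_frame {A : HermitianBundle I S} {κ : Type*} [Fintype κ] {φ : T → S} {t₀ : T}
    (hφ : SmAt I' I (fun t => (φ t : N)) t₀) {e : κ → ∀ t, A.fiber (φ t)}
    (he : FrameAt I' A φ e t₀) {σ : ∀ t, A.fiber (φ t)}
    (h : ∀ k, SmAt I' 𝓘(ℝ, ℂ) (fun t => ⟪e k t, σ t⟫_ℂ) t₀) : SecAt I' A φ σ t₀ := by
  refine ⟨hφ, fun p hp i => (SmAt.sum Finset.univ fun k =>
    ((he.1 k).2 p hp i).mul (h k)).congr ?_⟩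
  filter_upwards [eventually_mem_dom A hφ hp, he.2] with t ht hb
  obtain ⟨b, hb⟩ := hb
  rw [coef_of_mem A ht, ← b.sum_inner_mul_inner]
  refine Finset.sum_congr rfl fun k _ => ?_
  rw [coef_of_mem A ht, hb]

/-- `SecAt` asks for smooth coordinates in every frame around the point. One frame is enough, since
the coordinates in another are obtained by the smooth transition matrix. -/
lemma SecAt.of_dom {A : HermitianBundle I S} {φ : T → S} {t₀ : T}
    (hφ : SmAt I' I (fun t => (φ t : N)) t₀) {σ : ∀ t, A.fiber (φ t)} (q : S)
    (hq : (φ t₀ : N) ∈ A.dom q)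
    (h : ∀ i, SmAt I' 𝓘(ℝ, ℂ) (fun t => coef A q (φ t) i (σ t)) t₀) : SecAt I' A φ σ t₀ := by
  refine ⟨hφ, fun p hp i => ?_⟩
  have hs : ∀ k, SmAt I 𝓘(ℝ, ℂ) (fun s : S => coef A p s i
      (open Classical in if h : (s : N) ∈ A.dom q then A.frame q s h k else 0)) (φ t₀) := by
    intro k
    refine (A.smooth_frame p q i k).smAt ?_ (Filter.Eventually.of_forall fun s hs => ?_)
    · exact continuous_subtype_val.continuousAt.eventually_mem
        (((A.isOpen_dom p).inter (A.isOpen_dom q)).mem_nhds ⟨hp, hq⟩)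
    · rw [coef_of_mem A hs.1, dif_pos hs.2]
  refine (SmAt.sum Finset.univ fun k => ((hs k).comp hφ).mul (h k)).congr ?_
  filter_upwards [eventually_mem_dom A hφ hp, eventually_mem_dom A hφ hq] with t ht ht'
  rw [coef_of_mem A ht, ← (A.frame q (φ t) ht').sum_inner_mul_inner]
  refine Finset.sum_congr rfl fun k _ => ?_
  rw [coef_of_mem A ht, coef_of_mem A ht', dif_pos ht']

open Classical in
/-- The vectors of the local frame at `p`, extended by `0`. -/
def frameSec (A : HermitianBundle I S) (p : S) (i : A.ι p) (s : S) : A.fiber s :=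
  if h : (s : N) ∈ A.dom p then A.frame p s h i else 0

lemma frameSec_of_mem (A : HermitianBundle I S) {p s : S} (h : (s : N) ∈ A.dom p) (i : A.ι p) :
    frameSec A p i s = A.frame p s h i := dif_pos h

lemma frameSec_frameAt (A : HermitianBundle I S) {φ : T → S} {t₀ : T}
    (hφ : SmAt I' I (fun t => (φ t : N)) t₀) (p : S) (hp : (φ t₀ : N) ∈ A.dom p) :
    FrameAt I' A φ (fun i t => frameSec A p i (φ t)) t₀ := by
  classical
  refine ⟨fun k => SecAt.of_dom hφ p hp fun i =>
    (SmAt.const (if i = k then 1 else 0) t₀).congr ?_, ?_⟩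
  · filter_upwards [eventually_mem_dom A hφ hp] with t ht
    rw [coef_of_mem A ht, frameSec_of_mem A ht, orthonormal_iff_ite.mp (A.frame p _ ht).orthonormal]
  · filter_upwards [eventually_mem_dom A hφ hp] with t ht
    exact ⟨A.frame p _ ht, fun k => (frameSec_of_mem A ht k).symm⟩

lemma exists_frameAt (A : HermitianBundle I S) {φ : T → S} {t₀ : T}
    (hφ : SmAt I' I (fun t => (φ t : N)) t₀) :
    FrameAt I' A φ (fun i t => frameSec A (φ t₀) i (φ t)) t₀ :=
  frameSec_frameAt A hφ _ (A.mem_dom _)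

/-- The coordinates of the image are a smooth matrix applied to smooth coordinates. Together with
`IsSmoothFamily.of_secAt` this lets smoothness of maps be checked on sections instead of matrix
entries. -/
lemma IsSmoothFamily.secAt {A B : HermitianBundle I S} {f : ∀ s, A.fiber s →ₗ[ℂ] B.fiber s}
    (hf : IsSmoothFamily A B f) {φ : T → S} {t₀ : T} {σ : ∀ t, A.fiber (φ t)}
    (hσ : SecAt I' A φ σ t₀) : SecAt I' B φ (fun t => f (φ t) (σ t)) t₀ := by
  refine ⟨hσ.1, fun q hq j => ?_⟩
  have hp := A.mem_dom (φ t₀)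
  have hs : ∀ k, SmAt I 𝓘(ℝ, ℂ) (fun s : S => coef B q s j (f s (frameSec A (φ t₀) k s)))
      (φ t₀) := by
    intro k
    refine (hf (φ t₀) q k j).smAt ?_ (Filter.Eventually.of_forall fun s hs => ?_)
    · exact continuous_subtype_val.continuousAt.eventually_mem
        (((A.isOpen_dom _).inter (B.isOpen_dom q)).mem_nhds ⟨hp, hq⟩)
    · rw [coef_of_mem B hs.2, frameSec_of_mem A hs.1]
  refine (SmAt.sum Finset.univ fun k => ((hs k).comp hσ.1).mul (hσ.2 _ hp k)).congr ?_
  filter_upwards [eventually_mem_dom A hσ.1 hp, eventually_mem_dom B hσ.1 hq] with t ht ht'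
  rw [coef_of_mem B ht']
  conv_lhs => rw [← (A.frame (φ t₀) (φ t) ht).sum_repr (σ t), map_sum, inner_sum]
  refine Finset.sum_congr rfl fun k _ => ?_
  rw [map_smul, inner_smul_right, OrthonormalBasis.repr_apply_apply, coef_of_mem B ht',
    coef_of_mem A ht, frameSec_of_mem A ht, mul_comm]

/-- A family of linear maps is smooth if it maps a smooth frame around each point to smooth
sections. -/
lemma IsSmoothFamily.of_secAt {A B : HermitianBundle I S} {f : ∀ s, A.fiber s →ₗ[ℂ] B.fiber s}
    (h : ∀ s₀ : S, ∃ (κ : Type) (_ : Fintype κ) (e : κ → ∀ s, A.fiber s),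
      FrameAt I A (fun s => s) e s₀ ∧ ∀ k, SecAt I B (fun s => s) (fun s => f s (e k s)) s₀) :
    IsSmoothFamily A B f := by
  intro p q i j
  refine SmoothFun.of_smAt fun s₀ hs₀ => ?_
  obtain ⟨κ, _, e, he, hfe⟩ := h s₀
  have hF := (frameSec_frameAt A (φ := fun s => s) (SmAt.val s₀) p hs₀.1).1 i
  refine ⟨_, SmAt.sum Finset.univ fun k => ((hfe k).2 q hs₀.2 j).mul ((he.1 k).inner hF), ?_⟩
  filter_upwards [he.2] with s hb hs
  obtain ⟨b, hb⟩ := hb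
  conv_lhs => rw [← b.sum_repr (A.frame p s hs.1 i), map_sum, inner_sum]
  refine Finset.sum_congr rfl fun k _ => ?_
  rw [map_smul, inner_smul_right, OrthonormalBasis.repr_apply_apply, coef_of_mem B hs.2,
    frameSec_of_mem A hs.1, hb, mul_comm]

lemma BundleIso.secAt {A B : HermitianBundle I S} (f : BundleIso A B) {φ : T → S} {t₀ : T}
    {σ : ∀ t, A.fiber (φ t)} (hσ : SecAt I' A φ σ t₀) :
    SecAt I' B φ (fun t => f.equiv (φ t) (σ t)) t₀ :=
  f.smooth.secAt hσ

/-! ### Smooth sections of tensor products, duals and pull-backs -/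

section Operations

variable {A B : HermitianBundle I S} {φ : T → S} {t₀ : T}

lemma SecAt.tensor {σ : ∀ t, A.fiber (φ t)} {τ : ∀ t, B.fiber (φ t)}
    (hσ : SecAt I' A φ σ t₀) (hτ : SecAt I' B φ τ t₀) :
    SecAt I' (A.tensor B) φ (fun t => σ t ⊗ₜ[ℂ] τ t) t₀ := by
  refine ⟨hσ.1, fun p hp i => ((hσ.2 p hp.1 i.1).mul (hτ.2 p hp.2 i.2)).congr ?_⟩
  filter_upwards [eventually_mem_dom A hσ.1 hp.1, eventually_mem_dom B hσ.1 hp.2] with t h₁ h₂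
  rw [coef_of_mem A h₁, coef_of_mem B h₂]
  refine (coef_of_mem (A.tensor B) (show (φ t : N) ∈ (A.tensor B).dom p from ⟨h₁, h₂⟩) i _).trans ?_
  exact (congrArg (fun v => ⟪v, σ t ⊗ₜ[ℂ] τ t⟫_ℂ) (OrthonormalBasis.tensorProduct_apply'
    (A.frame p (φ t) h₁) (B.frame p (φ t) h₂) i)).trans (TensorProduct.inner_tmul ..)

lemma FrameAt.tensor {κ κ' : Type*} [Fintype κ] [Fintype κ'] {e : κ → ∀ t, A.fiber (φ t)}
    {f : κ' → ∀ t, B.fiber (φ t)} (he : FrameAt I' A φ e t₀) (hf : FrameAt I' B φ f t₀) :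
    FrameAt I' (A.tensor B) φ (fun (k : κ × κ') t => e k.1 t ⊗ₜ[ℂ] f k.2 t) t₀ :=
  ⟨fun k => (he.1 k.1).tensor (hf.1 k.2), by
    filter_upwards [he.2, hf.2] with t ⟨b, hb⟩ ⟨c, hc⟩
    exact ⟨b.tensorProduct c, fun k => (OrthonormalBasis.tensorProduct_apply' b c k).trans
      (congrArg₂ (fun v w => v ⊗ₜ[ℂ] w) (hb _) (hc _))⟩⟩

lemma SecAt.riesz {σ : ∀ t, A.fiber (φ t)} (hσ : SecAt I' A φ σ t₀) :
    SecAt I' A.dual φ (fun t => HDual.riesz (A.fiber (φ t)) (σ t)) t₀ := by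
  refine ⟨hσ.1, fun p hp i => (hσ.2 p hp i).conj.congr ?_⟩
  filter_upwards [eventually_mem_dom A hσ.1 hp] with t h
  refine (coef_of_mem A.dual (show (φ t : N) ∈ A.dual.dom p from h) i _).trans ?_
  refine (congrArg (fun v => ⟪v, HDual.riesz (A.fiber (φ t)) (σ t)⟫_ℂ)
    (dualBasis_apply (A.frame p (φ t) h) i)).trans ((HDual.inner_riesz _ _).trans ?_)
  exact (inner_conj_symm _ _).symm.trans (congrArg _ (coef_of_mem A h i (σ t)).symm)

lemma SecAt.of_riesz {σ : ∀ t, A.fiber (φ t)}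
    (hσ : SecAt I' A.dual φ (fun t => HDual.riesz (A.fiber (φ t)) (σ t)) t₀) :
    SecAt I' A φ σ t₀ := by
  have hF := exists_frameAt A hσ.1
  refine SecAt.of_frame hσ.1 hF fun k => (hσ.inner (hF.1 k).riesz).congr ?_
  exact Filter.Eventually.of_forall fun t => (HDual.inner_riesz _ _).symm

lemma SecAt.pullback {f : N → N₂} {S₂ : Set N₂} {A : HermitianBundle I₂ S₂}
    {hf : ContMDiff I I₂ ∞ f} {hS : Set.MapsTo f S S₂}
    (hφ : SmAt I' I (fun t => (φ t : N)) t₀)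
    {σ : ∀ t, A.fiber ⟨f (φ t), hS (φ t).2⟩}
    (hσ : SecAt I' A (fun t => ⟨f (φ t), hS (φ t).2⟩) σ t₀) :
    SecAt I' (A.pullback f hf hS) φ σ t₀ :=
  ⟨hφ, fun p hp i => hσ.2 ⟨f p, hS p.2⟩ hp i⟩

/-- The pull-back carries only the frames of `A` attached to points of the image of `f`. The one
attached to `f (φ t₀)` is among them, and one frame suffices. -/
lemma SecAt.of_pullback {f : N → N₂} {S₂ : Set N₂} {A : HermitianBundle I₂ S₂}
    {hf : ContMDiff I I₂ ∞ f} {hS : Set.MapsTo f S S₂}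
    {σ : ∀ t, A.fiber ⟨f (φ t), hS (φ t).2⟩}
    (hσ : SecAt I' (A.pullback f hf hS) φ σ t₀) :
    SecAt I' A (fun t => ⟨f (φ t), hS (φ t).2⟩) σ t₀ :=
  SecAt.of_dom (SmAt.contMDiffAt_comp (g := f) hf.contMDiffAt hσ.1) ⟨f (φ t₀), hS (φ t₀).2⟩
    (A.mem_dom _) fun i => hσ.2 (φ t₀) (A.mem_dom _) i

lemma FrameAt.pullback {κ : Type*} [Fintype κ] {f : N → N₂} {S₂ : Set N₂}
    {A : HermitianBundle I₂ S₂} {hf : ContMDiff I I₂ ∞ f} {hS : Set.MapsTo f S S₂}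
    (hφ : SmAt I' I (fun t => (φ t : N)) t₀)
    {e : κ → ∀ t, A.fiber ⟨f (φ t), hS (φ t).2⟩}
    (he : FrameAt I' A (fun t => ⟨f (φ t), hS (φ t).2⟩) e t₀) :
    FrameAt I' (A.pullback f hf hS) φ e t₀ :=
  ⟨fun k => (he.1 k).pullback hφ, he.2⟩

end Operations

end Sections

/-! ### Gluing of hermitian bundles -/

section Glue

variable {E' H' N' : Type*} [NormedAddCommGroup E'] [NormedSpace ℝ E'] [TopologicalSpace H']
  {I' : ModelWithCorners ℝ E' H'} [TopologicalSpace N'] [ChartedSpace H' N']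
  {E H N : Type*} [NormedAddCommGroup E] [NormedSpace ℝ E] [TopologicalSpace H]
  {I : ModelWithCorners ℝ E H} [TopologicalSpace N] [ChartedSpace H N]
  {E₂ H₂ N₂ : Type*} [NormedAddCommGroup E₂] [NormedSpace ℝ E₂] [TopologicalSpace H₂]
  {I₂ : ModelWithCorners ℝ E₂ H₂} [TopologicalSpace N₂] [ChartedSpace H₂ N₂]
  {S : Set N} {T : Set N'} {R : Set N₂}

lemma FrameAt.comp {A : HermitianBundle I₂ R} {κ : Type*} [Fintype κ] {φ : S → R}
    {e : κ → ∀ t, A.fiber (φ t)} {ψ : T → S} {t₀ : T} (he : FrameAt I A φ e (ψ t₀))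
    (hψ : SmAt I' I (fun t => (ψ t : N)) t₀) :
    FrameAt I' A (fun t => φ (ψ t)) (fun k t => e k (ψ t)) t₀ :=
  ⟨fun k => (he.1 k).comp hψ, hψ.continuousAt_subtype.eventually he.2⟩

variable (I S) in
/-- A family of vector spaces over `S`, locally identified with the pull-backs of a bundle `A`
along smooth maps, with smooth transition maps. -/
structure GlueData (A : HermitianBundle I₂ R) where
  fiber : S → Type
  [normedAddCommGroup : ∀ s, NormedAddCommGroup (fiber s)]
  [innerProductSpace : ∀ s, InnerProductSpace ℂ (fiber s)]
  [finiteDimensional : ∀ s, FiniteDimensional ℂ (fiber s)]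
  nbhd : S → Set N
  isOpen_nbhd : ∀ p, IsOpen (nbhd p)
  mem_nbhd : ∀ p : S, (p : N) ∈ nbhd p
  map : S → S → R
  smooth_map : ∀ p s : S, (s : N) ∈ nbhd p → SmAt I I₂ (fun s => (map p s : N₂)) s
  triv : ∀ p s : S, A.fiber (map p s) ≃ₗᵢ[ℂ] fiber s
  smooth_triv : ∀ p q s₀ : S, (s₀ : N) ∈ nbhd p → (s₀ : N) ∈ nbhd q →
    ∀ σ : ∀ s, A.fiber (map p s), SecAt I A (map p) σ s₀ →
      SecAt I A (map q) (fun s => (triv q s).symm (triv p s (σ s))) s₀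

namespace GlueData

attribute [instance] normedAddCommGroup innerProductSpace finiteDimensional

variable {A : HermitianBundle I₂ R} (G : GlueData I S A)

/-- The domain of the local frame at `p` of the glued bundle. -/
def dom (p : S) : Set N :=
  -- `G.map p` is defined on `S` alone, so the preimage of a frame domain is open only relative to
  -- `S`. The union supplies an open subset of `N` with the right trace.
  G.nbhd p ∩ ⋃₀ {W | IsOpen W ∧ ∀ s : S, (s : N) ∈ W → (s : N) ∈ G.nbhd p →
    (G.map p s : N₂) ∈ A.dom (G.map p p)}

lemma isOpen_dom (p : S) : IsOpen (G.dom p) :=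
  (G.isOpen_nbhd p).inter (isOpen_sUnion fun _ h => h.1)

lemma map_mem_dom {p s : S} (h : (s : N) ∈ G.dom p) : (G.map p s : N₂) ∈ A.dom (G.map p p) := by
  obtain ⟨h₁, W, hW, hs⟩ := h
  exact hW.2 s hs h₁

lemma mem_dom (p : S) : (p : N) ∈ G.dom p := by
  refine ⟨G.mem_nbhd p, ?_⟩
  have h := eventually_mem_dom A (G.smooth_map p p (G.mem_nbhd p)) (A.mem_dom (G.map p p))
  rw [nhds_subtype_eq_comap, Filter.eventually_comap] at h
  obtain ⟨W, hW, hWo, hpW⟩ := eventually_nhds_iff.mp h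
  exact ⟨W, ⟨hWo, fun s hs _ => hW s hs s rfl⟩, hpW⟩

lemma eventually_dom {p s₀ : S} (h : (s₀ : N) ∈ G.dom p) :
    ∀ᶠ s : S in nhds s₀, (s : N) ∈ G.dom p :=
  continuous_subtype_val.continuousAt.eventually_mem ((G.isOpen_dom p).mem_nhds h)

/-- The frame of the chart `q` is moved into the chart `p` by the smooth transition map. Since
`G.triv p s` is unitary, the transition matrix becomes an inner product of two smooth sections of
`A`. -/
lemma triv_frameSec_inner (p q s₀ : S) (hp : (s₀ : N) ∈ G.dom p) (hq : (s₀ : N) ∈ G.dom q)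
    (i : A.ι (G.map p p)) (j : A.ι (G.map q q)) :
    SmAt I 𝓘(ℝ, ℂ) (fun s => ⟪G.triv p s (frameSec A (G.map p p) i (G.map p s)),
      G.triv q s (frameSec A (G.map q q) j (G.map q s))⟫_ℂ) s₀ := by
  have h₁ := (frameSec_frameAt A (G.smooth_map p s₀ hp.1) _ (G.map_mem_dom hp)).1 i
  have h₂ := (frameSec_frameAt A (G.smooth_map q s₀ hq.1) _ (G.map_mem_dom hq)).1 j
  have h₃ := G.smooth_triv q p s₀ hq.1 hp.1 _ h₂
  refine (h₁.inner h₃).congr (Filter.Eventually.of_forall fun s => ?_)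
  exact (G.triv p s).inner_map_eq_flip _ _

/-- The glued bundle. -/
def bundle : HermitianBundle I S where
  fiber := G.fiber
  ι p := A.ι (G.map p p)
  dom := G.dom
  isOpen_dom := G.isOpen_dom
  mem_dom := G.mem_dom
  frame p s h := (A.frame (G.map p p) (G.map p s) (G.map_mem_dom h)).map (G.triv p s)
  smooth_frame p q i j := by
    refine SmoothFun.of_smAt fun s₀ hs₀ =>
      ⟨_, G.triv_frameSec_inner p q s₀ hs₀.1 hs₀.2 i j, Filter.Eventually.of_forall fun s hs => ?_⟩
    rw [OrthonormalBasis.map_apply, OrthonormalBasis.map_apply,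
      frameSec_of_mem A (G.map_mem_dom hs.1), frameSec_of_mem A (G.map_mem_dom hs.2)]

/-- The chart `p` can be used at every `s₀` in its neighbourhood, even outside the domain of the
frame chosen for `p`. For this reason the frame of `A` attached to `G.map p s₀` appears, not the one
attached to `G.map p p`. -/
lemma triv_frameAt (p s₀ : S) (hp : (s₀ : N) ∈ G.nbhd p) :
    FrameAt I G.bundle (fun s => s)
      (fun i s => G.triv p s (frameSec A (G.map p s₀) i (G.map p s))) s₀ := by
  have hF := exists_frameAt A (G.smooth_map p s₀ hp)
  refine ⟨fun k => SecAt.of_dom (SmAt.val s₀) s₀ (G.mem_dom s₀) fun i => ?_, ?_⟩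
  · have h₁ := (exists_frameAt A (G.smooth_map s₀ s₀ (G.mem_nbhd s₀))).1 i
    have h₂ := G.smooth_triv p s₀ s₀ hp (G.mem_nbhd s₀) _ (hF.1 k)
    refine (h₁.inner h₂).congr ?_
    filter_upwards [G.eventually_dom (G.mem_dom s₀)] with s hs
    refine (coef_of_mem G.bundle (show (s : N) ∈ G.bundle.dom s₀ from hs) i _).trans ?_
    refine Eq.trans ?_ ((G.triv s₀ s).inner_map_eq_flip _ _)
    exact (congrArg (fun v => ⟪G.triv s₀ s v, G.triv p s (frameSec A (G.map p s₀) k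
      (G.map p s))⟫_ℂ) (frameSec_of_mem A (G.map_mem_dom hs) i)).symm
  · filter_upwards [hF.2] with s ⟨b, hb⟩
    exact ⟨b.map (G.triv p s), fun k => (b.map_apply _ k).trans (congrArg _ (hb k))⟩

/-- A section of the glued bundle is smooth if it corresponds to a smooth section of `A`. -/
lemma secAt {ψ : T → S} {t₀ : T} (hψ : SmAt I' I (fun t => (ψ t : N)) t₀) (p : S)
    (hp : (ψ t₀ : N) ∈ G.nbhd p) {σ : ∀ t, A.fiber (G.map p (ψ t))}
    (hσ : SecAt I' A (fun t => G.map p (ψ t)) σ t₀) :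
    SecAt I' G.bundle ψ (fun t => G.triv p (ψ t) (σ t)) t₀ := by
  refine SecAt.of_frame hψ ((G.triv_frameAt p (ψ t₀) hp).comp (ψ := ψ) hψ) fun k => ?_
  have hF := (exists_frameAt A (G.smooth_map p (ψ t₀) hp)).comp (ψ := ψ) hψ
  refine ((hF.1 k).inner hσ).congr (Filter.Eventually.of_forall fun t => ?_)
  exact (G.triv p (ψ t)).inner_map_map _ _

lemma frameAt {ψ : T → S} {t₀ : T} (hψ : SmAt I' I (fun t => (ψ t : N)) t₀) (p : S)
    (hp : (ψ t₀ : N) ∈ G.nbhd p) {κ : Type*} [Fintype κ] {e : κ → ∀ t, A.fiber (G.map p (ψ t))}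
    (he : FrameAt I' A (fun t => G.map p (ψ t)) e t₀) :
    FrameAt I' G.bundle ψ (fun k t => G.triv p (ψ t) (e k t)) t₀ :=
  ⟨fun k => G.secAt hψ p hp (he.1 k), he.2.mono fun t ⟨b, hb⟩ =>
    ⟨b.map (G.triv p (ψ t)), fun k => (b.map_apply _ k).trans (congrArg _ (hb k))⟩⟩

end GlueData

end Glue

/-! ### Hermitian lines -/

section Lines

variable {V W U : Type*} [NormedAddCommGroup V] [InnerProductSpace ℂ V]
  [NormedAddCommGroup W] [InnerProductSpace ℂ W] [NormedAddCommGroup U] [InnerProductSpace ℂ U]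

lemma line_eq_inner_smul (h : Module.finrank ℂ V = 1) {u : V} (hu : ‖u‖ = 1) (v : V) :
    v = ⟪u, v⟫_ℂ • u := by
  have hu0 : u ≠ 0 := fun h0 => by simp [h0] at hu
  obtain ⟨c, rfl⟩ := (finrank_eq_one_iff_of_nonzero' u hu0).mp h v
  rw [inner_smul_right, inner_self_eq_norm_sq_to_K, hu]
  simp

lemma exists_unit (h : Module.finrank ℂ V = 1) : ∃ u : V, ‖u‖ = 1 := by
  have : Nontrivial V := Module.nontrivial_of_finrank_pos (R := ℂ) (by rw [h]; exact one_pos)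
  exact exists_norm_eq V zero_le_one

lemma line_inner_mul_inner (h : Module.finrank ℂ V = 1) {u : V} (hu : ‖u‖ = 1) (v w : V) :
    ⟪v, u⟫_ℂ * ⟪u, w⟫_ℂ = ⟪v, w⟫_ℂ := by
  conv_rhs => rw [line_eq_inner_smul h hu w]
  rw [inner_smul_right, mul_comm]

lemma inner_self_of_unit {u : V} (hu : ‖u‖ = 1) : ⟪u, u⟫_ℂ = 1 := by
  rw [inner_self_eq_norm_sq_to_K, hu]; simp

lemma norm_tmul_unit {v : V} {w : W} (hv : ‖v‖ = 1) (hw : ‖w‖ = 1) : ‖v ⊗ₜ[ℂ] w‖ = 1 := by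
  rw [TensorProduct.norm_tmul, hv, hw, one_mul]

/-- The tensor product with a unit vector of a line. -/
def tmulUnit [FiniteDimensional ℂ V] [FiniteDimensional ℂ W] (h : Module.finrank ℂ V = 1) (u : V)
    (hu : ‖u‖ = 1) : W ≃ₗᵢ[ℂ] V ⊗[ℂ] W :=
  unitaryOfInner (TensorProduct.mk ℂ V W u)
    (fun x y => by
      rw [TensorProduct.mk_apply, TensorProduct.mk_apply, TensorProduct.inner_tmul,
        inner_self_of_unit hu, one_mul])
    (by rw [Module.finrank_tensorProduct, h, one_mul])

@[simp] lemma tmulUnit_apply [FiniteDimensional ℂ V] [FiniteDimensional ℂ W]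
    (h : Module.finrank ℂ V = 1) (u : V) (hu : ‖u‖ = 1) (w : W) :
    tmulUnit h u hu w = u ⊗ₜ[ℂ] w := rfl

end Lines

/-! ### Calculus in bundle gerbes and their modules -/

section Gerbes

variable {EM HM : Type*} [NormedAddCommGroup EM] [NormedSpace ℝ EM] [TopologicalSpace HM]
  {IM : ModelWithCorners ℝ EM HM} {M : Type*} [TopologicalSpace M] [ChartedSpace HM M]
  {E H : Type*} [NormedAddCommGroup E] [NormedSpace ℝ E] [TopologicalSpace H]
  {I : ModelWithCorners ℝ E H} {N : Type*} [TopologicalSpace N] [ChartedSpace H N]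
  {E' H' : Type*} [NormedAddCommGroup E'] [NormedSpace ℝ E'] [TopologicalSpace H']
  {I' : ModelWithCorners ℝ E' H'} {N' : Type*} [TopologicalSpace N'] [ChartedSpace H' N']
  {E₂ H₂ N₂ : Type*} [NormedAddCommGroup E₂] [NormedSpace ℝ E₂] [TopologicalSpace H₂]
  {I₂ : ModelWithCorners ℝ E₂ H₂} [TopologicalSpace N₂] [ChartedSpace H₂ N₂]
  {𝒴 : SplitSpace IM M I N} {𝒳 : SplitSpace IM M I' N'} {T : Set N₂}

namespace BundleGerbe

variable (L : BundleGerbe 𝒴)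

/-- The product of two elements of a bundle gerbe. -/
def mul {y₁ y₂ y₃ : 𝒴.carrier} (h : 𝒴.proj y₁ = 𝒴.proj y₂) (h' : 𝒴.proj y₂ = 𝒴.proj y₃)
    (a : L.bundle.fiber (𝒴.pair h)) (b : L.bundle.fiber (𝒴.pair h')) :
    L.bundle.fiber (𝒴.pair (h.trans h')) := L.product.app h h' (a ⊗ₜ b)

variable {L} {y₁ y₂ y₃ y₄ : 𝒴.carrier} {h : 𝒴.proj y₁ = 𝒴.proj y₂} {h' : 𝒴.proj y₂ = 𝒴.proj y₃}

lemma mul_assoc {h'' : 𝒴.proj y₃ = 𝒴.proj y₄} (a : L.bundle.fiber (𝒴.pair h))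
    (b : L.bundle.fiber (𝒴.pair h')) (c : L.bundle.fiber (𝒴.pair h'')) :
    L.mul (h.trans h') h'' (L.mul h h' a b) c = L.mul h (h'.trans h'') a (L.mul h' h'' b c) :=
  L.assoc _ _ _ _ _ _ _ a b c

lemma smul_mul (c : ℂ) (a : L.bundle.fiber (𝒴.pair h)) (b : L.bundle.fiber (𝒴.pair h')) :
    L.mul h h' (c • a) b = c • L.mul h h' a b := by
  unfold mul
  rw [← TensorProduct.smul_tmul', map_smul]

lemma mul_smul (c : ℂ) (a : L.bundle.fiber (𝒴.pair h)) (b : L.bundle.fiber (𝒴.pair h')) :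
    L.mul h h' a (c • b) = c • L.mul h h' a b := by
  unfold mul
  rw [TensorProduct.tmul_smul, map_smul]

lemma inner_mul (a a' : L.bundle.fiber (𝒴.pair h)) (b b' : L.bundle.fiber (𝒴.pair h')) :
    ⟪L.mul h h' a b, L.mul h h' a' b'⟫_ℂ = ⟪a, a'⟫_ℂ * ⟪b, b'⟫_ℂ := by
  unfold mul
  rw [LinearIsometryEquiv.inner_map_map, TensorProduct.inner_tmul]

lemma norm_mul {a : L.bundle.fiber (𝒴.pair h)} {b : L.bundle.fiber (𝒴.pair h')} :
    ‖L.mul h h' a b‖ = ‖a‖ * ‖b‖ := by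
  unfold mul
  rw [LinearIsometryEquiv.norm_map, TensorProduct.norm_tmul]

lemma norm_mul_unit {a : L.bundle.fiber (𝒴.pair h)} {b : L.bundle.fiber (𝒴.pair h')}
    (ha : ‖a‖ = 1) (hb : ‖b‖ = 1) : ‖L.mul h h' a b‖ = 1 := by
  rw [norm_mul, ha, hb, one_mul]

/-- Left multiplication by a unit vector. -/
def mulLeft (h : 𝒴.proj y₁ = 𝒴.proj y₂) (h' : 𝒴.proj y₂ = 𝒴.proj y₃)
    (a : L.bundle.fiber (𝒴.pair h)) (ha : ‖a‖ = 1) :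
    L.bundle.fiber (𝒴.pair h') ≃ₗᵢ[ℂ] L.bundle.fiber (𝒴.pair (h.trans h')) :=
  (tmulUnit (L.rank_one _) a ha).trans (L.product.app h h')

@[simp] lemma mulLeft_apply (a : L.bundle.fiber (𝒴.pair h)) (ha : ‖a‖ = 1)
    (b : L.bundle.fiber (𝒴.pair h')) : mulLeft h h' a ha b = L.mul h h' a b := rfl

lemma mul_left_cancel {a : L.bundle.fiber (𝒴.pair h)} (ha : ‖a‖ = 1)
    {b b' : L.bundle.fiber (𝒴.pair h')} (hb : L.mul h h' a b = L.mul h h' a b') : b = b' :=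
  (mulLeft h h' a ha).injective hb

/-- Multiplication by a unit vector e is bijective on the fibre over the diagonal, so e = eu for
some u. Then e(uu) = (eu)u = eu, and cancelling e gives uu = u. -/
lemma exists_one (L : BundleGerbe 𝒴) (y : 𝒴.carrier) :
    ∃ u : L.bundle.fiber (𝒴.pair (Eq.refl (𝒴.proj y))), ‖u‖ = 1 ∧ L.mul rfl rfl u u = u := by
  obtain ⟨e, he⟩ := exists_unit (L.rank_one (𝒴.pair (Eq.refl (𝒴.proj y))))
  obtain ⟨u, hu⟩ := (mulLeft rfl rfl e he).surjective e
  rw [mulLeft_apply] at hu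
  refine ⟨u, ?_, mul_left_cancel he ?_⟩
  · have := congrArg norm hu
    rwa [norm_mul, he, one_mul] at this
  · rw [← mul_assoc, hu, hu]

/-- The unit of a bundle gerbe over the diagonal. -/
def one (L : BundleGerbe 𝒴) (y : 𝒴.carrier) : L.bundle.fiber (𝒴.pair (Eq.refl (𝒴.proj y))) :=
  (L.exists_one y).choose

lemma norm_one (y : 𝒴.carrier) : ‖L.one y‖ = 1 := (L.exists_one y).choose_spec.1

lemma one_mul_one (y : 𝒴.carrier) : L.mul rfl rfl (L.one y) (L.one y) = L.one y :=
  (L.exists_one y).choose_spec.2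

/-- Idempotence suffices: 1(1a) = (11)a = 1a, and left multiplication by a unit vector is injective.
-/
lemma one_mul (a : L.bundle.fiber (𝒴.pair h)) : L.mul rfl h (L.one y₁) a = a := by
  refine mul_left_cancel (L.norm_one y₁) (h := rfl) (h' := h) ?_
  exact (mul_assoc (L.one y₁) (L.one y₁) a).symm.trans
    (congrArg (fun u => L.mul rfl h u a) (L.one_mul_one y₁))

/-- Right multiplication by a unit vector preserves inner products, so the squared norm of a - a'
can be computed after multiplying by b, where it vanishes. -/
lemma mul_right_cancel {a a' : L.bundle.fiber (𝒴.pair h)} {b : L.bundle.fiber (𝒴.pair h')}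
    (hb : ‖b‖ = 1) (ha : L.mul h h' a b = L.mul h h' a' b) : a = a' := by
  have key : ∀ c d : L.bundle.fiber (𝒴.pair h), ⟪c, d⟫_ℂ = ⟪L.mul h h' c b, L.mul h h' d b⟫_ℂ :=
    fun c d => by rw [inner_mul, inner_self_of_unit hb, _root_.mul_one]
  rw [← sub_eq_zero, ← inner_self_eq_zero (𝕜 := ℂ), inner_sub_left, inner_sub_right,
    inner_sub_right, key a a, key a a', key a' a, key a' a', ha]
  ring

lemma mul_one (a : L.bundle.fiber (𝒴.pair h)) : L.mul h rfl a (L.one y₂) = a := by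
  refine mul_right_cancel (L.norm_one y₂) (h := h) (h' := rfl) ?_
  exact (mul_assoc a (L.one y₂) (L.one y₂)).trans
    (congrArg (fun u => L.mul h rfl a u) (L.one_mul_one y₂))

lemma secAt_mul {φ₁ φ₂ φ₃ : T → 𝒴.carrier} {h : ∀ t, 𝒴.proj (φ₁ t) = 𝒴.proj (φ₂ t)}
    {h' : ∀ t, 𝒴.proj (φ₂ t) = 𝒴.proj (φ₃ t)} {a : ∀ t, L.bundle.fiber (𝒴.pair (h t))}
    {b : ∀ t, L.bundle.fiber (𝒴.pair (h' t))} {t₀ : T}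
    (ha : SecAt I₂ L.bundle (fun t => 𝒴.pair (h t)) a t₀)
    (hb : SecAt I₂ L.bundle (fun t => 𝒴.pair (h' t)) b t₀) :
    SecAt I₂ L.bundle (fun t => 𝒴.pair ((h t).trans (h' t)))
      (fun t => L.mul (h t) (h' t) (a t) (b t)) t₀ := by
  have hc : SmAt I₂ (I.prod (I.prod I))
      (fun t => ((𝒴.triple (h t) (h' t) : 𝒴.cube) : N × N × N)) t₀ := ha.1.fst.prodMk hb.1
  exact (L.product.secAt (φ := fun t => 𝒴.triple (h t) (h' t))
    ((SecAt.pullback hc ha).tensor (SecAt.pullback hc hb))).of_pullback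

/-- The unit of a bundle gerbe is smooth. -/
lemma secAt_one {φ : T → 𝒴.carrier} {t₀ : T} (hφ : SmAt I₂ I (fun t => (φ t : N)) t₀) :
    SecAt I₂ L.bundle (fun t => 𝒴.pair (Eq.refl (𝒴.proj (φ t)))) (fun t => L.one (φ t)) t₀ := by
  have hF := exists_frameAt L.bundle (φ := fun t => 𝒴.pair (Eq.refl (𝒴.proj (φ t))))
    (hφ.prodMk hφ)
  refine SecAt.of_frame (hφ.prodMk hφ) hF fun k => ?_
  -- For a local unit section e the coordinate ⟪e, 1⟫ equals ⟪ee, 1e⟫ = ⟪ee, e⟫, which is smooth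
  -- because multiplication is. The unit itself was chosen pointwise.
  refine (((secAt_mul (hF.1 k) (hF.1 k)).inner (hF.1 k))).congr ?_
  filter_upwards [hF.2] with t ⟨b, hb⟩
  have hu : ‖frameSec L.bundle (𝒴.pair (Eq.refl (𝒴.proj (φ t₀)))) k
      (𝒴.pair (Eq.refl (𝒴.proj (φ t))))‖ = 1 := by
    rw [← hb]; exact b.orthonormal.1 k
  generalize frameSec L.bundle (𝒴.pair (Eq.refl (𝒴.proj (φ t₀)))) k
      (𝒴.pair (Eq.refl (𝒴.proj (φ t)))) = e at hu
  have h₁ := line_eq_inner_smul (L.rank_one _) (L.norm_one (φ t)) e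
  have h₂ : ⟪L.mul rfl rfl e e, L.mul rfl rfl (L.one (φ t)) e⟫_ℂ = ⟪e, L.one (φ t)⟫_ℂ := by
    rw [inner_mul, inner_self_of_unit hu, _root_.mul_one]
  rw [one_mul] at h₂
  exact h₂.symm

end BundleGerbe

namespace GerbeModule

variable {L : BundleGerbe 𝒴} (E : GerbeModule L)

/-- The action of an element of a bundle gerbe on an element of a module. -/
def smul {y₁ y₂ : 𝒴.carrier} (h : 𝒴.proj y₁ = 𝒴.proj y₂) (a : L.bundle.fiber (𝒴.pair h))
    (e : E.bundle.fiber y₂) : E.bundle.fiber y₁ := E.actAt h (a ⊗ₜ e)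

variable {E} {y₁ y₂ y₃ : 𝒴.carrier} {h : 𝒴.proj y₁ = 𝒴.proj y₂} {h' : 𝒴.proj y₂ = 𝒴.proj y₃}

lemma mul_smul (a : L.bundle.fiber (𝒴.pair h)) (b : L.bundle.fiber (𝒴.pair h'))
    (e : E.bundle.fiber y₃) :
    E.smul (h.trans h') (L.mul h h' a b) e = E.smul h a (E.smul h' b e) :=
  (E.act_assoc _ _ _ _ _ a b e).symm

lemma smul_smul_left (c : ℂ) (a : L.bundle.fiber (𝒴.pair h)) (e : E.bundle.fiber y₂) :
    E.smul h (c • a) e = c • E.smul h a e := by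
  unfold smul
  rw [← TensorProduct.smul_tmul', map_smul]

lemma smul_smul_right (c : ℂ) (a : L.bundle.fiber (𝒴.pair h)) (e : E.bundle.fiber y₂) :
    E.smul h a (c • e) = c • E.smul h a e := by
  unfold smul
  rw [TensorProduct.tmul_smul, map_smul]

/-- The action of a unit vector. -/
def smulUnit (E : GerbeModule L) (h : 𝒴.proj y₁ = 𝒴.proj y₂) (a : L.bundle.fiber (𝒴.pair h))
    (ha : ‖a‖ = 1) : E.bundle.fiber y₂ ≃ₗᵢ[ℂ] E.bundle.fiber y₁ :=
  (tmulUnit (L.rank_one _) a ha).trans (E.actAt h)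

@[simp] lemma smulUnit_apply (a : L.bundle.fiber (𝒴.pair h)) (ha : ‖a‖ = 1)
    (e : E.bundle.fiber y₂) : E.smulUnit h a ha e = E.smul h a e := rfl

/-- The action of the unit is an injective idempotent operator. -/
lemma one_smul {y : 𝒴.carrier} (e : E.bundle.fiber y) : E.smul rfl (L.one y) e = e := by
  refine (E.smulUnit rfl (L.one y) (L.norm_one y)).injective ?_
  rw [smulUnit_apply, smulUnit_apply, ← mul_smul, L.one_mul_one]

lemma secAt_smul {φ₁ φ₂ : T → 𝒴.carrier} {h : ∀ t, 𝒴.proj (φ₁ t) = 𝒴.proj (φ₂ t)}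
    {a : ∀ t, L.bundle.fiber (𝒴.pair (h t))} {e : ∀ t, E.bundle.fiber (φ₂ t)} {t₀ : T}
    (ha : SecAt I₂ L.bundle (fun t => 𝒴.pair (h t)) a t₀)
    (he : SecAt I₂ E.bundle φ₂ e t₀) :
    SecAt I₂ E.bundle φ₁ (fun t => E.smul (h t) (a t) (e t)) t₀ :=
  (E.act.secAt (ha.tensor (SecAt.pullback ha.1 he))).of_pullback

end GerbeModule

end Gerbes

/-! ### Descent of modules along `Y ×_M X → X` -/

section Descent

variable {EM HM : Type*} [NormedAddCommGroup EM] [NormedSpace ℝ EM] [TopologicalSpace HM]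
  {IM : ModelWithCorners ℝ EM HM} {M : Type*} [TopologicalSpace M] [ChartedSpace HM M]
  {E H : Type*} [NormedAddCommGroup E] [NormedSpace ℝ E] [TopologicalSpace H]
  {I : ModelWithCorners ℝ E H} {N : Type*} [TopologicalSpace N] [ChartedSpace H N]
  {E' H' : Type*} [NormedAddCommGroup E'] [NormedSpace ℝ E'] [TopologicalSpace H']
  {I' : ModelWithCorners ℝ E' H'} {N' : Type*} [TopologicalSpace N'] [ChartedSpace H' N']
  {E₂ H₂ N₂ : Type*} [NormedAddCommGroup E₂] [NormedSpace ℝ E₂] [TopologicalSpace H₂]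
  {I₂ : ModelWithCorners ℝ E₂ H₂} [TopologicalSpace N₂] [ChartedSpace H₂ N₂]
  {𝒴 : SplitSpace IM M I N} {𝒳 : SplitSpace IM M I' N'} {T : Set N₂}

namespace SplitSpace

lemma smAt_proj (x₀ : 𝒳.carrier) : SmAt I' IM (fun x : 𝒳.carrier => 𝒳.proj x) x₀ :=
  SmAt.of_contMDiffWithinAt (𝒳.smooth_proj x₀ x₀.2) (Filter.Eventually.of_forall fun _ => rfl)

/-- An open set of the ambient manifold which meets `X` in the preimage of an open set. -/
lemma exists_isOpen_preimage (𝒳 : SplitSpace IM M I' N') {U : Set M} (hU : IsOpen U) :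
    ∃ W : Set N', IsOpen W ∧ ∀ x : 𝒳.carrier, (x : N') ∈ W ↔ 𝒳.proj x ∈ U := by
  obtain ⟨W, hW, h⟩ := continuousOn_iff'.mp 𝒳.smooth_proj.continuousOn U hU
  refine ⟨W, hW, fun x => ⟨fun hx => ?_, fun hx => ?_⟩⟩
  · exact (h.symm.subset (show (x : N') ∈ W ∩ 𝒳.carrier from ⟨hx, x.2⟩)).1
  · exact (h.subset (show (x : N') ∈ 𝒳.proj ⁻¹' U ∩ 𝒳.carrier from ⟨hx, x.2⟩)).1

/-- Composing a local section of Y → M with the projection of X gives a local section of the fibre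
product over X. Each `l p` is made total so that gluing needs no partial functions, but it is smooth
only on `nb p`. -/
lemma exists_lifts (𝒴 : SplitSpace IM M I N) (𝒳 : SplitSpace IM M I' N') :
    ∃ (nb : 𝒳.carrier → Set N') (l : 𝒳.carrier → 𝒳.carrier → 𝒴.carrier),
      (∀ p, IsOpen (nb p)) ∧ (∀ p : 𝒳.carrier, (p : N') ∈ nb p) ∧
      (∀ p x, 𝒴.proj (l p x) = 𝒳.proj x) ∧
      ∀ p x : 𝒳.carrier, (x : N') ∈ nb p → SmAt I' I (fun x => (l p x : N)) x := by
  classical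
  choose U hU hmU s hs hsm hsp using 𝒴.locally_split
  choose W hW hWU using fun m => 𝒳.exists_isOpen_preimage (hU m)
  -- The index of the local section to be used: the one attached to p where it is defined, and
  -- otherwise the one attached to x, whose domain certainly contains `𝒳.proj x`.
  let c : 𝒳.carrier → 𝒳.carrier → M := fun p x => if (x : N') ∈ W (𝒳.proj p) then 𝒳.proj p
    else 𝒳.proj x
  have hc : ∀ p x, 𝒳.proj x ∈ U (c p x) := by
    intro p x
    by_cases h : (x : N') ∈ W (𝒳.proj p)
    · simp only [c, if_pos h]
      exact (hWU _ x).mp h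
    · simp only [c, if_neg h]
      exact hmU _
  refine ⟨fun p => W (𝒳.proj p), fun p x => ⟨s (c p x) (𝒳.proj x), hsm _ (hc p x)⟩,
    fun p => hW _, fun p => (hWU _ p).mpr (hmU _), fun p x => hsp _ _ (hc p x), ?_⟩
  intro p x hx
  have hs' := (hs (𝒳.proj p)).contMDiffAt ((hU _).mem_nhds ((hWU _ x).mp hx))
  refine (SmAt.contMDiffAt_comp hs' (smAt_proj x)).congr ?_
  filter_upwards [continuous_subtype_val.continuousAt.eventually_mem ((hW _).mem_nhds hx)]
    with x' hx'
  simp only [c, if_pos hx']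

/-- The first component of a point of `Y ×_M X`. -/
abbrev fstPt (z : (𝒴.prod 𝒳).carrier) : 𝒴.carrier := ⟨z.1.1, z.2.1⟩

/-- The second component of a point of `Y ×_M X`. -/
abbrev sndPt (z : (𝒴.prod 𝒳).carrier) : 𝒳.carrier := ⟨z.1.2, z.2.2.1⟩

/-- The point of `Y ×_M X` with given components. -/
abbrev mkPt {y : 𝒴.carrier} {x : 𝒳.carrier} (h : 𝒴.proj y = 𝒳.proj x) : (𝒴.prod 𝒳).carrier :=
  ⟨(y, x), y.2, x.2, h⟩

lemma proj_sndPt {z₁ z₂ : (𝒴.prod 𝒳).carrier}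
    (h : (𝒴.prod 𝒳).proj z₁ = (𝒴.prod 𝒳).proj z₂) :
    𝒳.proj (sndPt z₁) = 𝒳.proj (sndPt z₂) := z₁.2.2.2.symm.trans (h.trans z₂.2.2.2)

end SplitSpace

open SplitSpace

/-- The pull-back of a bundle gerbe to `Y ×_M X`. -/
def BundleGerbe.pullFst (L : BundleGerbe 𝒴) (𝒳 : SplitSpace IM M I' N') :
    BundleGerbe (𝒴.prod 𝒳) where
  bundle := prodFst L.bundle 𝒳
  rank_one _ := L.rank_one _
  product := L.product.prodFst 𝒳
  assoc := GerbeProduct.IsAssoc.prodFst L.assoc 𝒳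

/-- The pull-back of a bundle gerbe to `Y ×_M X`. -/
def BundleGerbe.pullSnd (𝒴 : SplitSpace IM M I N) (J : BundleGerbe 𝒳) :
    BundleGerbe (𝒴.prod 𝒳) where
  bundle := prodSnd 𝒴 J.bundle
  rank_one _ := J.rank_one _
  product := J.product.prodSnd 𝒴
  assoc := GerbeProduct.IsAssoc.prodSnd 𝒴 J.assoc

/-- The pull-back of a bundle to `Y ×_M X`. -/
abbrev bundleFst (A : HermitianBundle I 𝒴.carrier) (𝒳 : SplitSpace IM M I' N') :
    HermitianBundle (I.prod I') (𝒴.prod 𝒳).carrier :=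
  A.pullback (S' := (𝒴.prod 𝒳).carrier) Prod.fst contMDiff_fst (fun _ h => h.1)

/-- The pull-back of a bundle to `Y ×_M X`. -/
abbrev bundleSnd (𝒴 : SplitSpace IM M I N) (A : HermitianBundle I' 𝒳.carrier) :
    HermitianBundle (I.prod I') (𝒴.prod 𝒳).carrier :=
  A.pullback (S' := (𝒴.prod 𝒳).carrier) Prod.snd contMDiff_snd (fun _ h => h.2.1)

/-- The pull-back of a module to `Y ×_M X`. -/
def GerbeModule.pullFst {L : BundleGerbe 𝒴} (F : GerbeModule L) (𝒳 : SplitSpace IM M I' N') :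
    GerbeModule (L.pullFst 𝒳) where
  bundle := bundleFst F.bundle 𝒳
  act :=
    { equiv := (F.act.pullback (S' := (𝒴.prod 𝒳).sq)
        (fun p : (N × N') × (N × N') => (p.1.1, p.2.1))
        ((contMDiff_fst.comp contMDiff_fst).prodMk (contMDiff_fst.comp contMDiff_snd))
        (𝒴.mapsTo_prod_sq_fst 𝒳)).equiv
      smooth := (F.act.pullback (S' := (𝒴.prod 𝒳).sq)
        (fun p : (N × N') × (N × N') => (p.1.1, p.2.1))
        ((contMDiff_fst.comp contMDiff_fst).prodMk (contMDiff_fst.comp contMDiff_snd))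
        (𝒴.mapsTo_prod_sq_fst 𝒳)).smooth }
  act_assoc z₁ z₂ z₃ h h' a b e := F.act_assoc (fstPt z₁) (fstPt z₂) (fstPt z₃) h h' a b e

lemma SecAt.pullSnd {J : BundleGerbe 𝒳} {φ₁ φ₂ : T → (𝒴.prod 𝒳).carrier}
    {h : ∀ t, (𝒴.prod 𝒳).proj (φ₁ t) = (𝒴.prod 𝒳).proj (φ₂ t)} {t₀ : T}
    (h₁ : SmAt I₂ (I.prod I') (fun t => (φ₁ t : N × N')) t₀)
    (h₂ : SmAt I₂ (I.prod I') (fun t => (φ₂ t : N × N')) t₀)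
    {a : ∀ t, J.bundle.fiber (𝒳.pair (proj_sndPt (h t)))}
    (ha : SecAt I₂ J.bundle (fun t => 𝒳.pair (proj_sndPt (h t))) a t₀) :
    SecAt I₂ (J.pullSnd 𝒴).bundle (fun t => (𝒴.prod 𝒳).pair (h t)) a t₀ :=
  SecAt.pullback (A := J.bundle) (φ := fun t => (𝒴.prod 𝒳).pair (h t))
    (f := fun p : (N × N') × (N × N') => (p.1.2, p.2.2)) (S := (𝒴.prod 𝒳).sq)
    (hf := (contMDiff_snd.comp contMDiff_fst).prodMk (contMDiff_snd.comp contMDiff_snd))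
    (hS := 𝒴.mapsTo_prod_sq_snd 𝒳) (h₁.prodMk h₂) ha

lemma SecAt.pullFst {L : BundleGerbe 𝒴} {φ₁ φ₂ : T → (𝒴.prod 𝒳).carrier}
    {h : ∀ t, (𝒴.prod 𝒳).proj (φ₁ t) = (𝒴.prod 𝒳).proj (φ₂ t)} {t₀ : T}
    (h₁ : SmAt I₂ (I.prod I') (fun t => (φ₁ t : N × N')) t₀)
    (h₂ : SmAt I₂ (I.prod I') (fun t => (φ₂ t : N × N')) t₀)
    {a : ∀ t, L.bundle.fiber (𝒴.pair (y₁ := fstPt (φ₁ t)) (y₂ := fstPt (φ₂ t)) (h t))}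
    (ha : SecAt I₂ L.bundle
      (fun t => 𝒴.pair (y₁ := fstPt (φ₁ t)) (y₂ := fstPt (φ₂ t)) (h t)) a t₀) :
    SecAt I₂ (L.pullFst 𝒳).bundle (fun t => (𝒴.prod 𝒳).pair (h t)) a t₀ :=
  SecAt.pullback (A := L.bundle) (φ := fun t => (𝒴.prod 𝒳).pair (h t))
    (f := fun p : (N × N') × (N × N') => (p.1.1, p.2.1)) (S := (𝒴.prod 𝒳).sq)
    (hf := (contMDiff_fst.comp contMDiff_fst).prodMk (contMDiff_fst.comp contMDiff_snd))
    (hS := 𝒴.mapsTo_prod_sq_fst 𝒳) (h₁.prodMk h₂) ha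

/-- A unit vector of a gerbe over the diagonal of `X`, acting between two points of `Y ×_M X` with
the same second component. -/
lemma smul_one_smul {J : BundleGerbe 𝒳} {G : GerbeModule (J.pullSnd 𝒴)} {x : 𝒳.carrier}
    {y₁ y₂ y₃ : 𝒴.carrier} (h₁ : 𝒴.proj y₁ = 𝒳.proj x) (h₂ : 𝒴.proj y₂ = 𝒳.proj x)
    (h₃ : 𝒴.proj y₃ = 𝒳.proj x) (g : G.bundle.fiber (mkPt h₃)) :
    G.smul (y₁ := mkPt h₁) (y₂ := mkPt h₂) (h₁.trans h₂.symm) (J.one x)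
      (G.smul (y₁ := mkPt h₂) (y₂ := mkPt h₃) (h₂.trans h₃.symm) (J.one x) g) =
    G.smul (y₁ := mkPt h₁) (y₂ := mkPt h₃) (h₁.trans h₃.symm) (J.one x) g := by
  have e : (J.pullSnd 𝒴).mul (y₁ := mkPt h₁) (y₂ := mkPt h₂) (y₃ := mkPt h₃) (h₁.trans h₂.symm)
    (h₂.trans h₃.symm) (J.one x) (J.one x) = J.one x := J.one_mul_one x
  exact (GerbeModule.mul_smul (y₁ := mkPt h₁) (y₂ := mkPt h₂) (y₃ := mkPt h₃)
    (h := h₁.trans h₂.symm) (h' := h₂.trans h₃.symm) (J.one x) (J.one x) g).symm.trans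
    (congrArg (fun a => G.smul (y₁ := mkPt h₁) (y₂ := mkPt h₃) (h₁.trans h₃.symm) a g) e)

/-- Both sides are the action of j between the outer points, since j·1 = j = 1·j. So the
identifications along the fibres of the projection to X intertwine the action of J. -/
lemma smul_smul_one {J : BundleGerbe 𝒳} {G : GerbeModule (J.pullSnd 𝒴)}
    {z₁ z₂ : (𝒴.prod 𝒳).carrier} (h : (𝒴.prod 𝒳).proj z₁ = (𝒴.prod 𝒳).proj z₂)
    {y₁ y₂ : 𝒴.carrier} (h₁ : 𝒴.proj y₁ = 𝒳.proj (sndPt z₁)) (h₂ : 𝒴.proj y₂ = 𝒳.proj (sndPt z₂))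
    (j : J.bundle.fiber (𝒳.pair (proj_sndPt h))) (g : G.bundle.fiber z₂) :
    G.smul (y₁ := mkPt h₁) (y₂ := mkPt h₂) (h₁.trans ((proj_sndPt h).trans h₂.symm)) j
      (G.smul (y₁ := mkPt h₂) (y₂ := z₂) (h₂.trans z₂.2.2.2.symm) (J.one (sndPt z₂)) g) =
    G.smul (y₁ := mkPt h₁) (y₂ := z₁) (h₁.trans z₁.2.2.2.symm) (J.one (sndPt z₁))
      (G.smul h j g) := by
  have e₁ : (J.pullSnd 𝒴).mul (y₁ := mkPt h₁) (y₂ := mkPt h₂) (y₃ := z₂)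
    (h₁.trans ((proj_sndPt h).trans h₂.symm)) (h₂.trans z₂.2.2.2.symm) j (J.one (sndPt z₂)) = j :=
    J.mul_one (y₁ := sndPt z₁) (y₂ := sndPt z₂) j
  have e₂ : (J.pullSnd 𝒴).mul (y₁ := mkPt h₁) (y₂ := z₁) (y₃ := z₂)
    (h₁.trans z₁.2.2.2.symm) h (J.one (sndPt z₁)) j = j :=
    J.one_mul (y₁ := sndPt z₁) (y₂ := sndPt z₂) j
  refine (GerbeModule.mul_smul (y₁ := mkPt h₁) (y₂ := mkPt h₂) (y₃ := z₂)
    (h := h₁.trans ((proj_sndPt h).trans h₂.symm)) (h' := h₂.trans z₂.2.2.2.symm)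
    j (J.one (sndPt z₂)) g).symm.trans (Eq.trans ?_ (GerbeModule.mul_smul (y₁ := mkPt h₁)
      (y₂ := z₁) (y₃ := z₂) (h := h₁.trans z₁.2.2.2.symm) (h' := h) (J.one (sndPt z₁)) j g))
  rw [e₁, e₂]

lemma secAt_smul_one {J : BundleGerbe 𝒳} {G : GerbeModule (J.pullSnd 𝒴)} {x : T → 𝒳.carrier}
    {y₁ y₂ : T → 𝒴.carrier} (h₁ : ∀ t, 𝒴.proj (y₁ t) = 𝒳.proj (x t))
    (h₂ : ∀ t, 𝒴.proj (y₂ t) = 𝒳.proj (x t)) {t₀ : T}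
    (hy : SmAt I₂ I (fun t => (y₁ t : N)) t₀) {g : ∀ t, G.bundle.fiber (mkPt (h₂ t))}
    (hg : SecAt I₂ G.bundle (fun t => mkPt (h₂ t)) g t₀) :
    SecAt I₂ G.bundle (fun t => mkPt (h₁ t)) (fun t => G.smul (y₁ := mkPt (h₁ t))
      (y₂ := mkPt (h₂ t)) ((h₁ t).trans (h₂ t).symm) (J.one (x t)) (g t)) t₀ := by
  have hx : SmAt I₂ I' (fun t => (x t : N')) t₀ := hg.1.snd
  have h₃ : SecAt I₂ (J.pullSnd 𝒴).bundle (fun t => (𝒴.prod 𝒳).pair (y₁ := mkPt (h₁ t))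
      (y₂ := mkPt (h₂ t)) ((h₁ t).trans (h₂ t).symm)) (fun t => J.one (x t)) t₀ :=
    SecAt.pullSnd (hy.prodMk hx) hg.1 (J.secAt_one (φ := x) hx)
  exact GerbeModule.secAt_smul (φ₁ := fun t => mkPt (h₁ t)) (φ₂ := fun t => mkPt (h₂ t)) h₃ hg

section

variable {J : BundleGerbe 𝒳} (G : GerbeModule (J.pullSnd 𝒴)) (nb : 𝒳.carrier → Set N')
  (l : 𝒳.carrier → 𝒳.carrier → 𝒴.carrier) (hnb : ∀ p, IsOpen (nb p))
  (hmem : ∀ p : 𝒳.carrier, (p : N') ∈ nb p) (hl : ∀ p x, 𝒴.proj (l p x) = 𝒳.proj x)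
  (hs : ∀ p x : 𝒳.carrier, (x : N') ∈ nb p → SmAt I' I (fun x => (l p x : N)) x)

/-- The gluing data of the descended bundle. -/
def descentData : GlueData I' 𝒳.carrier G.bundle where
  -- The lift `l x x` need not vary smoothly with x. The smooth structure comes from the lifts `l p
  -- x` with p fixed, which the unit of J compares with it.
  fiber x := G.bundle.fiber (mkPt (hl x x))
  nbhd := nb
  isOpen_nbhd := hnb
  mem_nbhd := hmem
  map p x := mkPt (hl p x)
  smooth_map p x hx := (hs p x hx).prodMk (SmAt.val x)
  triv p x := G.smulUnit (y₁ := mkPt (hl x x)) (y₂ := mkPt (hl p x))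
    ((hl x x).trans (hl p x).symm) (J.one x) (J.norm_one x)
  smooth_triv p q x₀ hp hq σ hσ := by
    refine (secAt_smul_one (fun x => hl q x) (fun x => hl p x) (hs q x₀ hq) hσ).congr
      (Filter.Eventually.of_forall fun x => ?_)
    rw [LinearIsometryEquiv.symm_apply_eq]
    exact (smul_one_smul (hl x x) (hl q x) (hl p x) (σ x)).symm

/-- This expresses the smoothness of the map from `G` to the pull-back of the descended bundle. The
section is first moved to the lift attached to `sndPt (φ t₀)`, which is smooth nearby, and from
there to the diagonal lift; by `smul_one_smul` the detour changes nothing. -/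
lemma descentData_secAt {φ : T → (𝒴.prod 𝒳).carrier} {t₀ : T} {σ : ∀ t, G.bundle.fiber (φ t)}
    (hσ : SecAt I₂ G.bundle φ σ t₀) :
    SecAt I₂ (descentData G nb l hnb hmem hl hs).bundle (fun t => sndPt (φ t))
      (fun t => G.smul (y₁ := mkPt (hl (sndPt (φ t)) (sndPt (φ t)))) (y₂ := φ t)
        ((hl _ _).trans (φ t).2.2.2.symm) (J.one (sndPt (φ t))) (σ t)) t₀ := by
  have hx : SmAt I₂ I' (fun t => (sndPt (φ t) : N')) t₀ := hσ.1.snd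
  have hy : SmAt I₂ I (fun t => (l (sndPt (φ t₀)) (sndPt (φ t)) : N)) t₀ :=
    (hs (sndPt (φ t₀)) (sndPt (φ t₀)) (hmem _)).comp (φ := fun t => sndPt (φ t)) hx
  have h₁ := secAt_smul_one (x := fun t => sndPt (φ t)) (y₁ := fun t => l (sndPt (φ t₀)) (sndPt (φ t)))
    (y₂ := fun t => fstPt (φ t)) (fun t => hl _ _) (fun t => (φ t).2.2.2) hy hσ
  refine ((descentData G nb l hnb hmem hl hs).secAt (ψ := fun t => sndPt (φ t)) hx
    (sndPt (φ t₀)) (hmem _) h₁).congr (Filter.Eventually.of_forall fun t => ?_)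
  exact (smul_one_smul (G := G) (y₃ := fstPt (φ t)) (hl (sndPt (φ t)) (sndPt (φ t)))
    (hl (sndPt (φ t₀)) (sndPt (φ t))) (φ t).2.2.2 (σ t)).symm

/-- Near `x₀` the index of the lift is frozen at the two components of `x₀`. Along these smooth
lifts the action of `G` is smooth, and `smul_smul_one` carries the result over to the diagonal lifts
on which the descended action is defined. -/
lemma descentData_act_smooth (x₀ : 𝒳.sq) : ∃ (κ : Type) (_ : Fintype κ)
    (e : κ → ∀ p : 𝒳.sq, (J.bundle.tensor ((descentData G nb l hnb hmem hl hs).bundle.pullback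
      (S' := 𝒳.sq) Prod.snd contMDiff_snd (fun _ h => h.2.1))).fiber p),
    FrameAt (I'.prod I') (J.bundle.tensor ((descentData G nb l hnb hmem hl hs).bundle.pullback
      (S' := 𝒳.sq) Prod.snd contMDiff_snd (fun _ h => h.2.1))) (fun p => p) e x₀ ∧
    ∀ k, SecAt (I'.prod I') ((descentData G nb l hnb hmem hl hs).bundle.pullback
      (I' := I'.prod I') (S' := 𝒳.sq) (Prod.fst : N' × N' → N') contMDiff_fst (fun _ h => h.1))
      (fun p : 𝒳.sq => p) (fun p : 𝒳.sq =>
      G.actAt (y₁ := mkPt (hl ⟨p.1.1, p.2.1⟩ ⟨p.1.1, p.2.1⟩))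
        (y₂ := mkPt (hl ⟨p.1.2, p.2.2.1⟩ ⟨p.1.2, p.2.2.1⟩))
        ((hl ⟨p.1.1, p.2.1⟩ ⟨p.1.1, p.2.1⟩).trans
          (p.2.2.2.trans (hl ⟨p.1.2, p.2.2.1⟩ ⟨p.1.2, p.2.2.1⟩).symm)) (e k p)) x₀ := by
  let x₁ : 𝒳.sq → 𝒳.carrier := fun p => ⟨p.1.1, p.2.1⟩
  let x₂ : 𝒳.sq → 𝒳.carrier := fun p => ⟨p.1.2, p.2.2.1⟩
  have hx : ∀ p, 𝒳.proj (x₁ p) = 𝒳.proj (x₂ p) := fun p => p.2.2.2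
  have hx₁ : SmAt (I'.prod I') I' (fun p => (x₁ p : N')) x₀ := (SmAt.val x₀).fst
  have hx₂ : SmAt (I'.prod I') I' (fun p => (x₂ p : N')) x₀ := (SmAt.val x₀).snd
  let z₁ : 𝒳.sq → (𝒴.prod 𝒳).carrier := fun p => mkPt (hl (x₁ x₀) (x₁ p))
  let z₂ : 𝒳.sq → (𝒴.prod 𝒳).carrier := fun p => mkPt (hl (x₂ x₀) (x₂ p))
  have hz₁ : SmAt (I'.prod I') (I.prod I') (fun p => (z₁ p : N × N')) x₀ :=
    ((hs (x₁ x₀) (x₁ x₀) (hmem _)).comp (φ := x₁) hx₁).prodMk hx₁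
  have hz₂ : SmAt (I'.prod I') (I.prod I') (fun p => (z₂ p : N × N')) x₀ :=
    ((hs (x₂ x₀) (x₂ x₀) (hmem _)).comp (φ := x₂) hx₂).prodMk hx₂
  have hz : ∀ p, (𝒴.prod 𝒳).proj (z₁ p) = (𝒴.prod 𝒳).proj (z₂ p) :=
    fun p => (hl _ _).trans ((hx p).trans (hl _ _).symm)
  have hJ := exists_frameAt J.bundle (φ := fun p : 𝒳.sq => p) (SmAt.val x₀)
  have hG := exists_frameAt G.bundle (φ := z₂) hz₂
  have hD := FrameAt.pullback (A := (descentData G nb l hnb hmem hl hs).bundle)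
    (φ := fun p : 𝒳.sq => p) (f := Prod.snd) (hf := contMDiff_snd) (hS := fun _ h => h.2.1)
    (SmAt.val x₀) ((descentData G nb l hnb hmem hl hs).frameAt (ψ := x₂) hx₂ (x₂ x₀) (hmem _) hG)
  refine ⟨_, inferInstance, _, hJ.tensor hD, fun k => ?_⟩
  have h₁ : SecAt (I'.prod I') (J.pullSnd 𝒴).bundle (fun p => (𝒴.prod 𝒳).pair (hz p))
      (fun p => frameSec J.bundle x₀ k.1 p) x₀ := SecAt.pullSnd hz₁ hz₂ (hJ.1 k.1)
  have h₂ := descentData_secAt G nb l hnb hmem hl hs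
    (GerbeModule.secAt_smul (φ₁ := z₁) (φ₂ := z₂) (h := hz) h₁ (hG.1 k.2))
  refine SecAt.pullback (φ := fun p : 𝒳.sq => p) (f := Prod.fst)
    (A := (descentData G nb l hnb hmem hl hs).bundle) (SmAt.val x₀) (h₂.congr
      (Filter.Eventually.of_forall fun p => ?_))
  exact smul_smul_one (G := G) (z₁ := z₁ p) (z₂ := z₂ p) (hz p) (hl _ _) (hl _ _) _ _

/-- The descended module. -/
def descentModule : GerbeModule J where
  bundle := (descentData G nb l hnb hmem hl hs).bundle
  act :=
    { equiv := fun p => G.actAt (y₁ := mkPt (hl ⟨p.1.1, p.2.1⟩ ⟨p.1.1, p.2.1⟩))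
        (y₂ := mkPt (hl ⟨p.1.2, p.2.2.1⟩ ⟨p.1.2, p.2.2.1⟩))
        ((hl ⟨p.1.1, p.2.1⟩ ⟨p.1.1, p.2.1⟩).trans
          (p.2.2.2.trans (hl ⟨p.1.2, p.2.2.1⟩ ⟨p.1.2, p.2.2.1⟩).symm))
      smooth := IsSmoothFamily.of_secAt (descentData_act_smooth G nb l hnb hmem hl hs) }
  act_assoc x₁ x₂ x₃ h h' a b e := G.act_assoc (mkPt (hl x₁ x₁)) (mkPt (hl x₂ x₂))
    (mkPt (hl x₃ x₃)) ((hl _ _).trans (h.trans (hl _ _).symm))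
    ((hl _ _).trans (h'.trans (hl _ _).symm)) a b e

end

/-- Descent: a module over the pull-back of `J` to `Y ×_M X` comes from a `J`-module. -/
theorem exists_descent {J : BundleGerbe 𝒳} (G : GerbeModule (J.pullSnd 𝒴)) :
    ∃ (F : GerbeModule J) (θ : BundleIso G.bundle (bundleSnd 𝒴 F.bundle)),
      ∀ (z₁ z₂ : (𝒴.prod 𝒳).carrier) (h : (𝒴.prod 𝒳).proj z₁ = (𝒴.prod 𝒳).proj z₂)
        (j : J.bundle.fiber (𝒳.pair (proj_sndPt h))) (g : G.bundle.fiber z₂),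
        θ.equiv z₁ (G.smul h j g) = F.smul (proj_sndPt h) j (θ.equiv z₂ g) := by
  obtain ⟨nb, l, hnb, hmem, hl, hs⟩ := exists_lifts 𝒴 𝒳
  -- The isomorphism θ moves the fibre at z to the chosen lift of `sndPt z` by acting with the unit
  -- of J.
  refine ⟨descentModule G nb l hnb hmem hl hs,
    { equiv := fun z => G.smulUnit (y₁ := mkPt (hl (sndPt z) (sndPt z))) (y₂ := z)
        ((hl _ _).trans z.2.2.2.symm) (J.one (sndPt z)) (J.norm_one (sndPt z))
      smooth := IsSmoothFamily.of_secAt fun z₀ => ?_ }, fun z₁ z₂ h j g => ?_⟩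
  · have hF := exists_frameAt G.bundle (φ := fun z => z) (SmAt.val z₀)
    exact ⟨_, inferInstance, _, hF, fun k => SecAt.pullback (φ := fun z => z) (SmAt.val z₀)
      (descentData_secAt G nb l hnb hmem hl hs (hF.1 k))⟩
  · exact (smul_smul_one h (hl _ _) (hl _ _) j g).symm

end Descent

/-! ### Twisting modules by line bundles -/

section TwistLinear

variable {B Q₁ Q₂ E₁ E₂ : Type*}
  [NormedAddCommGroup B] [InnerProductSpace ℂ B] [FiniteDimensional ℂ B]
  [NormedAddCommGroup Q₁] [InnerProductSpace ℂ Q₁] [FiniteDimensional ℂ Q₁]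
  [NormedAddCommGroup Q₂] [InnerProductSpace ℂ Q₂] [FiniteDimensional ℂ Q₂]
  [NormedAddCommGroup E₁] [InnerProductSpace ℂ E₁] [FiniteDimensional ℂ E₁]
  [NormedAddCommGroup E₂] [InnerProductSpace ℂ E₂] [FiniteDimensional ℂ E₂]

/-- The isometry `B ⊗ (Q₂ ⊗ E₂) ≅ Q₁ ⊗ E₁` with `b ⊗ (q₂ ⊗ e) ↦ q₁ ⊗ u e`. -/
def twistIso (hB : Module.finrank ℂ B = 1) (h₁ : Module.finrank ℂ Q₁ = 1)
    (h₂ : Module.finrank ℂ Q₂ = 1) (b : B) (hb : ‖b‖ = 1) (q₁ : Q₁) (hq₁ : ‖q₁‖ = 1) (q₂ : Q₂)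
    (hq₂ : ‖q₂‖ = 1) (u : E₂ ≃ₗᵢ[ℂ] E₁) : B ⊗[ℂ] (Q₂ ⊗[ℂ] E₂) ≃ₗᵢ[ℂ] Q₁ ⊗[ℂ] E₁ :=
  (((tmulUnit hB b hb).symm.trans (tmulUnit h₂ q₂ hq₂).symm).trans u).trans (tmulUnit h₁ q₁ hq₁)

lemma tmulUnit_symm_tmul (h : Module.finrank ℂ B = 1) (b : B) (hb : ‖b‖ = 1) (c : B) (e : E₁) :
    (tmulUnit h b hb).symm (c ⊗ₜ[ℂ] e) = ⟪b, c⟫_ℂ • e := by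
  rw [LinearIsometryEquiv.symm_apply_eq, tmulUnit_apply, TensorProduct.tmul_smul,
    TensorProduct.smul_tmul', ← line_eq_inner_smul h hb c]

lemma twistIso_tmul (hB : Module.finrank ℂ B = 1) (h₁ : Module.finrank ℂ Q₁ = 1)
    (h₂ : Module.finrank ℂ Q₂ = 1) (b : B) (hb : ‖b‖ = 1) (q₁ : Q₁) (hq₁ : ‖q₁‖ = 1) (q₂ : Q₂)
    (hq₂ : ‖q₂‖ = 1) (u : E₂ ≃ₗᵢ[ℂ] E₁) (c : B) (q : Q₂) (e : E₂) :
    twistIso hB h₁ h₂ b hb q₁ hq₁ q₂ hq₂ u (c ⊗ₜ (q ⊗ₜ e)) =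
      (⟪b, c⟫_ℂ * ⟪q₂, q⟫_ℂ) • (q₁ ⊗ₜ[ℂ] u e) := by
  simp only [twistIso, LinearIsometryEquiv.trans_apply]
  rw [tmulUnit_symm_tmul, map_smul, tmulUnit_symm_tmul, map_smul, map_smul, map_smul, map_smul,
    smul_smul, tmulUnit_apply]

end TwistLinear

section Twists

variable {EM HM : Type*} [NormedAddCommGroup EM] [NormedSpace ℝ EM] [TopologicalSpace HM]
  {IM : ModelWithCorners ℝ EM HM} {M : Type*} [TopologicalSpace M] [ChartedSpace HM M]
  {E H : Type*} [NormedAddCommGroup E] [NormedSpace ℝ E] [TopologicalSpace H]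
  {I : ModelWithCorners ℝ E H} {N : Type*} [TopologicalSpace N] [ChartedSpace H N]
  {E' H' : Type*} [NormedAddCommGroup E'] [NormedSpace ℝ E'] [TopologicalSpace H']
  {I' : ModelWithCorners ℝ E' H'} {N' : Type*} [TopologicalSpace N'] [ChartedSpace H' N']
  {E₂ H₂ N₂ : Type*} [NormedAddCommGroup E₂] [NormedSpace ℝ E₂] [TopologicalSpace H₂]
  {I₂ : ModelWithCorners ℝ E₂ H₂} [TopologicalSpace N₂] [ChartedSpace H₂ N₂]
  {𝒴 : SplitSpace IM M I N} {𝒳 : SplitSpace IM M I' N'} {𝒵 : SplitSpace IM M I N} {T : Set N₂}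

open SplitSpace

/-- A unit section of a line bundle is a frame. -/
lemma SecAt.lineFrameAt {S : Set N} {A : HermitianBundle I S}
    (hA : ∀ s, Module.finrank ℂ (A.fiber s) = 1) {φ : T → S} {t₀ : T} {σ : ∀ t, A.fiber (φ t)}
    (hσ : SecAt I₂ A φ σ t₀) (h : ∀ᶠ t in nhds t₀, ‖σ t‖ = 1) :
    FrameAt I₂ A φ (fun (_ : Unit) t => σ t) t₀ := by
  refine ⟨fun _ => hσ, h.mono fun t ht => ?_⟩
  have ho : Orthonormal ℂ (fun _ : Unit => σ t) :=
    ⟨fun _ => ht, fun i j hij => (hij (Subsingleton.elim i j)).elim⟩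
  have hs : ⊤ ≤ Submodule.span ℂ (Set.range fun _ : Unit => σ t) := fun v _ => by
    rw [line_eq_inner_smul (hA _) ht v]
    exact Submodule.smul_mem _ _ (Submodule.subset_span ⟨(), rfl⟩)
  exact ⟨OrthonormalBasis.mk ho hs, fun _ => congrFun (OrthonormalBasis.coe_mk ho hs) _⟩

/-- The first point of an element of `Y^[2]`. -/
abbrev SplitSpace.sqFst (w : 𝒵.sq) : 𝒵.carrier := ⟨w.1.1, w.2.1⟩

/-- The second point of an element of `Y^[2]`. -/
abbrev SplitSpace.sqSnd (w : 𝒵.sq) : 𝒵.carrier := ⟨w.1.2, w.2.2.1⟩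

/-- A line bundle `Q` with a correspondence between unit vectors of two bundle gerbes `A` and `B`,
which makes `Q ⊗ E` a `B`-module for every `A`-module `E`. -/
structure Twist (A B : BundleGerbe 𝒵) where
  line : HermitianBundle I 𝒵.carrier
  rank_one : ∀ z, Module.finrank ℂ (line.fiber z) = 1
  -- `rel h q₁ q₂ a b` is to mean that b sends q₂ ⊗ e to q₁ ⊗ ae for every e.
  rel : ∀ {z₁ z₂ : 𝒵.carrier} (h : 𝒵.proj z₁ = 𝒵.proj z₂), line.fiber z₁ → line.fiber z₂ →
    A.bundle.fiber (𝒵.pair h) → B.bundle.fiber (𝒵.pair h) → Prop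
  rel_norm : ∀ {z₁ z₂ : 𝒵.carrier} {h : 𝒵.proj z₁ = 𝒵.proj z₂} {q₁ : line.fiber z₁}
    {q₂ : line.fiber z₂} {a : A.bundle.fiber (𝒵.pair h)} {b : B.bundle.fiber (𝒵.pair h)},
    rel h q₁ q₂ a b → ‖q₁‖ = 1 ∧ ‖q₂‖ = 1 ∧ ‖a‖ = 1 ∧ ‖b‖ = 1
  exists_rel : ∀ {z₁ z₂ : 𝒵.carrier} (h : 𝒵.proj z₁ = 𝒵.proj z₂) (q₁ : line.fiber z₁)
    (q₂ : line.fiber z₂) (a : A.bundle.fiber (𝒵.pair h)), ‖q₁‖ = 1 → ‖q₂‖ = 1 → ‖a‖ = 1 →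
    ∃ b, rel h q₁ q₂ a b
  exists_local : ∀ w₀ : 𝒵.sq, ∃ (q₁ : ∀ w : 𝒵.sq, line.fiber (sqFst w))
    (q₂ : ∀ w : 𝒵.sq, line.fiber (sqSnd w)) (a : ∀ w : 𝒵.sq, A.bundle.fiber w)
    (b : ∀ w : 𝒵.sq, B.bundle.fiber w), SecAt (I.prod I) line sqFst q₁ w₀ ∧
    SecAt (I.prod I) line sqSnd q₂ w₀ ∧ SecAt (I.prod I) A.bundle (fun w => w) a w₀ ∧
    SecAt (I.prod I) B.bundle (fun w => w) b w₀ ∧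
    ∀ᶠ w : 𝒵.sq in nhds w₀, rel (z₁ := sqFst w) (z₂ := sqSnd w) w.2.2.2 (q₁ w) (q₂ w) (a w) (b w)
  -- Two related quadruples differ by phases. This identity says that both sides of b(q₂ ⊗ e) = q₁ ⊗
  -- ae change by the same factor, so all related quadruples define one action.
  rel_scale : ∀ {z₁ z₂ : 𝒵.carrier} {h : 𝒵.proj z₁ = 𝒵.proj z₂} {q₁ q₁' : line.fiber z₁}
    {q₂ q₂' : line.fiber z₂} {a a' : A.bundle.fiber (𝒵.pair h)}
    {b b' : B.bundle.fiber (𝒵.pair h)}, rel h q₁ q₂ a b → rel h q₁' q₂' a' b' →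
    ⟪b, b'⟫_ℂ * ⟪q₂, q₂'⟫_ℂ = ⟪q₁, q₁'⟫_ℂ * ⟪a, a'⟫_ℂ
  rel_mul : ∀ {z₁ z₂ z₃ : 𝒵.carrier} {h : 𝒵.proj z₁ = 𝒵.proj z₂} {h' : 𝒵.proj z₂ = 𝒵.proj z₃}
    {q₁ : line.fiber z₁} {q₂ : line.fiber z₂} {q₃ : line.fiber z₃}
    {a : A.bundle.fiber (𝒵.pair h)} {b : B.bundle.fiber (𝒵.pair h)}
    {a' : A.bundle.fiber (𝒵.pair h')} {b' : B.bundle.fiber (𝒵.pair h')}, rel h q₁ q₂ a b →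
    rel h' q₂ q₃ a' b' → rel (h.trans h') q₁ q₃ (A.mul h h' a a') (B.mul h h' b b')

namespace Twist

variable {A B : BundleGerbe 𝒵} (W : Twist A B)

lemma exists_rel' {z₁ z₂ : 𝒵.carrier} (h : 𝒵.proj z₁ = 𝒵.proj z₂) :
    ∃ q : (W.line.fiber z₁ × W.line.fiber z₂) ×
      (A.bundle.fiber (𝒵.pair h) × B.bundle.fiber (𝒵.pair h)),
      W.rel h q.1.1 q.1.2 q.2.1 q.2.2 := by
  obtain ⟨q₁, h₁⟩ := exists_unit (W.rank_one z₁)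
  obtain ⟨q₂, h₂⟩ := exists_unit (W.rank_one z₂)
  obtain ⟨a, ha⟩ := exists_unit (A.rank_one (𝒵.pair h))
  obtain ⟨b, hb⟩ := W.exists_rel h q₁ q₂ a h₁ h₂ ha
  exact ⟨((q₁, q₂), (a, b)), hb⟩

variable (F : GerbeModule A)

/-- The action on the twisted bundle. -/
def action {z₁ z₂ : 𝒵.carrier} (h : 𝒵.proj z₁ = 𝒵.proj z₂) :
    B.bundle.fiber (𝒵.pair h) ⊗[ℂ] (W.line.fiber z₂ ⊗[ℂ] F.bundle.fiber z₂) ≃ₗᵢ[ℂ]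
      W.line.fiber z₁ ⊗[ℂ] F.bundle.fiber z₁ :=
  let q := W.exists_rel' h
  let hq := W.rel_norm q.choose_spec
  twistIso (B.rank_one _) (W.rank_one z₁) (W.rank_one z₂) q.choose.2.2 hq.2.2.2 q.choose.1.1 hq.1
    q.choose.1.2 hq.2.1 (F.smulUnit h q.choose.2.1 hq.2.2.1)

/-- `action` is built from one arbitrarily chosen related quadruple; `rel_scale` shows that the
formula holds for every other one. -/
lemma action_tmul {z₁ z₂ : 𝒵.carrier} {h : 𝒵.proj z₁ = 𝒵.proj z₂} {q₁ : W.line.fiber z₁}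
    {q₂ : W.line.fiber z₂} {a : A.bundle.fiber (𝒵.pair h)} {b : B.bundle.fiber (𝒵.pair h)}
    (hr : W.rel h q₁ q₂ a b) (e : F.bundle.fiber z₂) :
    W.action F h (b ⊗ₜ (q₂ ⊗ₜ e)) = q₁ ⊗ₜ F.smul h a e := by
  have hs := W.rel_scale (W.exists_rel' h).choose_spec hr
  have hn := W.rel_norm (W.exists_rel' h).choose_spec
  rw [action, twistIso_tmul, hs, GerbeModule.smulUnit_apply]
  conv_rhs => rw [line_eq_inner_smul (W.rank_one z₁) hn.1 q₁,
    line_eq_inner_smul (A.rank_one _) hn.2.2.1 a, GerbeModule.smul_smul_left,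
    ← TensorProduct.smul_tmul', TensorProduct.tmul_smul, smul_smul]

/-- The quadruple in the definition of `action` is chosen separately at each point. By `action_tmul`
it may be replaced by a smooth local one, and then the smooth frame b ⊗ (q₂ ⊗ f) is sent to the
smooth sections q₁ ⊗ af. -/
lemma action_smooth : IsSmoothFamily
    (B.bundle.tensor ((W.line.tensor F.bundle).pullback (I' := I.prod I) (S' := 𝒵.sq)
      (Prod.snd : N × N → N) contMDiff_snd (fun _ h => h.2.1)))
    ((W.line.tensor F.bundle).pullback (I' := I.prod I) (S' := 𝒵.sq)
      (Prod.fst : N × N → N) contMDiff_fst (fun _ h => h.1))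
    (fun w => (W.action F (z₁ := sqFst w) (z₂ := sqSnd w) w.2.2.2).toLinearEquiv.toLinearMap) := by
  refine IsSmoothFamily.of_secAt fun w₀ => ?_
  obtain ⟨q₁, q₂, a, b, hq₁, hq₂, ha, hb, hr⟩ := W.exists_local w₀
  have hF := exists_frameAt F.bundle hq₂.1
  have h₁ := (hb.lineFrameAt B.rank_one (hr.mono fun w h => (W.rel_norm h).2.2.2)).tensor
    (FrameAt.pullback (I' := I.prod I) (I := I.prod I) (S := 𝒵.sq) (φ := fun w => w)
      (A := W.line.tensor F.bundle) (f := Prod.snd) (hf := contMDiff_snd)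
      (hS := fun _ h => h.2.1) (SmAt.val w₀)
      ((hq₂.lineFrameAt W.rank_one (hr.mono fun w h => (W.rel_norm h).2.1)).tensor hF))
  refine ⟨_, inferInstance, _, h₁, fun k => ?_⟩
  have h₂ := hq₁.tensor (GerbeModule.secAt_smul (φ₁ := sqFst) (φ₂ := sqSnd) (h := fun w => w.2.2.2)
    ha (hF.1 k.2.2))
  refine SecAt.pullback (φ := fun w : 𝒵.sq => w) (f := Prod.fst)
    (A := W.line.tensor F.bundle) (SmAt.val w₀) (h₂.congr (hr.mono fun w h => ?_))
  exact W.action_tmul F h _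

lemma action_smul {z₁ z₂ : 𝒵.carrier} (h : 𝒵.proj z₁ = 𝒵.proj z₂) (c : ℂ)
    (b : B.bundle.fiber (𝒵.pair h)) (x : W.line.fiber z₂ ⊗[ℂ] F.bundle.fiber z₂) :
    W.action F h ((c • b) ⊗ₜ x) = c • W.action F h (b ⊗ₜ x) := by
  rw [← TensorProduct.smul_tmul', map_smul]

lemma action_smul' {z₁ z₂ : 𝒵.carrier} (h : 𝒵.proj z₁ = 𝒵.proj z₂) (c : ℂ)
    (b : B.bundle.fiber (𝒵.pair h)) (x : W.line.fiber z₂ ⊗[ℂ] F.bundle.fiber z₂) :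
    W.action F h (b ⊗ₜ (c • x)) = c • W.action F h (b ⊗ₜ x) := by
  rw [TensorProduct.tmul_smul, map_smul]

/-- By linearity in the lines it is enough to treat two related quadruples with the same middle
vector q₂. These compose by `rel_mul`. -/
lemma action_assoc {z₁ z₂ z₃ : 𝒵.carrier} (h : 𝒵.proj z₁ = 𝒵.proj z₂)
    (h' : 𝒵.proj z₂ = 𝒵.proj z₃) (b : B.bundle.fiber (𝒵.pair h)) (b' : B.bundle.fiber (𝒵.pair h'))
    (x : W.line.fiber z₃ ⊗[ℂ] F.bundle.fiber z₃) :
    W.action F h (b ⊗ₜ W.action F h' (b' ⊗ₜ x)) =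
      W.action F (h.trans h') (B.mul h h' b b' ⊗ₜ x) := by
  obtain ⟨q₁, hq₁⟩ := exists_unit (W.rank_one z₁)
  obtain ⟨q₂, hq₂⟩ := exists_unit (W.rank_one z₂)
  obtain ⟨q₃, hq₃⟩ := exists_unit (W.rank_one z₃)
  obtain ⟨a, ha⟩ := exists_unit (A.rank_one (𝒵.pair h))
  obtain ⟨a', ha'⟩ := exists_unit (A.rank_one (𝒵.pair h'))
  obtain ⟨β, hβ⟩ := W.exists_rel h q₁ q₂ a hq₁ hq₂ ha
  obtain ⟨β', hβ'⟩ := W.exists_rel h' q₂ q₃ a' hq₂ hq₃ ha'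
  obtain ⟨e, rfl⟩ := (tmulUnit (W.rank_one z₃) q₃ hq₃).surjective x
  rw [tmulUnit_apply, line_eq_inner_smul (B.rank_one _) (W.rel_norm hβ).2.2.2 b,
    line_eq_inner_smul (B.rank_one _) (W.rel_norm hβ').2.2.2 b', action_smul, action_smul,
    action_smul', BundleGerbe.smul_mul, action_smul, BundleGerbe.mul_smul, action_smul,
    W.action_tmul F hβ', W.action_tmul F hβ, W.action_tmul F (W.rel_mul hβ hβ'),
    GerbeModule.mul_smul]

/-- The twisted module `Q ⊗ E`. -/
def module : GerbeModule B where
  bundle := W.line.tensor F.bundle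
  act := ⟨fun w => W.action F (z₁ := sqFst w) (z₂ := sqSnd w) w.2.2.2, W.action_smooth F⟩
  act_assoc _ _ _ h h' b b' x := W.action_assoc F h h' b b' x

end Twist

variable {L : BundleGerbe 𝒴} {J : BundleGerbe 𝒳}

/-- A `J`-module `F` is induced by an `L`-module `E` if its pull-back to `Y ×_M X` is `Q ⊗ E`. -/
def Twist.Ind (W : Twist (L.pullFst 𝒳) (J.pullSnd 𝒴)) (F : GerbeModule L) (G : GerbeModule J) :
    Prop :=
  ∃ θ : BundleIso (W.line.tensor (bundleFst F.bundle 𝒳)) (bundleSnd 𝒴 G.bundle),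
    ∀ (z₁ z₂ : (𝒴.prod 𝒳).carrier) (h : (𝒴.prod 𝒳).proj z₁ = (𝒴.prod 𝒳).proj z₂)
      (q₁ : W.line.fiber z₁) (q₂ : W.line.fiber z₂)
      (a : L.bundle.fiber (𝒴.pair (y₁ := fstPt z₁) (y₂ := fstPt z₂) h))
      (b : J.bundle.fiber (𝒳.pair (proj_sndPt h))), W.rel h q₁ q₂ a b →
      ∀ e : F.bundle.fiber (fstPt z₂), G.smul (proj_sndPt h) b (θ.equiv z₂ (q₂ ⊗ₜ e)) =
        θ.equiv z₁ (q₁ ⊗ₜ F.smul (y₁ := fstPt z₁) (y₂ := fstPt z₂) h a e)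

/-- The module is obtained by descending the twist of the pull-back of `F`. -/
lemma Twist.exists_ind (W : Twist (L.pullFst 𝒳) (J.pullSnd 𝒴)) (F : GerbeModule L) :
    ∃ G : GerbeModule J, W.Ind F G := by
  obtain ⟨G, θ, hθ⟩ := exists_descent (W.module (F.pullFst 𝒳))
  refine ⟨G, ⟨⟨θ.equiv, θ.smooth⟩, fun z₁ z₂ h q₁ q₂ a b hr e => ?_⟩⟩
  exact (hθ z₁ z₂ h b (q₂ ⊗ₜ e)).symm.trans
    (congrArg (θ.equiv z₁) (W.action_tmul (F.pullFst 𝒳) hr e))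

end Twists

/-! ### Independence of the induced module of all choices, up to isomorphism -/

section Functoriality

variable {EM HM : Type*} [NormedAddCommGroup EM] [NormedSpace ℝ EM] [TopologicalSpace HM]
  {IM : ModelWithCorners ℝ EM HM} {M : Type*} [TopologicalSpace M] [ChartedSpace HM M]
  {E H : Type*} [NormedAddCommGroup E] [NormedSpace ℝ E] [TopologicalSpace H]
  {I : ModelWithCorners ℝ E H} {N : Type*} [TopologicalSpace N] [ChartedSpace H N]
  {E' H' : Type*} [NormedAddCommGroup E'] [NormedSpace ℝ E'] [TopologicalSpace H']
  {I' : ModelWithCorners ℝ E' H'} {N' : Type*} [TopologicalSpace N'] [ChartedSpace H' N']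
  {E₂ H₂ N₂ : Type*} [NormedAddCommGroup E₂] [NormedSpace ℝ E₂] [TopologicalSpace H₂]
  {I₂ : ModelWithCorners ℝ E₂ H₂} [TopologicalSpace N₂] [ChartedSpace H₂ N₂]
  {𝒴 : SplitSpace IM M I N} {𝒳 : SplitSpace IM M I' N'} {T : Set N₂}

open SplitSpace

lemma IsSmoothFamily.lTensor {S : Set N} {Q A B : HermitianBundle I S}
    {f : ∀ s, A.fiber s →ₗ[ℂ] B.fiber s} (hf : IsSmoothFamily A B f) :
    IsSmoothFamily (Q.tensor A) (Q.tensor B) (fun s => (f s).lTensor (Q.fiber s)) :=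
  IsSmoothFamily.of_secAt fun s₀ => by
    have hQ := exists_frameAt Q (φ := fun s => s) (SmAt.val s₀)
    have hA := exists_frameAt A (φ := fun s => s) (SmAt.val s₀)
    exact ⟨_, inferInstance, _, hQ.tensor hA, fun k =>
      (hQ.1 k.1).tensor (hf.secAt (φ := fun s => s) (hA.1 k.2))⟩

lemma IsSmoothFamily.pullback {S : Set N} {S' : Set N'} {A B : HermitianBundle I S}
    {f : ∀ s, A.fiber s →ₗ[ℂ] B.fiber s} (hf : IsSmoothFamily A B f) (g : N' → N)
    (hg : ContMDiff I' I ∞ g) (hS : Set.MapsTo g S' S) :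
    IsSmoothFamily (A.pullback g hg hS) (B.pullback g hg hS) (fun s => f ⟨g s, hS s.2⟩) :=
  fun p q i j => (hf ⟨g p, hS p.2⟩ ⟨g q, hS q.2⟩ i j).comp hg hS

variable {L : BundleGerbe 𝒴} {J : BundleGerbe 𝒳}

section

variable {Q : HermitianBundle (I.prod I') (𝒴.prod 𝒳).carrier} {A A' : HermitianBundle I 𝒴.carrier}
  {B B' : HermitianBundle I' 𝒳.carrier}
  (θ : BundleIso (Q.tensor (bundleFst A 𝒳)) (bundleSnd 𝒴 B))
  (θ' : BundleIso (Q.tensor (bundleFst A' 𝒳)) (bundleSnd 𝒴 B'))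

/-- The map `B_x → B'_x` corresponding to `A_y → A'_y`. -/
def transport (ψ : ∀ y, A.fiber y ≃ₗ[ℂ] A'.fiber y) (z : (𝒴.prod 𝒳).carrier) :
    B.fiber (sndPt z) ≃ₗ[ℂ] B'.fiber (sndPt z) :=
  ((θ.equiv z).toLinearEquiv.symm.trans
    (LinearEquiv.lTensor (Q.fiber z) (ψ (fstPt z)))).trans (θ'.equiv z).toLinearEquiv

lemma transport_apply (ψ : ∀ y, A.fiber y ≃ₗ[ℂ] A'.fiber y) (z : (𝒴.prod 𝒳).carrier)
    (q : Q.fiber z) (e : A.fiber (fstPt z)) :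
    transport θ θ' ψ z (θ.equiv z (q ⊗ₜ e)) = θ'.equiv z (q ⊗ₜ ψ (fstPt z) e) := by
  have h : (θ.equiv z).symm (θ.equiv z (q ⊗ₜ e)) = q ⊗ₜ e :=
    (θ.equiv z).symm_apply_apply _
  exact congrArg (fun x => θ'.equiv z (LinearEquiv.lTensor (Q.fiber z) (ψ (fstPt z)) x)) h

lemma transport_secAt {ψ : ∀ y, A.fiber y ≃ₗ[ℂ] A'.fiber y}
    (hψ : IsSmoothFamily A A' (fun y => (ψ y).toLinearMap)) {φ : T → (𝒴.prod 𝒳).carrier} {t₀ : T}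
    (hφ : SmAt I₂ (I.prod I') (fun t => (φ t : N × N')) t₀) {σ : ∀ t, B.fiber (sndPt (φ t))}
    (hσ : SecAt I₂ B (fun t => sndPt (φ t)) σ t₀) :
    SecAt I₂ B' (fun t => sndPt (φ t)) (fun t => transport θ θ' ψ (φ t) (σ t)) t₀ := by
  have h₁ : SecAt I₂ (bundleSnd 𝒴 B) φ σ t₀ := SecAt.pullback (f := Prod.snd) hφ hσ
  have h₂ := (IsSmoothFamily.lTensor (Q := Q) (hψ.pullback (S' := (𝒴.prod 𝒳).carrier) Prod.fst
    contMDiff_fst (fun _ h => h.1))).secAt (θ.symm.secAt h₁)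
  exact (θ'.secAt h₂).of_pullback

end

lemma GerbeModule.map_smul_of_unit {G G' : GerbeModule J} {x₁ x₂ : 𝒳.carrier}
    {h : 𝒳.proj x₁ = 𝒳.proj x₂} (f₁ : G.bundle.fiber x₁ →ₗ[ℂ] G'.bundle.fiber x₁)
    (f₂ : G.bundle.fiber x₂ →ₗ[ℂ] G'.bundle.fiber x₂) {b : J.bundle.fiber (𝒳.pair h)}
    (hb : ‖b‖ = 1) {g : G.bundle.fiber x₂} (e : f₁ (G.smul h b g) = G'.smul h b (f₂ g))
    (j : J.bundle.fiber (𝒳.pair h)) : f₁ (G.smul h j g) = G'.smul h j (f₂ g) := by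
  rw [line_eq_inner_smul (J.rank_one _) hb j, smul_smul_left, smul_smul_left, map_smul, e]

/-- Both actions of J are determined by the same relation and by the actions of L, which ψ respects.
One related quadruple is enough, because the J-fibre and the line of the twist are spanned by single
unit vectors. -/
lemma Twist.transport_smul {W : Twist (L.pullFst 𝒳) (J.pullSnd 𝒴)} {F F' : GerbeModule L}
    {G G' : GerbeModule J}
    {θ : BundleIso (W.line.tensor (bundleFst F.bundle 𝒳)) (bundleSnd 𝒴 G.bundle)}
    {θ' : BundleIso (W.line.tensor (bundleFst F'.bundle 𝒳)) (bundleSnd 𝒴 G'.bundle)}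
    (hθ : ∀ (z₁ z₂ : (𝒴.prod 𝒳).carrier) (h : (𝒴.prod 𝒳).proj z₁ = (𝒴.prod 𝒳).proj z₂)
      (q₁ : W.line.fiber z₁) (q₂ : W.line.fiber z₂)
      (a : L.bundle.fiber (𝒴.pair (y₁ := fstPt z₁) (y₂ := fstPt z₂) h))
      (b : J.bundle.fiber (𝒳.pair (proj_sndPt h))), W.rel h q₁ q₂ a b →
      ∀ e : F.bundle.fiber (fstPt z₂), G.smul (proj_sndPt h) b (θ.equiv z₂ (q₂ ⊗ₜ e)) =
        θ.equiv z₁ (q₁ ⊗ₜ F.smul (y₁ := fstPt z₁) (y₂ := fstPt z₂) h a e))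
    (hθ' : ∀ (z₁ z₂ : (𝒴.prod 𝒳).carrier) (h : (𝒴.prod 𝒳).proj z₁ = (𝒴.prod 𝒳).proj z₂)
      (q₁ : W.line.fiber z₁) (q₂ : W.line.fiber z₂)
      (a : L.bundle.fiber (𝒴.pair (y₁ := fstPt z₁) (y₂ := fstPt z₂) h))
      (b : J.bundle.fiber (𝒳.pair (proj_sndPt h))), W.rel h q₁ q₂ a b →
      ∀ e : F'.bundle.fiber (fstPt z₂), G'.smul (proj_sndPt h) b (θ'.equiv z₂ (q₂ ⊗ₜ e)) =
        θ'.equiv z₁ (q₁ ⊗ₜ F'.smul (y₁ := fstPt z₁) (y₂ := fstPt z₂) h a e))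
    {ψ : ∀ y, F.bundle.fiber y ≃ₗ[ℂ] F'.bundle.fiber y}
    (hψ : ∀ (y₁ y₂ : 𝒴.carrier) (h : 𝒴.proj y₁ = 𝒴.proj y₂) (a : L.bundle.fiber (𝒴.pair h))
      (e : F.bundle.fiber y₂), ψ y₁ (F.actAt h (a ⊗ₜ e)) = F'.actAt h (a ⊗ₜ ψ y₂ e))
    {z₁ z₂ : (𝒴.prod 𝒳).carrier} (h : (𝒴.prod 𝒳).proj z₁ = (𝒴.prod 𝒳).proj z₂)
    (j : J.bundle.fiber (𝒳.pair (proj_sndPt h))) (g : G.bundle.fiber (sndPt z₂)) :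
    transport θ θ' ψ z₁ (G.smul (proj_sndPt h) j g) =
      G'.smul (proj_sndPt h) j (transport θ θ' ψ z₂ g) := by
  obtain ⟨q₁, hq₁⟩ := exists_unit (W.rank_one z₁)
  obtain ⟨q₂, hq₂⟩ := exists_unit (W.rank_one z₂)
  obtain ⟨a, ha⟩ := exists_unit ((L.pullFst 𝒳).rank_one ((𝒴.prod 𝒳).pair h))
  obtain ⟨b, hb⟩ := W.exists_rel h q₁ q₂ a hq₁ hq₂ ha
  obtain ⟨x, rfl⟩ := (θ.equiv z₂).surjective g
  obtain ⟨e, rfl⟩ := (tmulUnit (W.rank_one z₂) q₂ hq₂).surjective x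
  have e₁ := hθ z₁ z₂ h q₁ q₂ a b hb e
  have e₂ := hθ' z₁ z₂ h q₁ q₂ a b hb (ψ (fstPt z₂) e)
  have e₃ := hψ (fstPt z₁) (fstPt z₂) h a e
  have e₄ : transport θ θ' ψ z₁ (G.smul (proj_sndPt h) b (θ.equiv z₂ (q₂ ⊗ₜ e))) =
      G'.smul (proj_sndPt h) b (transport θ θ' ψ z₂ (θ.equiv z₂ (q₂ ⊗ₜ e))) := by
    refine (congrArg (transport θ θ' ψ z₁) e₁).trans ((transport_apply θ θ' ψ z₁ q₁ _).trans ?_)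
    refine Eq.trans ?_ (congrArg (G'.smul (proj_sndPt h) b) (transport_apply θ θ' ψ z₂ q₂ e)).symm
    exact (congrArg (fun v => θ'.equiv z₁ (q₁ ⊗ₜ v)) e₃).trans e₂.symm
  exact GerbeModule.map_smul_of_unit (transport θ θ' ψ z₁).toLinearMap
    (transport θ θ' ψ z₂).toLinearMap (W.rel_norm hb).2.2.2 e₄ j

/-- Isomorphic modules induce isomorphic modules. -/
theorem Twist.Ind.isomorphic {W : Twist (L.pullFst 𝒳) (J.pullSnd 𝒴)} {F F' : GerbeModule L}
    {G G' : GerbeModule J} (h : W.Ind F G) (h' : W.Ind F' G') (hF : F.Isomorphic F') :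
    G.Isomorphic G' := by
  obtain ⟨θ, hθ⟩ := h
  obtain ⟨θ', hθ'⟩ := h'
  obtain ⟨ψ, hψ₁, hψ₂, hψ⟩ := hF
  obtain ⟨nb, l, hnb, hmem, hl, hs⟩ := exists_lifts 𝒴 𝒳
  -- The transported map commutes with the action of the unit of J between the two points over x.
  -- That unit acts as the identity on both modules, so the two transports agree.
  have key : ∀ (x : 𝒳.carrier) (y₁ y₂ : 𝒴.carrier) (h₁ : 𝒴.proj y₁ = 𝒳.proj x)
      (h₂ : 𝒴.proj y₂ = 𝒳.proj x),
      transport θ θ' ψ (mkPt h₁) = transport θ θ' ψ (mkPt h₂) := by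
    intro x y₁ y₂ h₁ h₂
    ext g
    have := Twist.transport_smul hθ hθ' hψ (z₁ := mkPt h₁) (z₂ := mkPt h₂) (h₁.trans h₂.symm)
      (J.one x) g
    exact (congrArg _ (GerbeModule.one_smul (y := x) g)).symm.trans
      (this.trans (GerbeModule.one_smul (y := x) (transport θ θ' ψ (mkPt h₂) g)))
  have smooth : ∀ {A A' : HermitianBundle I' 𝒳.carrier}
      (f : ∀ x : 𝒳.carrier, A.fiber x →ₗ[ℂ] A'.fiber x)
      (_ : ∀ (x₀ : 𝒳.carrier) (σ : ∀ x, A.fiber x), SecAt I' A (fun x => x) σ x₀ →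
        SecAt I' A' (fun x => x) (fun x => f x (σ x)) x₀), IsSmoothFamily A A' f :=
    fun f hf => IsSmoothFamily.of_secAt fun x₀ => ⟨_, inferInstance, _,
      exists_frameAt _ (φ := fun x => x) (SmAt.val x₀), fun k =>
        hf x₀ _ ((exists_frameAt _ (φ := fun x => x) (SmAt.val x₀)).1 k)⟩
  -- The diagonal lift defines the map; by `key` it may be replaced near `x₀` by the smooth lift `l
  -- x₀`.
  refine ⟨fun x => transport θ θ' ψ (mkPt (hl x x)), smooth _ fun x₀ σ hσ => ?_,
    smooth _ fun x₀ σ hσ => ?_, fun x₁ x₂ h a e => ?_⟩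
  · refine (transport_secAt θ θ' hψ₁ (φ := fun x => mkPt (hl x₀ x))
      ((hs x₀ x₀ (hmem _)).prodMk (SmAt.val x₀)) hσ).congr
      (Filter.Eventually.of_forall fun x => ?_)
    exact LinearEquiv.congr_fun (key x (l x x) (l x₀ x) (hl _ _) (hl _ _)) (σ x)
  -- The inverse is the transport of the inverse of ψ, with θ and θ' exchanged.
  · refine (transport_secAt θ' θ (ψ := fun y => (ψ y).symm) hψ₂ (φ := fun x => mkPt (hl x₀ x))
      ((hs x₀ x₀ (hmem _)).prodMk (SmAt.val x₀)) hσ).congr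
      (Filter.Eventually.of_forall fun x => ?_)
    exact LinearEquiv.congr_fun (congrArg LinearEquiv.symm
      (key x (l x x) (l x₀ x) (hl _ _) (hl _ _))) (σ x)
  · exact Twist.transport_smul hθ hθ' hψ (z₁ := mkPt (hl x₁ x₁)) (z₂ := mkPt (hl x₂ x₂))
      ((hl _ _).trans (h.trans (hl _ _).symm)) a e

end Functoriality

/-! ### The correspondence defined by a stable isomorphism -/

section StableIsomorphism

variable {EM HM : Type*} [NormedAddCommGroup EM] [NormedSpace ℝ EM] [TopologicalSpace HM]
  {IM : ModelWithCorners ℝ EM HM} {M : Type*} [TopologicalSpace M] [ChartedSpace HM M]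
  {E H : Type*} [NormedAddCommGroup E] [NormedSpace ℝ E] [TopologicalSpace H]
  {I : ModelWithCorners ℝ E H} {N : Type*} [TopologicalSpace N] [ChartedSpace H N]
  {E' H' : Type*} [NormedAddCommGroup E'] [NormedSpace ℝ E'] [TopologicalSpace H']
  {I' : ModelWithCorners ℝ E' H'} {N' : Type*} [TopologicalSpace N'] [ChartedSpace H' N']
  {E₂ H₂ N₂ : Type*} [NormedAddCommGroup E₂] [NormedSpace ℝ E₂] [TopologicalSpace H₂]
  {I₂ : ModelWithCorners ℝ E₂ H₂} [TopologicalSpace N₂] [ChartedSpace H₂ N₂]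
  {𝒴 : SplitSpace IM M I N} {𝒳 : SplitSpace IM M I' N'} {T : Set N₂}

open SplitSpace

/-- Contraction with v is adjoint to w ↦ v* ⊗ w. This turns the coordinates of a contraction into
inner products of smooth sections. -/
lemma inner_evalAt {V W : Type*} [NormedAddCommGroup V] [InnerProductSpace ℂ V]
    [FiniteDimensional ℂ V] [NormedAddCommGroup W] [InnerProductSpace ℂ W] (v : V) (w : W)
    (τ : HDual V ⊗[ℂ] W) : ⟪w, evalAt v τ⟫_ℂ = ⟪HDual.riesz V v ⊗ₜ[ℂ] w, τ⟫_ℂ := by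
  induction τ with
  | zero => simp
  | add x y hx hy => rw [map_add, inner_add_right, inner_add_right, hx, hy]
  | tmul φ u =>
    obtain ⟨v', rfl⟩ := (HDual.riesz V).surjective φ
    rw [evalAt_tmul, inner_smul_right, TensorProduct.inner_tmul, HDual.inner_riesz,
      HDual.ev_riesz]

lemma norm_riesz {V : Type*} [NormedAddCommGroup V] [InnerProductSpace ℂ V]
    [FiniteDimensional ℂ V] {v : V} (hv : ‖v‖ = 1) : ‖HDual.riesz V v‖ = 1 :=
  ((HDual.riesz V).norm_map v).trans hv

lemma exists_unit_sec {S : Set N} {A : HermitianBundle I S}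
    (hA : ∀ s, Module.finrank ℂ (A.fiber s) = 1) {φ : T → S} {t₀ : T}
    (hφ : SmAt I₂ I (fun t => (φ t : N)) t₀) :
    ∃ σ : ∀ t, A.fiber (φ t), SecAt I₂ A φ σ t₀ ∧ ∀ᶠ t in nhds t₀, ‖σ t‖ = 1 := by
  have hF := exists_frameAt A hφ
  have hne : Nonempty (A.ι (φ t₀)) := by
    rw [← Fintype.card_pos_iff, ← Module.finrank_eq_card_basis
      (A.frame (φ t₀) (φ t₀) (A.mem_dom _)).toBasis, hA]
    exact one_pos
  refine ⟨_, hF.1 hne.some, hF.2.mono fun t ⟨b, hb⟩ => ?_⟩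
  rw [← hb]
  exact b.orthonormal.1 _

lemma dual_prod_mul {z₁ z₂ z₃ : (𝒴.prod 𝒳).carrier} {L : BundleGerbe 𝒴} {J : BundleGerbe 𝒳}
    (h : (𝒴.prod 𝒳).proj z₁ = (𝒴.prod 𝒳).proj z₂) (h' : (𝒴.prod 𝒳).proj z₂ = (𝒴.prod 𝒳).proj z₃)
    (l : L.bundle.fiber (𝒴.pair (y₁ := fstPt z₁) (y₂ := fstPt z₂) h))
    (l' : L.bundle.fiber (𝒴.pair (y₁ := fstPt z₂) (y₂ := fstPt z₃) h'))
    (j : J.bundle.fiber (𝒳.pair (proj_sndPt h))) (j' : J.bundle.fiber (𝒳.pair (proj_sndPt h'))) :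
    (L.dual.prod J).mul h h' (HDual.riesz (L.bundle.fiber (𝒴.pair
      (y₁ := fstPt z₁) (y₂ := fstPt z₂) h)) l ⊗ₜ[ℂ] j) (HDual.riesz (L.bundle.fiber (𝒴.pair
      (y₁ := fstPt z₂) (y₂ := fstPt z₃) h')) l' ⊗ₜ[ℂ] j') =
      HDual.riesz _ (L.mul (y₁ := fstPt z₁) (y₂ := fstPt z₂) (y₃ := fstPt z₃) h h' l l') ⊗ₜ[ℂ]
        (J.mul (proj_sndPt h) (proj_sndPt h') j j') := by
  refine (interchange_tmul _ _ _ _ _ _).trans ?_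
  exact congrArg (fun v => v ⊗ₜ[ℂ] J.mul (proj_sndPt h) (proj_sndPt h') j j')
    (GerbeProduct.dual_app L.product (y₁ := fstPt z₁) (y₂ := fstPt z₂) (y₃ := fstPt z₃) h h' l l')

namespace StableIso

variable {L : BundleGerbe 𝒴} {J : BundleGerbe 𝒳} (T : StableIso L J)

/-- The isomorphism `K_{z₂} ⊗ K_{z₁}* ≅ L* ⊗ J`. -/
def app {z₁ z₂ : (𝒴.prod 𝒳).carrier} (h : (𝒴.prod 𝒳).proj z₁ = (𝒴.prod 𝒳).proj z₂) :
    T.line.fiber z₂ ⊗[ℂ] HDual (T.line.fiber z₁) ≃ₗᵢ[ℂ]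
      HDual (L.bundle.fiber (𝒴.pair (y₁ := fstPt z₁) (y₂ := fstPt z₂) h)) ⊗[ℂ]
        J.bundle.fiber (𝒳.pair (proj_sndPt h)) :=
  T.iso.iso.equiv ((𝒴.prod 𝒳).pair h)

/-- Unit vectors `κ₁`, `κ₂`, `l`, `j` with `t(κ₂ ⊗ κ₁*) = l* ⊗ j`. -/
def Corr {z₁ z₂ : (𝒴.prod 𝒳).carrier} (h : (𝒴.prod 𝒳).proj z₁ = (𝒴.prod 𝒳).proj z₂)
    (κ₁ : T.line.fiber z₁) (κ₂ : T.line.fiber z₂)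
    (l : L.bundle.fiber (𝒴.pair (y₁ := fstPt z₁) (y₂ := fstPt z₂) h))
    (j : J.bundle.fiber (𝒳.pair (proj_sndPt h))) : Prop :=
  (‖κ₁‖ = 1 ∧ ‖κ₂‖ = 1 ∧ ‖l‖ = 1 ∧ ‖j‖ = 1) ∧
    T.app h (κ₂ ⊗ₜ[ℂ] HDual.riesz _ κ₁) = HDual.riesz _ l ⊗ₜ[ℂ] j

variable {T} {z₁ z₂ z₃ : (𝒴.prod 𝒳).carrier}
  {h : (𝒴.prod 𝒳).proj z₁ = (𝒴.prod 𝒳).proj z₂} {h' : (𝒴.prod 𝒳).proj z₂ = (𝒴.prod 𝒳).proj z₃}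

/-- As l* spans its line, t(κ₂ ⊗ κ₁*) has the form l* ⊗ j. Here j is a unit vector because t is
isometric, and contraction with the unit vector l recovers it. -/
lemma corr_evalAt {κ₁ : T.line.fiber z₁} {κ₂ : T.line.fiber z₂} (h₁ : ‖κ₁‖ = 1) (h₂ : ‖κ₂‖ = 1)
    {l : L.bundle.fiber (𝒴.pair (y₁ := fstPt z₁) (y₂ := fstPt z₂) h)} (hl : ‖l‖ = 1) :
    T.Corr h κ₁ κ₂ l (evalAt l (T.app h (κ₂ ⊗ₜ[ℂ] HDual.riesz _ κ₁))) := by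
  obtain ⟨j, hj⟩ := (tmulUnit (finrank_dual.trans (L.rank_one _)) (HDual.riesz _ l)
    (norm_riesz hl)).surjective (T.app h (κ₂ ⊗ₜ[ℂ] HDual.riesz _ κ₁))
  rw [tmulUnit_apply] at hj
  have hn : ‖HDual.riesz _ l ⊗ₜ[ℂ] j‖ = 1 := by
    rw [hj, LinearIsometryEquiv.norm_map]
    exact norm_tmul_unit h₂ (norm_riesz h₁)
  rw [TensorProduct.norm_tmul, norm_riesz hl, one_mul] at hn
  rw [← hj, evalAt_tmul, HDual.ev_riesz, inner_self_of_unit hl, one_smul]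
  exact ⟨⟨h₁, h₂, hl, hn⟩, hj.symm⟩

lemma Corr.evalAt_eq {κ₁ : T.line.fiber z₁} {κ₂ : T.line.fiber z₂}
    {l : L.bundle.fiber (𝒴.pair (y₁ := fstPt z₁) (y₂ := fstPt z₂) h)}
    {j : J.bundle.fiber (𝒳.pair (proj_sndPt h))} (hc : T.Corr h κ₁ κ₂ l j) :
    evalAt l (T.app h (κ₂ ⊗ₜ[ℂ] HDual.riesz _ κ₁)) = j := by
  rw [hc.2, evalAt_tmul, HDual.ev_riesz, inner_self_of_unit hc.1.2.2.1, one_smul]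

/-- Completion in the opposite direction, needed for the inverse twist: an arbitrary unit l gives
some j₀, which differs from j by a phase that l can absorb. -/
lemma exists_corr_right {κ₁ : T.line.fiber z₁} {κ₂ : T.line.fiber z₂} (h₁ : ‖κ₁‖ = 1)
    (h₂ : ‖κ₂‖ = 1) {j : J.bundle.fiber (𝒳.pair (proj_sndPt h))} (hj : ‖j‖ = 1) :
    ∃ l, T.Corr h κ₁ κ₂ l j := by
  obtain ⟨l, hl⟩ := exists_unit (L.rank_one (𝒴.pair (y₁ := fstPt z₁) (y₂ := fstPt z₂) h))
  obtain ⟨hn, hc⟩ := T.corr_evalAt (h := h) h₁ h₂ hl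
  set j₀ := evalAt l (T.app h (κ₂ ⊗ₜ[ℂ] HDual.riesz _ κ₁))
  have hj₀ : j₀ = ⟪j, j₀⟫_ℂ • j := line_eq_inner_smul (J.rank_one _) hj j₀
  have hc' : ‖⟪j, j₀⟫_ℂ‖ = 1 := by
    have := hn.2.2.2
    rwa [hj₀, norm_smul, hj, mul_one] at this
  -- The phase is conjugated because l enters through l*, which depends on l conjugate-linearly.
  refine ⟨(starRingEnd ℂ) ⟪j, j₀⟫_ℂ • l, ⟨⟨h₁, h₂, ?_, hj⟩, ?_⟩⟩
  · rw [norm_smul, RCLike.norm_conj, hc', hl, mul_one]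
  · rw [hc, map_smulₛₗ, Complex.conj_conj, TensorProduct.smul_tmul, ← hj₀]

/-- Unitarity of t, applied to two corresponding quadruples; passing to duals reverses the inner
products of κ₁ and l. -/
lemma Corr.scale {κ₁ κ₁' : T.line.fiber z₁} {κ₂ κ₂' : T.line.fiber z₂}
    {l l' : L.bundle.fiber (𝒴.pair (y₁ := fstPt z₁) (y₂ := fstPt z₂) h)}
    {j j' : J.bundle.fiber (𝒳.pair (proj_sndPt h))} (hc : T.Corr h κ₁ κ₂ l j)
    (hc' : T.Corr h κ₁' κ₂' l' j') : ⟪κ₂, κ₂'⟫_ℂ * ⟪κ₁', κ₁⟫_ℂ = ⟪l', l⟫_ℂ * ⟪j, j'⟫_ℂ := by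
  rw [← HDual.inner_riesz l l', ← HDual.inner_riesz κ₁ κ₁', ← TensorProduct.inner_tmul,
    ← TensorProduct.inner_tmul, ← hc.2, ← hc'.2, LinearIsometryEquiv.inner_map_map]

lemma inner_mul_inner_unit {V : Type*} [NormedAddCommGroup V] [InnerProductSpace ℂ V]
    (hV : Module.finrank ℂ V = 1) {v w : V} (hv : ‖v‖ = 1) (hw : ‖w‖ = 1) :
    ⟪v, w⟫_ℂ * ⟪w, v⟫_ℂ = 1 := by
  rw [line_inner_mul_inner hV hw, inner_self_of_unit hv]

/-- `Corr.scale` in the form required of the twist by K. Inner products of unit vectors in a line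
are phases, so reversing one inverts it. -/
lemma Corr.scale' {κ₁ κ₁' : T.line.fiber z₁} {κ₂ κ₂' : T.line.fiber z₂}
    {l l' : L.bundle.fiber (𝒴.pair (y₁ := fstPt z₁) (y₂ := fstPt z₂) h)}
    {j j' : J.bundle.fiber (𝒳.pair (proj_sndPt h))} (hc : T.Corr h κ₁ κ₂ l j)
    (hc' : T.Corr h κ₁' κ₂' l' j') : ⟪l, l'⟫_ℂ * ⟪κ₂, κ₂'⟫_ℂ = ⟪κ₁, κ₁'⟫_ℂ * ⟪j, j'⟫_ℂ := by
  have e₁ := hc.scale hc'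
  have e₂ := inner_mul_inner_unit (L.rank_one _) hc.1.2.2.1 hc'.1.2.2.1
  have e₃ := inner_mul_inner_unit (T.rank_one _) hc.1.1 hc'.1.1
  linear_combination ⟪κ₁, κ₁'⟫_ℂ * ⟪l, l'⟫_ℂ * e₁ - ⟪l, l'⟫_ℂ * ⟪κ₂, κ₂'⟫_ℂ * e₃ +
    ⟪κ₁, κ₁'⟫_ℂ * ⟪j, j'⟫_ℂ * e₂

/-- The form required of the twist by K*, where the inner products of the κ are reversed. -/
lemma Corr.scale'' {κ₁ κ₁' : T.line.fiber z₁} {κ₂ κ₂' : T.line.fiber z₂}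
    {l l' : L.bundle.fiber (𝒴.pair (y₁ := fstPt z₁) (y₂ := fstPt z₂) h)}
    {j j' : J.bundle.fiber (𝒳.pair (proj_sndPt h))} (hc : T.Corr h κ₁ κ₂ l j)
    (hc' : T.Corr h κ₁' κ₂' l' j') : ⟪j, j'⟫_ℂ * ⟪κ₂', κ₂⟫_ℂ = ⟪κ₁', κ₁⟫_ℂ * ⟪l, l'⟫_ℂ := by
  have e₁ := hc.scale hc'
  have e₂ := inner_mul_inner_unit (L.rank_one _) hc.1.2.2.1 hc'.1.2.2.1
  have e₃ := inner_mul_inner_unit (T.rank_one _) hc.1.2.1 hc'.1.2.1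
  linear_combination -⟪κ₂', κ₂⟫_ℂ * ⟪l, l'⟫_ℂ * e₁ - ⟪j, j'⟫_ℂ * ⟪κ₂', κ₂⟫_ℂ * e₂ +
    ⟪κ₁', κ₁⟫_ℂ * ⟪l, l'⟫_ℂ * e₃

/-- In δ(K) the product of κ₂ ⊗ κ₁* and κ₃ ⊗ κ₂* is κ₃ ⊗ κ₁*, since κ₂*(κ₂) = 1. It remains to use
that t preserves products. -/
lemma Corr.mul {κ₁ : T.line.fiber z₁} {κ₂ : T.line.fiber z₂} {κ₃ : T.line.fiber z₃}
    {l : L.bundle.fiber (𝒴.pair (y₁ := fstPt z₁) (y₂ := fstPt z₂) h)}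
    {j : J.bundle.fiber (𝒳.pair (proj_sndPt h))}
    {l' : L.bundle.fiber (𝒴.pair (y₁ := fstPt z₂) (y₂ := fstPt z₃) h')}
    {j' : J.bundle.fiber (𝒳.pair (proj_sndPt h'))} (hc : T.Corr h κ₁ κ₂ l j)
    (hc' : T.Corr h' κ₂ κ₃ l' j') :
    T.Corr (h.trans h') κ₁ κ₃
      (L.mul (y₁ := fstPt z₁) (y₂ := fstPt z₂) (y₃ := fstPt z₃) h h' l l')
      (J.mul (proj_sndPt h) (proj_sndPt h') j j') := by
  refine ⟨⟨hc.1.1, hc'.1.2.1, BundleGerbe.norm_mul_unit hc.1.2.2.1 hc'.1.2.2.1,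
    BundleGerbe.norm_mul_unit hc.1.2.2.2 hc'.1.2.2.2⟩, ?_⟩
  have e := T.iso.map_product z₁ z₂ z₃ h h' (κ₂ ⊗ₜ[ℂ] HDual.riesz _ κ₁)
    (κ₃ ⊗ₜ[ℂ] HDual.riesz _ κ₂)
  have e₁ : (BundleGerbe.delta T.line T.rank_one).product.app h h'
      ((κ₂ ⊗ₜ[ℂ] HDual.riesz (T.line.fiber z₁) κ₁) ⊗ₜ[ℂ]
        (κ₃ ⊗ₜ[ℂ] HDual.riesz (T.line.fiber z₂) κ₂)) = κ₃ ⊗ₜ[ℂ] HDual.riesz (T.line.fiber z₁) κ₁ := by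
    refine (contract_tmul (T.rank_one z₂) κ₂ (HDual.riesz _ κ₁) κ₃ (HDual.riesz _ κ₂)).trans ?_
    rw [HDual.ev_riesz, inner_self_of_unit hc.1.2.1, one_smul]
  have e₂ := dual_prod_mul (L := L) (J := J) h h' l l' j j'
  have e₃ : T.app (h.trans h') (κ₃ ⊗ₜ[ℂ] HDual.riesz _ κ₁) = _ :=
    (congrArg (T.app (h.trans h')) e₁).symm.trans e
  refine e₃.trans (Eq.trans ?_ e₂)
  exact congrArg₂ (fun v w => (L.dual.prod J).product.app h h' (v ⊗ₜ[ℂ] w)) hc.2 hc'.2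

/-- Smooth local unit sections κ₁, κ₂, l exist in any line bundle, and the corresponding j is a
contraction, hence smooth by `inner_evalAt`. -/
lemma exists_local_corr (T : StableIso L J) (w₀ : (𝒴.prod 𝒳).sq) :
    ∃ (κ₁ : ∀ w : (𝒴.prod 𝒳).sq, T.line.fiber (sqFst w))
      (κ₂ : ∀ w : (𝒴.prod 𝒳).sq, T.line.fiber (sqSnd w))
      (l : ∀ w : (𝒴.prod 𝒳).sq, (L.pullFst 𝒳).bundle.fiber w)
      (j : ∀ w : (𝒴.prod 𝒳).sq, (J.pullSnd 𝒴).bundle.fiber w),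
      SecAt ((I.prod I').prod (I.prod I')) T.line sqFst κ₁ w₀ ∧
      SecAt ((I.prod I').prod (I.prod I')) T.line sqSnd κ₂ w₀ ∧
      SecAt ((I.prod I').prod (I.prod I')) (L.pullFst 𝒳).bundle (fun w => w) l w₀ ∧
      SecAt ((I.prod I').prod (I.prod I')) (J.pullSnd 𝒴).bundle (fun w => w) j w₀ ∧
      ∀ᶠ w : (𝒴.prod 𝒳).sq in nhds w₀, T.Corr (z₁ := sqFst w) (z₂ := sqSnd w) w.2.2.2
        (κ₁ w) (κ₂ w) (l w) (j w) := by
  have hv := SmAt.val (I' := (I.prod I').prod (I.prod I')) w₀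
  obtain ⟨κ₁, hκ₁, hn₁⟩ := exists_unit_sec (T := (𝒴.prod 𝒳).sq) (t₀ := w₀) (φ := sqFst)
    T.rank_one hv.fst
  obtain ⟨κ₂, hκ₂, hn₂⟩ := exists_unit_sec (T := (𝒴.prod 𝒳).sq) (t₀ := w₀) (φ := sqSnd)
    T.rank_one hv.snd
  obtain ⟨l, hl, hn₃⟩ := exists_unit_sec (T := (𝒴.prod 𝒳).sq) (t₀ := w₀) (φ := fun w => w)
    (L.pullFst 𝒳).rank_one hv
  refine ⟨κ₁, κ₂, l, fun w => evalAt (V := L.bundle.fiber (𝒴.pair (y₁ := fstPt (sqFst w))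
    (y₂ := fstPt (sqSnd w)) w.2.2.2)) (l w) (T.app (z₁ := sqFst w) (z₂ := sqSnd w) w.2.2.2
      (κ₂ w ⊗ₜ[ℂ] HDual.riesz _ (κ₁ w))), hκ₁, hκ₂, hl, ?_, ?_⟩
  · have hF := exists_frameAt (J.pullSnd 𝒴).bundle (φ := fun w => w) hv
    refine SecAt.of_frame (I' := (I.prod I').prod (I.prod I')) (I := (I.prod I').prod (I.prod I'))
      (A := (J.pullSnd 𝒴).bundle) (φ := fun w => w) hv hF fun k => ?_
    have h₁ : SecAt ((I.prod I').prod (I.prod I')) (BundleGerbe.delta T.line T.rank_one).bundle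
        (fun w => w) (fun w => κ₂ w ⊗ₜ[ℂ] HDual.riesz _ (κ₁ w)) w₀ :=
      (SecAt.pullback (I' := (I.prod I').prod (I.prod I')) (I := (I.prod I').prod (I.prod I'))
        (φ := fun w : (𝒴.prod 𝒳).sq => w) (f := Prod.snd) (A := T.line) (hf := contMDiff_snd)
        (hS := fun _ h => h.2.1) hv hκ₂).tensor
        (SecAt.pullback (I' := (I.prod I').prod (I.prod I')) (I := (I.prod I').prod (I.prod I'))
          (φ := fun w : (𝒴.prod 𝒳).sq => w) (f := Prod.fst) (A := T.line)
          (hf := contMDiff_fst) (hS := fun _ h => h.1) hv hκ₁).riesz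
    have h₂ : SecAt ((I.prod I').prod (I.prod I')) (L.dual.prod J).bundle (fun w => w)
        (fun w => HDual.riesz ((L.pullFst 𝒳).bundle.fiber w) (l w) ⊗ₜ[ℂ]
          frameSec (J.pullSnd 𝒴).bundle w₀ k w) w₀ :=
      SecAt.tensor (A := (L.pullFst 𝒳).bundle.dual) (B := (J.pullSnd 𝒴).bundle) hl.riesz (hF.1 k)
    refine (h₂.inner (T.iso.iso.secAt h₁)).congr (Filter.Eventually.of_forall fun w => ?_)
    exact inner_evalAt (V := L.bundle.fiber (𝒴.pair (y₁ := fstPt (sqFst w))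
      (y₂ := fstPt (sqSnd w)) w.2.2.2)) (l w) _ _
  · filter_upwards [hn₁, hn₂, hn₃] with w h₁ h₂ h₃
    exact T.corr_evalAt (z₁ := sqFst w) (z₂ := sqSnd w) h₁ h₂ h₃

end StableIso

end StableIsomorphism

/-! ### The twists defined by a stable isomorphism -/

section Flip

variable {E H N : Type*} [NormedAddCommGroup E] [NormedSpace ℝ E] [TopologicalSpace H]
  {I : ModelWithCorners ℝ E H} [TopologicalSpace N] [ChartedSpace H N] {S : Set N}

lemma tmulUnit_symm_apply {V W : Type*} [NormedAddCommGroup V] [InnerProductSpace ℂ V]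
    [FiniteDimensional ℂ V] [NormedAddCommGroup W] [InnerProductSpace ℂ W]
    [FiniteDimensional ℂ W] (h : Module.finrank ℂ V = 1) (u : V) (hu : ‖u‖ = 1) (w : W) :
    (tmulUnit h u hu).symm (u ⊗ₜ[ℂ] w) = w := by
  rw [tmulUnit_symm_tmul, inner_self_of_unit hu, one_smul]

/-- An isomorphism `V ⊗ A ≅ B` for a line bundle `V` gives `V' ⊗ B ≅ A`, if `V'` is the conjugate
of `V`. -/
lemma BundleIso.exists_flip {V V' A B : HermitianBundle I S}
    (hV : ∀ s, Module.finrank ℂ (V.fiber s) = 1) (hV' : ∀ s, Module.finrank ℂ (V'.fiber s) = 1)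
    (c : ∀ s, V.fiber s ≃ₗᵢ⋆[ℂ] V'.fiber s)
    (hc : ∀ (s₀ : S) (σ : ∀ s, V.fiber s), SecAt I V (fun s => s) σ s₀ →
      SecAt I V' (fun s => s) (fun s => c s (σ s)) s₀)
    (θ : BundleIso (V.tensor A) B) :
    ∃ θ' : BundleIso (V'.tensor B) A, ∀ (s : S) (v : V.fiber s) (e : A.fiber s), ‖v‖ = 1 →
      θ'.equiv s (c s v ⊗ₜ θ.equiv s (v ⊗ₜ e)) = e := by
  choose u hu using fun s => exists_unit (hV s)
  have hcu : ∀ s (v : V.fiber s), ‖v‖ = 1 → ‖c s v‖ = 1 := fun s v hv =>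
    ((c s).norm_map v).trans hv
  -- The map c(u) ⊗ θ(u ⊗ e) ↦ e for an arbitrary unit vector u. Another unit vector multiplies the
  -- two factors by conjugate phases, so u does not matter.
  let f : ∀ s, V'.fiber s ⊗[ℂ] B.fiber s ≃ₗᵢ[ℂ] A.fiber s := fun s =>
    ((tmulUnit (hV' s) (c s (u s)) (hcu s _ (hu s))).symm.trans (θ.equiv s).symm).trans
      (tmulUnit (hV s) (u s) (hu s)).symm
  have hf : ∀ (s : S) (v : V.fiber s) (e : A.fiber s), ‖v‖ = 1 →
      f s (c s v ⊗ₜ θ.equiv s (v ⊗ₜ e)) = e := by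
    intro s v e hv
    have h₁ : c s v = (starRingEnd ℂ) ⟪u s, v⟫_ℂ • c s (u s) := by
      conv_lhs => rw [line_eq_inner_smul (hV s) (hu s) v, map_smulₛₗ]
    have h₂ : v ⊗ₜ[ℂ] e = ⟪u s, v⟫_ℂ • (u s ⊗ₜ[ℂ] e) := by
      conv_lhs => rw [line_eq_inner_smul (hV s) (hu s) v]
      rw [TensorProduct.smul_tmul']
    have h₃ : θ.equiv s (v ⊗ₜ e) = ⟪u s, v⟫_ℂ • θ.equiv s (u s ⊗ₜ e) :=
      (congrArg (θ.equiv s) h₂).trans (map_smul (θ.equiv s) _ _)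
    have h₄ : f s (c s (u s) ⊗ₜ θ.equiv s (u s ⊗ₜ e)) = e := by
      refine (congrArg (fun b => (tmulUnit (hV s) (u s) (hu s)).symm ((θ.equiv s).symm b))
        (tmulUnit_symm_apply (hV' s) (c s (u s)) (hcu s _ (hu s)) _)).trans ?_
      refine (congrArg (tmulUnit (hV s) (u s) (hu s)).symm
        ((θ.equiv s).symm_apply_apply (u s ⊗ₜ[ℂ] e))).trans ?_
      exact tmulUnit_symm_apply _ _ _ _
    rw [h₁, h₃, TensorProduct.tmul_smul, ← TensorProduct.smul_tmul', map_smul, map_smul, h₄,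
      smul_smul, inner_conj_symm, StableIso.inner_mul_inner_unit (hV s) (hu s) hv, one_smul]
  refine ⟨⟨f, IsSmoothFamily.of_secAt fun s₀ => ?_⟩, hf⟩
  obtain ⟨v, hv, hn⟩ := exists_unit_sec (T := S) (t₀ := s₀) (φ := fun s => s) hV (SmAt.val s₀)
  have hB := exists_frameAt B (φ := fun s => s) (SmAt.val (I' := I) s₀)
  have hA := exists_frameAt A (φ := fun s => s) (SmAt.val (I' := I) s₀)
  have h₁ := (hc s₀ v hv).lineFrameAt hV' (hn.mono fun s h => hcu s _ h)
  refine ⟨_, inferInstance, _, h₁.tensor hB, fun k => ?_⟩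
  refine SecAt.of_frame (SmAt.val (I' := I) s₀) hA fun i => ?_
  -- For a smooth local unit section v the matrix entry ⟪a, f(c(v) ⊗ b)⟫ equals ⟪θ(v ⊗ a), b⟫, which
  -- involves no choices.
  refine ((θ.secAt (φ := fun s => s) (hv.tensor (hA.1 i))).inner (hB.1 k.2)).congr
    (hn.mono fun s hs => ?_)
  obtain ⟨e, he⟩ := ((tmulUnit (hV s) (v s) hs).trans (θ.equiv s)).surjective
    (frameSec B s₀ k.2 s)
  have he' : θ.equiv s (v s ⊗ₜ e) = frameSec B s₀ k.2 s := he
  have h₂ : f s (c s (v s) ⊗ₜ frameSec B s₀ k.2 s) = e :=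
    (congrArg (fun b => f s (c s (v s) ⊗ₜ b)) he'.symm).trans (hf s (v s) e hs)
  have h₃ : ⟪θ.equiv s (v s ⊗ₜ frameSec A s₀ i s), θ.equiv s (v s ⊗ₜ e)⟫_ℂ =
      ⟪frameSec A s₀ i s, e⟫_ℂ :=
    ((θ.equiv s).inner_map_map _ _).trans ((TensorProduct.inner_tmul ..).trans (by
      rw [inner_self_of_unit hs, one_mul]))
  exact (congrArg (fun x => ⟪frameSec A s₀ i s, x⟫_ℂ) h₂).trans
    (h₃.symm.trans (congrArg (fun x => ⟪θ.equiv s (v s ⊗ₜ frameSec A s₀ i s), x⟫_ℂ) he'))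

end Flip

/-! ### The twists by K* and by K -/

section StableTwists

variable {EM HM : Type*} [NormedAddCommGroup EM] [NormedSpace ℝ EM] [TopologicalSpace HM]
  {IM : ModelWithCorners ℝ EM HM} {M : Type*} [TopologicalSpace M] [ChartedSpace HM M]
  {E H : Type*} [NormedAddCommGroup E] [NormedSpace ℝ E] [TopologicalSpace H]
  {I : ModelWithCorners ℝ E H} {N : Type*} [TopologicalSpace N] [ChartedSpace H N]
  {E' H' : Type*} [NormedAddCommGroup E'] [NormedSpace ℝ E'] [TopologicalSpace H']
  {I' : ModelWithCorners ℝ E' H'} {N' : Type*} [TopologicalSpace N'] [ChartedSpace H' N']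
  {𝒴 : SplitSpace IM M I N} {𝒳 : SplitSpace IM M I' N'}

open SplitSpace

/-- The point `(y, x)` for a point `(x, y)`. -/
abbrev SplitSpace.swapPt (z : (𝒳.prod 𝒴).carrier) : (𝒴.prod 𝒳).carrier :=
  ⟨z.1.swap, z.2.2.1, z.2.1, z.2.2.2.symm⟩

/-- The point `((y₁, x₁), (y₂, x₂))` for a point `((x₁, y₁), (x₂, y₂))`. -/
abbrev SplitSpace.swapSq (w : (𝒳.prod 𝒴).sq) : (𝒴.prod 𝒳).sq :=
  ⟨(w.1.1.swap, w.1.2.swap), (swapPt (sqFst w)).2, (swapPt (sqSnd w)).2,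
    proj_sndPt (z₁ := sqFst w) (z₂ := sqSnd w) w.2.2.2⟩

lemma smAt_swapSq (w₀ : (𝒳.prod 𝒴).sq) :
    SmAt ((I'.prod I).prod (I'.prod I)) ((I.prod I').prod (I.prod I'))
      (fun w : (𝒳.prod 𝒴).sq => (swapSq w : (N × N') × (N × N'))) w₀ :=
  have hv := SmAt.val (I' := (I'.prod I).prod (I'.prod I)) w₀
  (hv.fst.snd.prodMk hv.fst.fst).prodMk (hv.snd.snd.prodMk hv.snd.fst)

lemma SecAt.swap_pullSnd {J : BundleGerbe 𝒳}
    {j : ∀ w : (𝒴.prod 𝒳).sq, (J.pullSnd 𝒴).bundle.fiber w} {w₀ : (𝒳.prod 𝒴).sq}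
    (hj : SecAt ((I.prod I').prod (I.prod I')) (J.pullSnd 𝒴).bundle (fun w => w) j (swapSq w₀)) :
    SecAt ((I'.prod I).prod (I'.prod I)) (J.pullFst 𝒴).bundle (fun w => w)
      (fun w => j (swapSq w)) w₀ := by
  have h₁ : SecAt ((I.prod I').prod (I.prod I')) J.bundle
      (fun w : (𝒴.prod 𝒳).sq => ⟨(w.1.1.2, w.1.2.2), 𝒴.mapsTo_prod_sq_snd 𝒳 w.2⟩) j (swapSq w₀) :=
    SecAt.of_pullback (A := J.bundle) (φ := fun w : (𝒴.prod 𝒳).sq => w)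
      (f := fun p : (N × N') × (N × N') => (p.1.2, p.2.2))
      (hf := (contMDiff_snd.comp contMDiff_fst).prodMk (contMDiff_snd.comp contMDiff_snd))
      (hS := 𝒴.mapsTo_prod_sq_snd 𝒳) hj
  exact SecAt.pullback (φ := fun w : (𝒳.prod 𝒴).sq => w) (A := J.bundle)
    (f := fun p : (N' × N) × (N' × N) => (p.1.1, p.2.1))
    (hf := (contMDiff_fst.comp contMDiff_fst).prodMk (contMDiff_fst.comp contMDiff_snd))
    (hS := 𝒳.mapsTo_prod_sq_fst 𝒴)
    (SmAt.val (I' := (I'.prod I).prod (I'.prod I)) w₀) (h₁.comp (ψ := swapSq) (smAt_swapSq w₀))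

lemma SecAt.swap_pullFst {L : BundleGerbe 𝒴}
    {l : ∀ w : (𝒴.prod 𝒳).sq, (L.pullFst 𝒳).bundle.fiber w} {w₀ : (𝒳.prod 𝒴).sq}
    (hl : SecAt ((I.prod I').prod (I.prod I')) (L.pullFst 𝒳).bundle (fun w => w) l (swapSq w₀)) :
    SecAt ((I'.prod I).prod (I'.prod I)) (L.pullSnd 𝒳).bundle (fun w => w)
      (fun w => l (swapSq w)) w₀ := by
  have h₁ : SecAt ((I.prod I').prod (I.prod I')) L.bundle
      (fun w : (𝒴.prod 𝒳).sq => ⟨(w.1.1.1, w.1.2.1), 𝒴.mapsTo_prod_sq_fst 𝒳 w.2⟩) l (swapSq w₀) :=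
    SecAt.of_pullback (A := L.bundle) (φ := fun w : (𝒴.prod 𝒳).sq => w)
      (f := fun p : (N × N') × (N × N') => (p.1.1, p.2.1))
      (hf := (contMDiff_fst.comp contMDiff_fst).prodMk (contMDiff_fst.comp contMDiff_snd))
      (hS := 𝒴.mapsTo_prod_sq_fst 𝒳) hl
  exact SecAt.pullback (φ := fun w : (𝒳.prod 𝒴).sq => w) (A := L.bundle)
    (f := fun p : (N' × N) × (N' × N) => (p.1.2, p.2.2))
    (hf := (contMDiff_snd.comp contMDiff_fst).prodMk (contMDiff_snd.comp contMDiff_snd))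
    (hS := 𝒳.mapsTo_prod_sq_snd 𝒴)
    (SmAt.val (I' := (I'.prod I).prod (I'.prod I)) w₀) (h₁.comp (ψ := swapSq) (smAt_swapSq w₀))

namespace StableIso

variable {L : BundleGerbe 𝒴} {J : BundleGerbe 𝒳} (T : StableIso L J)

/-- The twist by `K*`. -/
def twist : Twist (L.pullFst 𝒳) (J.pullSnd 𝒴) where
  line := T.line.dual
  rank_one z := finrank_dual.trans (T.rank_one z)
  rel {z₁ z₂} h q₁ q₂ l j := T.Corr h ((HDual.riesz (T.line.fiber z₁)).symm q₁)
    ((HDual.riesz (T.line.fiber z₂)).symm q₂) l j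
  rel_norm {z₁ z₂} _ q₁ q₂ _ _ hc :=
    ⟨((HDual.riesz (T.line.fiber z₁)).symm.norm_map q₁).symm.trans hc.1.1,
      ((HDual.riesz (T.line.fiber z₂)).symm.norm_map q₂).symm.trans hc.1.2.1, hc.1.2.2⟩
  exists_rel {z₁ z₂} h q₁ q₂ l h₁ h₂ hl := ⟨_, T.corr_evalAt (h := h)
    (((HDual.riesz (T.line.fiber z₁)).symm.norm_map q₁).trans h₁)
    (((HDual.riesz (T.line.fiber z₂)).symm.norm_map q₂).trans h₂) hl⟩
  exists_local w₀ := by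
    obtain ⟨κ₁, κ₂, l, j, h₁, h₂, hl, hj, hc⟩ := T.exists_local_corr w₀
    refine ⟨_, _, l, j, h₁.riesz, h₂.riesz, hl, hj, hc.mono fun w h => ?_⟩
    have e₁ := (HDual.riesz (T.line.fiber (sqFst w))).symm_apply_apply (κ₁ w)
    have e₂ := (HDual.riesz (T.line.fiber (sqSnd w))).symm_apply_apply (κ₂ w)
    rw [← e₁, ← e₂] at h
    exact h
  rel_scale hc hc' := hc.scale'' hc'
  rel_mul hc hc' := hc.mul hc'

/-- The twist by `K`, in the opposite direction. -/
def twistSymm : Twist (J.pullFst 𝒴) (L.pullSnd 𝒳) where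
  line := T.line.pullback (S' := (𝒳.prod 𝒴).carrier) Prod.swap
    (contMDiff_snd.prodMk contMDiff_fst) (fun z hz => (swapPt ⟨z, hz⟩).2)
  rank_one z := T.rank_one (swapPt z)
  -- The same correspondence, read from J to L: the points are swapped, and the κ themselves replace
  -- their duals.
  rel {z₁ z₂} h q₁ q₂ j l := T.Corr (z₁ := swapPt z₁) (z₂ := swapPt z₂) (proj_sndPt h) q₁ q₂ l j
  rel_norm hc := ⟨hc.1.1, hc.1.2.1, hc.1.2.2.2, hc.1.2.2.1⟩
  exists_rel {z₁ z₂} h q₁ q₂ j h₁ h₂ hj :=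
    exists_corr_right (z₁ := swapPt z₁) (z₂ := swapPt z₂) (h := proj_sndPt h) h₁ h₂ hj
  exists_local w₀ := by
    obtain ⟨κ₁, κ₂, l, j, h₁, h₂, hl, hj, hc⟩ := T.exists_local_corr (swapSq w₀)
    have hv := SmAt.val (I' := (I'.prod I).prod (I'.prod I)) w₀
    have hs := smAt_swapSq w₀
    refine ⟨fun w => κ₁ (swapSq w), fun w => κ₂ (swapSq w), fun w => j (swapSq w),
      fun w => l (swapSq w), ?_, ?_, ?_, ?_, ?_⟩
    · exact SecAt.pullback (f := Prod.swap) (A := T.line) hv.fst (h₁.comp (ψ := swapSq) hs)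
    · exact SecAt.pullback (f := Prod.swap) (A := T.line) hv.snd (h₂.comp (ψ := swapSq) hs)
    · exact hj.swap_pullSnd
    · exact hl.swap_pullFst
    · exact (hs.continuousAt_subtype (f := swapSq)).eventually hc
  rel_scale hc hc' := hc.scale' hc'
  rel_mul hc hc' := hc.mul hc'

end StableIso

end StableTwists

/-! ### The isomorphism of semigroups defined by a stable isomorphism -/

section InducedModules

variable {EM HM : Type*} [NormedAddCommGroup EM] [NormedSpace ℝ EM] [TopologicalSpace HM]
  {IM : ModelWithCorners ℝ EM HM} {M : Type*} [TopologicalSpace M] [ChartedSpace HM M]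
  {E H : Type*} [NormedAddCommGroup E] [NormedSpace ℝ E] [TopologicalSpace H]
  {I : ModelWithCorners ℝ E H} {N : Type*} [TopologicalSpace N] [ChartedSpace H N]
  {E' H' : Type*} [NormedAddCommGroup E'] [NormedSpace ℝ E'] [TopologicalSpace H']
  {I' : ModelWithCorners ℝ E' H'} {N' : Type*} [TopologicalSpace N'] [ChartedSpace H' N']
  {𝒴 : SplitSpace IM M I N} {𝒳 : SplitSpace IM M I' N'}
  {L : BundleGerbe 𝒴} {J : BundleGerbe 𝒳}

open SplitSpace

lemma BundleIso.map_smul_tmul_smul {S : Set N} {V A B : HermitianBundle I S}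
    (θ : BundleIso (V.tensor A) B) (s : S) (c d : ℂ) (v : V.fiber s) (e : A.fiber s) :
    θ.equiv s ((c • v) ⊗ₜ (d • e)) = (c * d) • θ.equiv s (v ⊗ₜ e) :=
  (congrArg (θ.equiv s) (TensorProduct.smul_tmul_smul c d v e)).trans
    (map_smul (θ.equiv s) (c * d) (v ⊗ₜ[ℂ] e))

lemma Twist.Ind.sum {W : Twist (L.pullFst 𝒳) (J.pullSnd 𝒴)} {F F' : GerbeModule L}
    {G G' : GerbeModule J} (h : W.Ind F G) (h' : W.Ind F' G') : W.Ind (F.sum F') (G.sum G') := by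
  obtain ⟨θ, hθ⟩ := h
  obtain ⟨θ', hθ'⟩ := h'
  refine ⟨⟨(BundleIso.diagonal θ θ').equiv, (BundleIso.diagonal θ θ').smooth⟩, ?_⟩
  intro z₁ z₂ h q₁ q₂ a b hr e
  exact congrArg₂ (fun v w => WithLp.toLp 2 (v, w)) (hθ z₁ z₂ h q₁ q₂ a b hr e.fst)
    (hθ' z₁ z₂ h q₁ q₂ a b hr e.snd)

namespace StableIso

variable {T : StableIso L J} {F : GerbeModule L} {G : GerbeModule J}

lemma twist_rel_riesz {z₁ z₂ : (𝒴.prod 𝒳).carrier}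
    {h : (𝒴.prod 𝒳).proj z₁ = (𝒴.prod 𝒳).proj z₂} {κ₁ : T.line.fiber z₁} {κ₂ : T.line.fiber z₂}
    {l : L.bundle.fiber (𝒴.pair (y₁ := fstPt z₁) (y₂ := fstPt z₂) h)}
    {j : J.bundle.fiber (𝒳.pair (proj_sndPt h))} :
    T.twist.rel h (HDual.riesz (T.line.fiber z₁) κ₁) (HDual.riesz (T.line.fiber z₂) κ₂) l j ↔
      T.Corr h κ₁ κ₂ l j := by
  change T.Corr h ((HDual.riesz (T.line.fiber z₁)).symm (HDual.riesz _ κ₁))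
    ((HDual.riesz (T.line.fiber z₂)).symm (HDual.riesz _ κ₂)) l j ↔ _
  rw [LinearIsometryEquiv.symm_apply_apply, LinearIsometryEquiv.symm_apply_apply]

/-- Specialise the compatibility to k = κ₂, η = κ₂*, ξ = κ₁*. Then η(k) = 1, and the contraction
with l is the corresponding element of J. -/
lemma Induces.ind (h : T.Induces F G) : T.twist.Ind F G := by
  obtain ⟨θ, hθ⟩ := h
  refine ⟨θ, fun z₁ z₂ h q₁ q₂ a b hr e => ?_⟩
  obtain ⟨κ₁, rfl⟩ := (HDual.riesz (T.line.fiber z₁)).surjective q₁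
  obtain ⟨κ₂, rfl⟩ := (HDual.riesz (T.line.fiber z₂)).surjective q₂
  have hc : T.Corr h κ₁ κ₂ a b := twist_rel_riesz.mp hr
  have e₁ := hθ z₁ z₂ h κ₂ (HDual.riesz _ κ₁) a (HDual.riesz _ κ₂) e
  rw [HDual.ev_riesz, inner_self_of_unit hc.1.2.1, one_smul] at e₁
  refine Eq.trans ?_ e₁
  exact congrArg (fun v => G.smul (proj_sndPt h) v (θ.equiv z₂ (HDual.riesz _ κ₂ ⊗ₜ e)))
    hc.evalAt_eq.symm

/-- The variables k, ξ, l and η all run through lines, so they are multiples of the vectors of one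
corresponding quadruple. Both sides of the compatibility are multiplied by the product of the four
scalars. -/
lemma Induces.of_ind (h : T.twist.Ind F G) : T.Induces F G := by
  obtain ⟨θ, hθ⟩ := h
  refine ⟨θ, fun z₁ z₂ h k ξ l η e => ?_⟩
  obtain ⟨κ₁, hκ₁⟩ := exists_unit (T.rank_one z₁)
  obtain ⟨κ₂, hκ₂⟩ := exists_unit (T.rank_one z₂)
  obtain ⟨a, ha⟩ := exists_unit (L.rank_one (𝒴.pair (y₁ := fstPt z₁) (y₂ := fstPt z₂) h))
  have hc := T.corr_evalAt (h := h) hκ₁ hκ₂ ha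
  set b := evalAt a (T.app h (κ₂ ⊗ₜ[ℂ] HDual.riesz _ κ₁))
  have hr : T.twist.rel h (HDual.riesz (T.line.fiber z₁) κ₁) (HDual.riesz (T.line.fiber z₂) κ₂)
      a b := twist_rel_riesz.mpr hc
  have key := hθ z₁ z₂ h _ _ a b hr e
  obtain ⟨c, rfl⟩ : ∃ c : ℂ, k = c • κ₂ := ⟨_, line_eq_inner_smul (T.rank_one z₂) hκ₂ k⟩
  obtain ⟨d, rfl⟩ : ∃ d : ℂ, ξ = d • HDual.riesz _ κ₁ :=
    ⟨_, line_eq_inner_smul (finrank_dual.trans (T.rank_one z₁)) (norm_riesz hκ₁) ξ⟩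
  obtain ⟨c', rfl⟩ : ∃ c : ℂ, l = c • a := ⟨_, line_eq_inner_smul (L.rank_one _) ha l⟩
  obtain ⟨d', rfl⟩ : ∃ d : ℂ, η = d • HDual.riesz _ κ₂ :=
    ⟨_, line_eq_inner_smul (finrank_dual.trans (T.rank_one z₂)) (norm_riesz hκ₂) η⟩
  have e₁ : evalAt (c' • a) (T.app h ((c • κ₂) ⊗ₜ[ℂ] (d • HDual.riesz _ κ₁))) =
      (c * d * c') • b := by
    rw [TensorProduct.smul_tmul_smul, map_smul, hc.2, map_smul, evalAt_tmul, map_smul,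
      HDual.ev_riesz, inner_self_of_unit ha, smul_smul, smul_eq_mul, mul_one]
  have e₂ : θ.equiv z₂ ((d' • HDual.riesz (T.line.fiber z₂) κ₂) ⊗ₜ e) =
      d' • θ.equiv z₂ (HDual.riesz (T.line.fiber z₂) κ₂ ⊗ₜ e) :=
    map_smul (θ.equiv z₂) d' (HDual.riesz (T.line.fiber z₂) κ₂ ⊗ₜ[ℂ] e)
  have e₃ : θ.equiv z₁ ((d • HDual.riesz (T.line.fiber z₁) κ₁) ⊗ₜ
      F.smul (y₁ := fstPt z₁) (y₂ := fstPt z₂) h (c' • a) e) =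
      (d * c') • θ.equiv z₁ (HDual.riesz (T.line.fiber z₁) κ₁ ⊗ₜ
        F.smul (y₁ := fstPt z₁) (y₂ := fstPt z₂) h a e) := by
    refine Eq.trans ?_ (θ.map_smul_tmul_smul z₁ d c' (HDual.riesz (T.line.fiber z₁) κ₁)
      (F.smul (y₁ := fstPt z₁) (y₂ := fstPt z₂) h a e))
    exact congrArg (fun v : (bundleFst F.bundle 𝒳).fiber z₁ =>
      θ.equiv z₁ ((d • HDual.riesz (T.line.fiber z₁) κ₁) ⊗ₜ v))
      (GerbeModule.smul_smul_left (y₁ := fstPt z₁) (y₂ := fstPt z₂) c' a e)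
  have e₄ : (d' • HDual.riesz (T.line.fiber z₂) κ₂).ev (c • κ₂) = d' * c := by
    rw [map_smul, map_smul, LinearMap.smul_apply, HDual.ev_riesz, inner_self_of_unit hκ₂,
      smul_eq_mul, smul_eq_mul, mul_one, mul_comm]
  have e₅ : G.smul (proj_sndPt h)
        (evalAt (c' • a) (T.app h ((c • κ₂) ⊗ₜ[ℂ] (d • HDual.riesz _ κ₁))))
        (θ.equiv z₂ ((d' • HDual.riesz (T.line.fiber z₂) κ₂) ⊗ₜ e)) =
      (d' * c) • θ.equiv z₁ ((d • HDual.riesz (T.line.fiber z₁) κ₁) ⊗ₜ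
        F.smul (y₁ := fstPt z₁) (y₂ := fstPt z₂) h (c' • a) e) := by
    refine (congrArg₂ (fun v w => G.smul (proj_sndPt h) v w) e₁ e₂).trans ?_
    refine Eq.trans ?_ (congrArg (fun v => (d' * c) • v) e₃).symm
    refine (GerbeModule.smul_smul_left _ _ _).trans ?_
    refine (congrArg (fun v => (c * d * c') • v) ((GerbeModule.smul_smul_right _ _ _).trans
      (congrArg (fun v => d' • v) key))).trans ?_
    refine (smul_smul _ _ _).trans (Eq.trans ?_ (smul_smul _ _ _).symm)
    congr 1
    ring
  exact e₅.trans (congrArg (fun x : ℂ => x • θ.equiv z₁ ((d • HDual.riesz (T.line.fiber z₁) κ₁) ⊗ₜ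
        F.smul (y₁ := fstPt z₁) (y₂ := fstPt z₂) h (c' • a) e)) e₄.symm)

/-- Flipping θ : K* ⊗ F ≅ G gives an isomorphism K ⊗ G ≅ F with κ ⊗ θ(κ* ⊗ e) ↦ e for unit κ.
Applying it to the compatibility of θ yields that of the flipped map. -/
lemma ind_symm (h : T.twist.Ind F G) : T.twistSymm.Ind G F := by
  obtain ⟨θ, hθ⟩ := h
  obtain ⟨θ', hθ'⟩ := θ.exists_flip T.twist.rank_one T.rank_one
    (fun z => (HDual.riesz (T.line.fiber z)).symm) (fun z₀ σ hσ => SecAt.of_riesz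
      (hσ.congr (Filter.Eventually.of_forall fun z =>
        (HDual.riesz (T.line.fiber z)).apply_symm_apply (σ z))))
  let θs := θ'.pullback (S' := (𝒳.prod 𝒴).carrier) (I' := I'.prod I) Prod.swap
    (contMDiff_snd.prodMk contMDiff_fst) (fun z hz => (swapPt ⟨z, hz⟩).2)
  refine ⟨⟨θs.equiv, θs.smooth⟩, fun w₁ w₂ h κ₁ κ₂ j l (hc : T.Corr (z₁ := swapPt w₁)
    (z₂ := swapPt w₂) (proj_sndPt h) κ₁ κ₂ l j) g => ?_⟩
  have hθ₁ : ∀ (z : (𝒴.prod 𝒳).carrier) (κ : T.line.fiber z) (e : F.bundle.fiber (fstPt z)),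
      ‖κ‖ = 1 → θ'.equiv z (κ ⊗ₜ θ.equiv z (HDual.riesz _ κ ⊗ₜ e)) = e := fun z κ e hκ =>
    (congrArg (fun v => θ'.equiv z (v ⊗ₜ θ.equiv z (HDual.riesz _ κ ⊗ₜ e)))
      ((HDual.riesz (T.line.fiber z)).symm_apply_apply κ).symm).trans
        (hθ' z (HDual.riesz _ κ) e (norm_riesz hκ))
  obtain ⟨x, hx⟩ := (θ.equiv (swapPt w₂)).surjective g
  obtain ⟨e, he⟩ := (tmulUnit (T.twist.rank_one (swapPt w₂)) (HDual.riesz _ κ₂)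
    (norm_riesz hc.1.2.1)).surjective x
  have hg : θ.equiv (swapPt w₂) (HDual.riesz (T.line.fiber (swapPt w₂)) κ₂ ⊗ₜ e) = g :=
    (congrArg (θ.equiv (swapPt w₂)) he).trans hx
  subst hg
  have hr : T.twist.rel (z₁ := swapPt w₁) (z₂ := swapPt w₂) (proj_sndPt h)
      (HDual.riesz (T.line.fiber (swapPt w₁)) κ₁) (HDual.riesz (T.line.fiber (swapPt w₂)) κ₂)
      l j := twist_rel_riesz.mpr hc
  have key := hθ (swapPt w₁) (swapPt w₂) (proj_sndPt h) _ _ l j hr e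
  have e₁ := hθ₁ (swapPt w₂) κ₂ e hc.1.2.1
  have e₂ := hθ₁ (swapPt w₁) κ₁ (F.smul (y₁ := fstPt (swapPt w₁)) (y₂ := fstPt (swapPt w₂))
    (proj_sndPt h) l e) hc.1.1
  refine (congrArg (fun v => F.smul (y₁ := fstPt (swapPt w₁)) (y₂ := fstPt (swapPt w₂))
    (proj_sndPt h) l v) e₁).trans (e₂.symm.trans ?_)
  exact congrArg (fun v => θ'.equiv (swapPt w₁) (κ₁ ⊗ₜ v)) key.symm

/-- The same flip in the opposite direction, from K ⊗ G ≅ F to K* ⊗ F ≅ G. -/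
lemma ind_of_symm (h : T.twistSymm.Ind G F) : T.twist.Ind F G := by
  obtain ⟨θ, hθ⟩ := h
  obtain ⟨θ', hθ'⟩ := θ.exists_flip (V' := T.twistSymm.line.dual) T.twistSymm.rank_one
    (fun z => finrank_dual.trans (T.twistSymm.rank_one z))
    (fun z => HDual.riesz (T.twistSymm.line.fiber z)) (fun z₀ σ hσ => hσ.riesz)
  let θs := θ'.pullback (S' := (𝒴.prod 𝒳).carrier) (I' := I.prod I') Prod.swap
    (contMDiff_snd.prodMk contMDiff_fst) (fun z hz => (swapPt ⟨z, hz⟩).2)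
  refine ⟨⟨θs.equiv, θs.smooth⟩, fun w₁ w₂ h q₁ q₂ l j hr f => ?_⟩
  obtain ⟨κ₁, rfl⟩ := (HDual.riesz (T.line.fiber w₁)).surjective q₁
  obtain ⟨κ₂, rfl⟩ := (HDual.riesz (T.line.fiber w₂)).surjective q₂
  have hc : T.Corr h κ₁ κ₂ l j := twist_rel_riesz.mp hr
  obtain ⟨x, hx⟩ := (θ.equiv (swapPt w₂)).surjective f
  obtain ⟨g, hg⟩ := (tmulUnit (T.twistSymm.rank_one (swapPt w₂)) κ₂ hc.1.2.1).surjective x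
  have hf : θ.equiv (swapPt w₂) (κ₂ ⊗ₜ g) = f := (congrArg (θ.equiv (swapPt w₂)) hg).trans hx
  subst hf
  have key := hθ (swapPt w₁) (swapPt w₂) (proj_sndPt h) κ₁ κ₂ j l hc g
  have e₁ := hθ' (swapPt w₂) κ₂ g hc.1.2.1
  have e₂ := hθ' (swapPt w₁) κ₁ (G.smul (proj_sndPt h) j g) hc.1.1
  refine (congrArg (fun v => G.smul (proj_sndPt h) j v) e₁).trans (e₂.symm.trans ?_)
  exact congrArg (fun v => θ'.equiv (swapPt w₁) (HDual.riesz (T.line.fiber w₁) κ₁ ⊗ₜ v)) key.symm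

end StableIso

end InducedModules

/-! ### The isomorphism of K-groups -/

section KTheory

variable {EM HM : Type*} [NormedAddCommGroup EM] [NormedSpace ℝ EM] [TopologicalSpace HM]
  {IM : ModelWithCorners ℝ EM HM} {M : Type*} [TopologicalSpace M] [ChartedSpace HM M]
  {E H : Type*} [NormedAddCommGroup E] [NormedSpace ℝ E] [TopologicalSpace H]
  {I : ModelWithCorners ℝ E H} {N : Type*} [TopologicalSpace N] [ChartedSpace H N]
  {E' H' : Type*} [NormedAddCommGroup E'] [NormedSpace ℝ E'] [TopologicalSpace H']
  {I' : ModelWithCorners ℝ E' H'} {N' : Type*} [TopologicalSpace N'] [ChartedSpace H' N']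
  {𝒴 : SplitSpace IM M I N} {𝒳 : SplitSpace IM M I' N'}
  {L : BundleGerbe 𝒴} {J : BundleGerbe 𝒳}

lemma grothendieckLift_of {A B : Type*} [AddCommMonoid A] [AddCommGroup B] (f : A →+ B) (a : A) :
    Algebra.GrothendieckAddGroup.lift f (Algebra.GrothendieckAddGroup.of a) = f a :=
  DFunLike.congr_fun (Algebra.GrothendieckAddGroup.lift.symm_apply_apply f) a

/-- By the universal property it suffices to compare the two homomorphisms on classes of elements of
`A`. -/
lemma grothendieckLift_comp {A B : Type*} [AddCommMonoid A] [AddCommMonoid B] (f : A →+ B)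
    (g : B →+ A) (h : ∀ a, g (f a) = a) :
    (Algebra.GrothendieckAddGroup.lift (Algebra.GrothendieckAddGroup.of.comp g)).comp
      (Algebra.GrothendieckAddGroup.lift (Algebra.GrothendieckAddGroup.of.comp f)) =
        AddMonoidHom.id (Algebra.GrothendieckAddGroup A) := by
  refine Algebra.GrothendieckAddGroup.lift.symm.injective (AddMonoidHom.ext fun a => ?_)
  have e₁ := grothendieckLift_of (Algebra.GrothendieckAddGroup.of.comp f) a
  have e₂ := grothendieckLift_of (Algebra.GrothendieckAddGroup.of.comp g) (f a)
  exact (congrArg (Algebra.GrothendieckAddGroup.lift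
    (Algebra.GrothendieckAddGroup.of.comp g)) e₁).trans
      (e₂.trans (congrArg Algebra.GrothendieckAddGroup.of (h a)))

/-- An isomorphism of commutative monoids induces one of Grothendieck groups. -/
def grothendieckCongr {A B : Type*} [AddCommMonoid A] [AddCommMonoid B] (f : A ≃+ B) :
    Algebra.GrothendieckAddGroup A ≃+ Algebra.GrothendieckAddGroup B :=
  AddMonoidHom.toAddEquiv
    (Algebra.GrothendieckAddGroup.lift (Algebra.GrothendieckAddGroup.of.comp f.toAddMonoidHom))
    (Algebra.GrothendieckAddGroup.lift (Algebra.GrothendieckAddGroup.of.comp f.symm.toAddMonoidHom))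
    (grothendieckLift_comp f.toAddMonoidHom f.symm.toAddMonoidHom f.symm_apply_apply)
    (grothendieckLift_comp f.symm.toAddMonoidHom f.toAddMonoidHom f.apply_symm_apply)

lemma grothendieckCongr_of {A B : Type*} [AddCommMonoid A] [AddCommMonoid B] (f : A ≃+ B)
    (a : A) : grothendieckCongr f (Algebra.GrothendieckAddGroup.of a) =
      Algebra.GrothendieckAddGroup.of (f a) :=
  grothendieckLift_of (Algebra.GrothendieckAddGroup.of.comp f.toAddMonoidHom) a

namespace StableIso

variable (T : StableIso L J)

lemma exists_induces (F : GerbeModule L) : ∃ G : GerbeModule J, T.Induces F G :=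
  (T.twist.exists_ind F).imp fun _ h => Induces.of_ind h

/-- The isomorphism `Mod(L) ≅ Mod(J)` defined by a stable isomorphism. -/
def modEquiv : GerbeMod L ≃+ GerbeMod J where
  -- Modules are chosen arbitrarily here. Well-definedness, additivity and the two inverse laws all
  -- follow from `Twist.Ind.isomorphic`, which compares any two modules induced by isomorphic ones.
  toFun := Quotient.lift (fun F => GerbeMod.mk (T.twist.exists_ind F).choose) fun F F' h =>
    Quotient.sound (Twist.Ind.isomorphic (T.twist.exists_ind F).choose_spec
      (T.twist.exists_ind F').choose_spec h)
  invFun := Quotient.lift (fun G => GerbeMod.mk (T.twistSymm.exists_ind G).choose) fun G G' h =>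
    Quotient.sound (Twist.Ind.isomorphic (T.twistSymm.exists_ind G).choose_spec
      (T.twistSymm.exists_ind G').choose_spec h)
  left_inv x := by
    induction x using Quotient.inductionOn with | h F
    exact Quotient.sound (Twist.Ind.isomorphic (T.twistSymm.exists_ind _).choose_spec
      (ind_symm (T.twist.exists_ind F).choose_spec) (.refl _))
  right_inv x := by
    induction x using Quotient.inductionOn with | h G
    exact Quotient.sound (Twist.Ind.isomorphic (T.twist.exists_ind _).choose_spec
      (ind_of_symm (T.twistSymm.exists_ind G).choose_spec) (.refl _))
  map_add' x y := by
    induction x using Quotient.inductionOn with | h F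
    induction y using Quotient.inductionOn with | h F'
    exact Quotient.sound (Twist.Ind.isomorphic (T.twist.exists_ind _).choose_spec
      ((T.twist.exists_ind F).choose_spec.sum (T.twist.exists_ind F').choose_spec) (.refl _))

lemma modEquiv_mk {F : GerbeModule L} {G : GerbeModule J} (h : T.Induces F G) :
    T.modEquiv (GerbeMod.mk F) = GerbeMod.mk G :=
  Quotient.sound (Twist.Ind.isomorphic (T.twist.exists_ind F).choose_spec h.ind (.refl _))

end StableIso

end KTheory

/-! ### The trivialisation defined by a unit cocycle -/

section UnitCocycles

variable {EM HM : Type*} [NormedAddCommGroup EM] [NormedSpace ℝ EM] [TopologicalSpace HM]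
  {IM : ModelWithCorners ℝ EM HM} {M : Type*} [TopologicalSpace M] [ChartedSpace HM M]
  {E H : Type*} [NormedAddCommGroup E] [NormedSpace ℝ E] [TopologicalSpace H]
  {I : ModelWithCorners ℝ E H} {N : Type*} [TopologicalSpace N] [ChartedSpace H N]
  {E₂ H₂ N₂ : Type*} [NormedAddCommGroup E₂] [NormedSpace ℝ E₂] [TopologicalSpace H₂]
  {I₂ : ModelWithCorners ℝ E₂ H₂} [TopologicalSpace N₂] [ChartedSpace H₂ N₂]
  {𝒵 : SplitSpace IM M I N} {T : Set N₂}

open SplitSpace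

namespace BundleGerbe

variable (P : BundleGerbe 𝒵)

/-- The unit of a bundle gerbe at a pair of equal points. -/
def oneEq {y y' : 𝒵.carrier} (h : y = y') :
    P.bundle.fiber (𝒵.pair (congrArg (fun z : 𝒵.carrier => 𝒵.proj z) h)) := by
  subst h
  exact P.one y

variable {P}

lemma norm_oneEq {y y' : 𝒵.carrier} (h : y = y') : ‖P.oneEq h‖ = 1 := by
  subst h
  exact P.norm_one y

lemma oneEq_mul_oneEq_mul {y₁ y₂ y₃ z : 𝒵.carrier} (h : y₁ = y₂) (h' : y₂ = y₃)
    (hz : 𝒵.proj y₃ = 𝒵.proj z) (a : P.bundle.fiber (𝒵.pair hz)) :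
    P.mul (congrArg (fun z : 𝒵.carrier => 𝒵.proj z) h)
      ((congrArg (fun z : 𝒵.carrier => 𝒵.proj z) h').trans hz) (P.oneEq h)
      (P.mul (congrArg (fun z : 𝒵.carrier => 𝒵.proj z) h') hz (P.oneEq h') a) =
    P.mul (congrArg (fun z : 𝒵.carrier => 𝒵.proj z) (h.trans h')) hz (P.oneEq (h.trans h')) a := by
  subst h h'
  exact one_mul _

lemma secAt_oneEq {φ φ' : T → 𝒵.carrier} (h : ∀ t, φ t = φ' t) {t₀ : T}
    (hφ : SmAt I₂ I (fun t => (φ t : N)) t₀) :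
    SecAt I₂ P.bundle (fun t => 𝒵.pair (congrArg (fun z : 𝒵.carrier => 𝒵.proj z) (h t)))
      (fun t => P.oneEq (h t)) t₀ := by
  obtain rfl : φ = φ' := funext h
  exact secAt_one hφ

end BundleGerbe

/-- Local sections `s_x` of `Z → M`, smooth near the points of the sets of a cover, together with
unit sections `τ_xy` of `(s_x, s_y)^{-1} P` with `τ_xy τ_yz = τ_xz`. -/
structure UnitCocycle (P : BundleGerbe 𝒵) (V : PointCover M) where
  point : M → M → 𝒵.carrier
  proj_point : ∀ x m, 𝒵.proj (point x m) = m
  smooth_point : ∀ (x : M) (m : (Set.univ : Set M)), (m : M) ∈ V.set x →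
    SmAt IM I (fun m : (Set.univ : Set M) => (point x m : N)) m
  unit : ∀ x y m : M,
    P.bundle.fiber (𝒵.pair ((proj_point x m).trans (proj_point y m).symm))
  norm_unit : ∀ x y m, ‖unit x y m‖ = 1
  unit_mul : ∀ x y z m, P.mul ((proj_point x m).trans (proj_point y m).symm)
    ((proj_point y m).trans (proj_point z m).symm) (unit x y m) (unit y z m) = unit x z m
  smooth_unit : ∀ (x y : M) (m : (Set.univ : Set M)), (m : M) ∈ V.set x → (m : M) ∈ V.set y →
    SecAt IM P.bundle (fun m : (Set.univ : Set M) =>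
      𝒵.pair ((proj_point x m).trans (proj_point y m).symm)) (fun m => unit x y m) m

namespace UnitCocycle

variable {P : BundleGerbe 𝒵} {V : PointCover M} (C : UnitCocycle P V)

/-- The point of the fibre of `z` given by the section of index `x`. -/
abbrev loc (x : M) (z : 𝒵.carrier) : 𝒵.carrier := C.point x (𝒵.proj z)

lemma proj_loc (x : M) (z : 𝒵.carrier) : 𝒵.proj (C.loc x z) = 𝒵.proj z := C.proj_point _ _

lemma smAt_loc (x : M) (z₀ : 𝒵.carrier) (h : 𝒵.proj z₀ ∈ V.set x) :
    SmAt I I (fun z : 𝒵.carrier => (C.loc x z : N)) z₀ :=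
  SmAt.comp (φ := fun z : 𝒵.carrier => (⟨𝒵.proj z, Set.mem_univ _⟩ : (Set.univ : Set M)))
    (C.smooth_point x ⟨𝒵.proj z₀, Set.mem_univ _⟩ h) (smAt_proj z₀)

/-- The base point of the fibre of `z`. -/
abbrev base (z : 𝒵.carrier) : 𝒵.carrier := C.loc (𝒵.proj z) z

/-- The base point depends only on the fibre, but equal base points still give different fibre types
of P. Multiplication with `oneEq` serves as the transport between them. -/
lemma base_eq {z z' : 𝒵.carrier} (h : 𝒵.proj z = 𝒵.proj z') : C.base z = C.base z' := by
  unfold base loc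
  rw [h]

lemma loc_eq (x : M) {z z' : 𝒵.carrier} (h : 𝒵.proj z = 𝒵.proj z') : C.loc x z = C.loc x z' := by
  unfold loc
  rw [h]

/-- The multiplication `P_(s_y, z) ≅ P_(s_x, z)` with `τ_xy`. -/
def trans (x y : M) (z : 𝒵.carrier) : P.bundle.fiber (𝒵.pair (C.proj_loc y z)) ≃ₗᵢ[ℂ]
    P.bundle.fiber (𝒵.pair (C.proj_loc x z)) :=
  BundleGerbe.mulLeft ((C.proj_loc x z).trans (C.proj_loc y z).symm) (C.proj_loc y z)
    (C.unit x y (𝒵.proj z)) (C.norm_unit _ _ _)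

lemma trans_apply (x y : M) (z : 𝒵.carrier) (a : P.bundle.fiber (𝒵.pair (C.proj_loc y z))) :
    C.trans x y z a = P.mul ((C.proj_loc x z).trans (C.proj_loc y z).symm) (C.proj_loc y z)
      (C.unit x y (𝒵.proj z)) a := rfl

/-- The cocycle identity of τ, which makes the local pictures P_(s_x, z) of the line bundle fit
together. -/
lemma trans_trans (x y y' : M) (z : 𝒵.carrier)
    (a : P.bundle.fiber (𝒵.pair (C.proj_loc y' z))) :
    C.trans x y z (C.trans y y' z a) = C.trans x y' z a := by
  rw [trans_apply, trans_apply, trans_apply, ← C.unit_mul x y y' (𝒵.proj z)]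
  exact (BundleGerbe.mul_assoc _ _ _).symm

lemma secAt_trans {x y : M} {ψ : T → 𝒵.carrier} {t₀ : T}
    (hψ : SmAt I₂ I (fun t => (ψ t : N)) t₀) (hx : 𝒵.proj (ψ t₀) ∈ V.set x)
    (hy : 𝒵.proj (ψ t₀) ∈ V.set y) {a : ∀ t, P.bundle.fiber (𝒵.pair (C.proj_loc y (ψ t)))}
    (ha : SecAt I₂ P.bundle (fun t => 𝒵.pair (C.proj_loc y (ψ t))) a t₀) :
    SecAt I₂ P.bundle (fun t => 𝒵.pair (C.proj_loc x (ψ t)))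
      (fun t => C.trans x y (ψ t) (a t)) t₀ := by
  have h₁ := (C.smooth_unit x y ⟨𝒵.proj (ψ t₀), Set.mem_univ _⟩ hx hy).comp
    (ψ := fun t => (⟨𝒵.proj (ψ t), Set.mem_univ _⟩ : (Set.univ : Set M))) (s₀ := t₀)
    (SmAt.comp (φ := ψ) (smAt_proj (ψ t₀)) hψ)
  exact BundleGerbe.secAt_mul (h := fun t => (C.proj_loc x (ψ t)).trans (C.proj_loc y (ψ t)).symm)
    h₁ ha

/-- The gluing data of the line bundle with fibres `P_(s(z), z)`, for the base points `s(z)`. -/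
def glueData : GlueData I 𝒵.carrier P.bundle where
  -- The section used here has the index `𝒵.proj z`, which changes with z. The chart at p keeps the
  -- index `𝒵.proj p`, and multiplication with τ relates the two.
  fiber z := P.bundle.fiber (𝒵.pair (C.proj_loc (𝒵.proj z) z))
  nbhd p := (𝒵.exists_isOpen_preimage (V.isOpen_set (𝒵.proj p))).choose
  isOpen_nbhd p := (𝒵.exists_isOpen_preimage (V.isOpen_set (𝒵.proj p))).choose_spec.1
  mem_nbhd p := ((𝒵.exists_isOpen_preimage (V.isOpen_set (𝒵.proj p))).choose_spec.2 p).mpr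
    (V.mem_set _)
  map p z := 𝒵.pair (C.proj_loc (𝒵.proj p) z)
  smooth_map p z hz := (C.smAt_loc _ z
    (((𝒵.exists_isOpen_preimage (V.isOpen_set (𝒵.proj p))).choose_spec.2 z).mp hz)).prodMk
      (SmAt.val z)
  triv p z := C.trans (𝒵.proj z) (𝒵.proj p) z
  smooth_triv p q z₀ hp hq σ hσ := by
    have hp' := ((𝒵.exists_isOpen_preimage (V.isOpen_set (𝒵.proj p))).choose_spec.2 z₀).mp hp
    have hq' := ((𝒵.exists_isOpen_preimage (V.isOpen_set (𝒵.proj q))).choose_spec.2 z₀).mp hq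
    refine (C.secAt_trans (ψ := fun z => z) (SmAt.val z₀) hq' hp' hσ).congr
      (Filter.Eventually.of_forall fun z => ?_)
    rw [LinearIsometryEquiv.symm_apply_eq, trans_trans]

/-- The line bundle with fibres `P_(s(z), z)`. -/
def line : HermitianBundle I 𝒵.carrier := C.glueData.bundle

lemma rank_one_line (z : 𝒵.carrier) : Module.finrank ℂ (C.line.fiber z) = 1 := P.rank_one _

/-- The index x is required only to be equal to the projection of `ψ t₀`, so that the index taken
from z₁ can also serve at a point z₂ of the same fibre. -/
lemma secAt_line {x : M} {ψ : T → 𝒵.carrier} {t₀ : T}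
    (hψ : SmAt I₂ I (fun t => (ψ t : N)) t₀) (hx : 𝒵.proj (ψ t₀) = x)
    {a : ∀ t, P.bundle.fiber (𝒵.pair (C.proj_loc x (ψ t)))}
    (ha : SecAt I₂ P.bundle (fun t => 𝒵.pair (C.proj_loc x (ψ t))) a t₀) :
    SecAt I₂ C.line ψ (fun t => C.trans (𝒵.proj (ψ t)) x (ψ t) (a t)) t₀ := by
  subst hx
  exact C.glueData.secAt hψ (ψ t₀) (C.glueData.mem_nbhd _) ha

/-- The multiplication `P_(z₁, z₂) → P_(s(z₂), z₂)` with an element of `P_(s(z₁), z₁)`. -/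
def lineMul {z₁ z₂ : 𝒵.carrier} (h : 𝒵.proj z₁ = 𝒵.proj z₂) (κ : C.line.fiber z₁)
    (p : P.bundle.fiber (𝒵.pair h)) : C.line.fiber z₂ :=
  P.mul (y₁ := C.base z₂) (y₂ := C.base z₁) (y₃ := z₂)
    (congrArg (fun z : 𝒵.carrier => 𝒵.proj z) (C.base_eq h.symm))
    ((C.proj_loc _ z₁).trans h) (P.oneEq (C.base_eq h.symm)) (P.mul (C.proj_loc _ z₁) h κ p)

variable {C} {z₁ z₂ z₃ : 𝒵.carrier} {h : 𝒵.proj z₁ = 𝒵.proj z₂} {h' : 𝒵.proj z₂ = 𝒵.proj z₃}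

lemma lineMul_smul_left (c : ℂ) (κ : C.line.fiber z₁) (p : P.bundle.fiber (𝒵.pair h)) :
    C.lineMul h (c • κ) p = c • C.lineMul h κ p :=
  (congrArg _ (BundleGerbe.smul_mul c κ p)).trans (BundleGerbe.mul_smul c _ _)

/-- Associativity of P, with the two transports between equal base points merged into one. This
becomes the multiplicativity of P ≅ δ(K). -/
lemma lineMul_lineMul (κ : C.line.fiber z₁) (p : P.bundle.fiber (𝒵.pair h))
    (q : P.bundle.fiber (𝒵.pair h')) :
    C.lineMul h' (C.lineMul h κ p) q = C.lineMul (h.trans h') κ (P.mul h h' p q) := by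
  have e₁ := BundleGerbe.mul_assoc (P.oneEq (C.base_eq h.symm)) (P.mul (C.proj_loc _ z₁) h κ p) q
  have e₂ := BundleGerbe.mul_assoc (L := P) (h := C.proj_loc (𝒵.proj z₁) z₁) κ p q
  refine (congrArg _ (e₁.trans (congrArg _ e₂))).trans ?_
  exact BundleGerbe.oneEq_mul_oneEq_mul (C.base_eq h'.symm) (C.base_eq h.symm) _ _

end UnitCocycle

end UnitCocycles

/-! ### The isomorphism of P with δ(K) -/

section UnitCocycleTrivialisation

variable {EM HM : Type*} [NormedAddCommGroup EM] [NormedSpace ℝ EM] [TopologicalSpace HM]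
  {IM : ModelWithCorners ℝ EM HM} {M : Type*} [TopologicalSpace M] [ChartedSpace HM M]
  {E H : Type*} [NormedAddCommGroup E] [NormedSpace ℝ E] [TopologicalSpace H]
  {I : ModelWithCorners ℝ E H} {N : Type*} [TopologicalSpace N] [ChartedSpace H N]
  {𝒵 : SplitSpace IM M I N}

open SplitSpace

namespace UnitCocycle

variable {P : BundleGerbe 𝒵} {V : PointCover M} {C : UnitCocycle P V}
  {z₁ z₂ z₃ : 𝒵.carrier} {h : 𝒵.proj z₁ = 𝒵.proj z₂} {h' : 𝒵.proj z₂ = 𝒵.proj z₃}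

lemma oneEq_mul_unit_mul (C : UnitCocycle P V) (x : M) {m₁ m₂ : M} (h : m₂ = m₁) {w : 𝒵.carrier}
    (hw : 𝒵.proj (C.point x m₁) = 𝒵.proj w) (e₁ : C.point m₂ m₂ = C.point m₁ m₁)
    (e₂ : C.point x m₂ = C.point x m₁) (c : P.bundle.fiber (𝒵.pair hw)) :
    P.mul (congrArg (fun z : 𝒵.carrier => 𝒵.proj z) e₁)
      (((C.proj_point m₁ m₁).trans (C.proj_point x m₁).symm).trans hw) (P.oneEq e₁)
      (P.mul ((C.proj_point m₁ m₁).trans (C.proj_point x m₁).symm) hw (C.unit m₁ x m₁) c) =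
    P.mul ((C.proj_point m₂ m₂).trans (C.proj_point x m₂).symm)
      ((congrArg (fun z : 𝒵.carrier => 𝒵.proj z) e₂).trans hw) (C.unit m₂ x m₂)
      (P.mul (congrArg (fun z : 𝒵.carrier => 𝒵.proj z) e₂) hw (P.oneEq e₂) c) := by
  subst h
  refine (BundleGerbe.one_mul _).trans (congrArg _ ?_)
  exact (BundleGerbe.one_mul c).symm

/-- This writes `lineMul` in the chart of a fixed index x, where only smooth sections are involved.
It is what makes `deltaIso` visibly smooth. -/
lemma lineMul_trans (x : M) (a : P.bundle.fiber (𝒵.pair (C.proj_loc x z₁)))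
    (p : P.bundle.fiber (𝒵.pair h)) :
    C.lineMul h (C.trans (𝒵.proj z₁) x z₁ a) p = C.trans (𝒵.proj z₂) x z₂
      (P.mul (y₁ := C.loc x z₂) (y₂ := C.loc x z₁) (y₃ := z₂)
        (congrArg (fun z : 𝒵.carrier => 𝒵.proj z) (C.loc_eq x h.symm))
        ((C.proj_loc x z₁).trans h) (P.oneEq (C.loc_eq x h.symm)) (P.mul (C.proj_loc x z₁) h a p)) := by
  refine (congrArg _ (BundleGerbe.mul_assoc (L := P) _ _ _)).trans ?_
  exact C.oneEq_mul_unit_mul x h.symm ((C.proj_loc x z₁).trans h) _ _ _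

/-- The isomorphism `P_(z₁, z₂) ≅ K_{z₂} ⊗ K_{z₁}*`, for the line bundle `K` of a unit cocycle. -/
def deltaIso (C : UnitCocycle P V) {z₁ z₂ : 𝒵.carrier} (h : 𝒵.proj z₁ = 𝒵.proj z₂) :
    P.bundle.fiber (𝒵.pair h) ≃ₗᵢ[ℂ] C.line.fiber z₂ ⊗[ℂ] HDual (C.line.fiber z₁) :=
  let κ := (exists_unit (C.rank_one_line z₁)).choose
  have hκ : ‖κ‖ = 1 := (exists_unit (C.rank_one_line z₁)).choose_spec
  (((BundleGerbe.mulLeft (C.proj_loc _ z₁) h κ hκ).trans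
    (BundleGerbe.mulLeft (y₁ := C.base z₂) (y₂ := C.base z₁) (y₃ := z₂)
      (congrArg (fun z : 𝒵.carrier => 𝒵.proj z) (C.base_eq h.symm))
      ((C.proj_loc _ z₁).trans h) (P.oneEq (C.base_eq h.symm)) (BundleGerbe.norm_oneEq _))).trans
    (tmulUnit (V := HDual (C.line.fiber z₁)) (W := C.line.fiber z₂)
      (finrank_dual.trans (C.rank_one_line z₁)) (HDual.riesz _ κ) (norm_riesz hκ))).trans
    (TensorProduct.commIsometry ℂ (HDual (C.line.fiber z₁)) (C.line.fiber z₂))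

/-- Any unit vector may replace the chosen one: κp is linear and κ* conjugate-linear in κ, so a
phase cancels. -/
lemma deltaIso_apply {κ : C.line.fiber z₁} (hκ : ‖κ‖ = 1) (p : P.bundle.fiber (𝒵.pair h)) :
    C.deltaIso h p = C.lineMul h κ p ⊗ₜ[ℂ] HDual.riesz _ κ := by
  have hu := (exists_unit (C.rank_one_line z₁)).choose_spec
  set u := (exists_unit (C.rank_one_line z₁)).choose
  have e : C.deltaIso h p = C.lineMul h u p ⊗ₜ[ℂ] HDual.riesz _ u := rfl
  have hu' := line_eq_inner_smul (C.rank_one_line z₁) hκ u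
  rw [e, hu', lineMul_smul_left, map_smulₛₗ, TensorProduct.smul_tmul_smul, inner_conj_symm,
    StableIso.inner_mul_inner_unit (C.rank_one_line z₁) hκ hu, one_smul]

/-- The pairing contracts κp with κ'* and leaves ⟪κ', κp⟫ κ'q = (κp)q, because κ' is a unit vector
of a line. This is κ(pq). -/
lemma deltaIso_mul (p : P.bundle.fiber (𝒵.pair h)) (q : P.bundle.fiber (𝒵.pair h')) :
    C.deltaIso (h.trans h') (P.mul h h' p q) =
      (BundleGerbe.delta C.line C.rank_one_line).product.app h h'
        (C.deltaIso h p ⊗ₜ[ℂ] C.deltaIso h' q) := by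
  obtain ⟨κ, hκ⟩ := exists_unit (C.rank_one_line z₁)
  obtain ⟨κ', hκ'⟩ := exists_unit (C.rank_one_line z₂)
  rw [deltaIso_apply hκ, deltaIso_apply hκ, deltaIso_apply hκ']
  refine Eq.trans ?_ (contract_tmul (C.rank_one_line z₂) _ _ _ _).symm
  rw [HDual.ev_riesz, TensorProduct.smul_tmul', ← lineMul_smul_left,
    ← line_eq_inner_smul (C.rank_one_line z₂) hκ', lineMul_lineMul]

/-- All sections are expressed with the single index belonging to the fibre of `w₀`. A smooth unit
section a of P_(s_x, z₁) there provides a smooth unit κ for `deltaIso_apply`. -/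
lemma deltaIso_smooth (C : UnitCocycle P V) : IsSmoothFamily P.bundle
    (BundleGerbe.delta C.line C.rank_one_line).bundle
    (fun w => (C.deltaIso (z₁ := sqFst w) (z₂ := sqSnd w) w.2.2.2).toLinearEquiv.toLinearMap) := by
  refine IsSmoothFamily.of_secAt fun w₀ => ?_
  have hv := SmAt.val (I' := I.prod I) w₀
  obtain ⟨p, hp, hp'⟩ := exists_unit_sec (T := 𝒵.sq) (t₀ := w₀) (φ := fun w => w) P.rank_one hv
  have hl : SmAt (I.prod I) I (fun w : 𝒵.sq => (C.loc (𝒵.proj (sqFst w₀)) (sqFst w) : N)) w₀ :=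
    (C.smAt_loc (𝒵.proj (sqFst w₀)) (sqFst w₀) (V.mem_set _)).comp (φ := sqFst) hv.fst
  have hl' : SmAt (I.prod I) I (fun w : 𝒵.sq => (C.loc (𝒵.proj (sqFst w₀)) (sqSnd w) : N)) w₀ :=
    (C.smAt_loc (𝒵.proj (sqFst w₀)) (sqSnd w₀) (by
      rw [show 𝒵.proj (sqSnd w₀) = 𝒵.proj (sqFst w₀) from w₀.2.2.2.symm]; exact V.mem_set _)).comp
      (φ := sqSnd) hv.snd
  obtain ⟨a, ha, ha'⟩ := exists_unit_sec (T := 𝒵.sq) (t₀ := w₀)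
    (φ := fun w : 𝒵.sq => 𝒵.pair (C.proj_loc (𝒵.proj (sqFst w₀)) (sqFst w))) P.rank_one
    (hl.prodMk hv.fst)
  refine ⟨Unit, inferInstance, _, SecAt.lineFrameAt P.rank_one hp hp', fun _ => ?_⟩
  have hκ := C.secAt_line (ψ := sqFst) (t₀ := w₀) hv.fst rfl ha
  have ho := BundleGerbe.secAt_oneEq (P := P)
    (φ := fun w : 𝒵.sq => C.loc (𝒵.proj (sqFst w₀)) (sqSnd w))
    (φ' := fun w : 𝒵.sq => C.loc (𝒵.proj (sqFst w₀)) (sqFst w))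
    (fun w => C.loc_eq _ w.2.2.2.symm) hl'
  have hm := C.secAt_line (ψ := sqSnd) (t₀ := w₀) hv.snd w₀.2.2.2.symm
    (BundleGerbe.secAt_mul ho (BundleGerbe.secAt_mul (h' := fun w : 𝒵.sq => w.2.2.2) ha hp))
  have hd : SecAt (I.prod I) (BundleGerbe.delta C.line C.rank_one_line).bundle (fun w => w) _ w₀ :=
    (SecAt.pullback (I' := I.prod I) (I := I.prod I)
      (φ := fun w : 𝒵.sq => w) (f := Prod.snd) (A := C.line) (hf := contMDiff_snd)
      (hS := fun _ h => h.2.1) hv hm).tensor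
    (SecAt.pullback (I' := I.prod I) (I := I.prod I)
      (φ := fun w : 𝒵.sq => w) (f := Prod.fst) (A := C.line) (hf := contMDiff_fst)
      (hS := fun _ h => h.1) hv hκ).riesz
  refine hd.congr (ha'.mono fun w hw => ?_)
  refine (deltaIso_apply (C := C) (z₁ := sqFst w) (z₂ := sqSnd w) (h := w.2.2.2)
    (((C.trans _ _ _).norm_map (a w)).trans hw) (p w)).trans ?_
  exact congrArg (fun v => v ⊗ₜ[ℂ] HDual.riesz (C.line.fiber (sqFst w)) _)
    (C.lineMul_trans (z₁ := sqFst w) (z₂ := sqSnd w) (h := w.2.2.2) _ (a w) (p w))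

/-- A bundle gerbe with a unit cocycle is trivial. -/
def trivialisation (C : UnitCocycle P V) : Trivialisation P where
  line := C.line
  rank_one := C.rank_one_line
  iso :=
    { iso := BundleIso.symm ⟨fun w => C.deltaIso (z₁ := sqFst w) (z₂ := sqSnd w) w.2.2.2,
        C.deltaIso_smooth⟩
      map_product := fun z₁ z₂ z₃ h h' a b => by
        obtain ⟨a, rfl⟩ := (C.deltaIso h).surjective a
        obtain ⟨b, rfl⟩ := (C.deltaIso h').surjective b
        refine ((C.deltaIso (h.trans h')).symm_apply_eq.mpr (C.deltaIso_mul a b).symm).trans ?_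
        exact congrArg₂ (P.mul h h') ((C.deltaIso h).symm_apply_apply a).symm
          ((C.deltaIso h').symm_apply_apply b).symm }

end UnitCocycle

end UnitCocycleTrivialisation

/-! ### Bundle gerbes with the same Dixmier-Douady class -/

section CechCochains

variable {EM HM : Type*} [NormedAddCommGroup EM] [NormedSpace ℝ EM] [TopologicalSpace HM]
  {IM : ModelWithCorners ℝ EM HM} {M : Type*} [TopologicalSpace M] [ChartedSpace HM M]

namespace PointCover

lemma isOpen_inter (V : PointCover M) {p : ℕ} (x : Fin p → M) : IsOpen (V.inter x) := by
  have h : V.inter x = ⋂ i, V.set (x i) := by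
    ext m
    simp [inter]
  rw [h]
  exact isOpen_iInter_of_finite fun i => V.isOpen_set _

/-- Smooth real Čech cocycles of degree two are coboundaries. -/
lemma exists_cobounding [FiniteDimensional ℝ EM] [IsManifold IM ∞ M] [T2Space M]
    [SigmaCompactSpace M] (V : PointCover M) {c : (Fin 3 → M) → M → ℝ}
    (hc : ∀ x, ContMDiffOn IM 𝓘(ℝ, ℝ) ∞ (c x) (V.inter x))
    (hd : ∀ (x : Fin 4 → M), ∀ m ∈ V.inter x,
      ∑ i : Fin 4, (-1) ^ (i : ℕ) * c (x ∘ i.succAbove) m = 0) :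
    ∃ g : M → M → M → ℝ,
      (∀ x y, ∀ m ∈ V.set x ∩ V.set y, ContMDiffAt IM 𝓘(ℝ, ℝ) ∞ (g x y) m) ∧
      ∀ x : Fin 3 → M, ∀ m ∈ V.inter x,
        g (x 1) (x 2) m - g (x 0) (x 2) m + g (x 0) (x 1) m = c x m := by
  obtain ⟨ρ, hρ⟩ := SmoothPartitionOfUnity.exists_isSubordinate IM isClosed_univ V.set V.isOpen_set
    (fun m _ => Set.mem_iUnion.mpr ⟨m, V.mem_set m⟩)
  have hm : ∀ a m, ρ a m ≠ 0 → m ∈ V.set a := fun a m h => hρ a (subset_tsupport _ h)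
  -- The usual contracting homotopy g_xy = Σ_a ρ_a c_axy. The coboundary of g is Σ_a ρ_a c = c by
  -- the cocycle identity for (a, x₀, x₁, x₂), which is available wherever ρ_a is nonzero.
  refine ⟨fun x y m => ∑ᶠ a, ρ a m • c ![a, x, y] m, fun x y m hm => ?_, fun x m hx => ?_⟩
  · refine ρ.contMDiffAt_finsum fun a ha => (hc ![a, x, y]).contMDiffAt
      ((V.isOpen_inter _).mem_nhds fun i => ?_)
    fin_cases i
    exacts [hρ a ha, hm.1, hm.2]
  · simp only [← ρ.sum_finsupport_smul_eq_finsum]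
    rw [← Finset.sum_sub_distrib, ← Finset.sum_add_distrib]
    have key : ∀ a, ρ a m • c ![a, x 1, x 2] m - ρ a m • c ![a, x 0, x 2] m +
        ρ a m • c ![a, x 0, x 1] m = ρ a m * c x m := by
      intro a
      by_cases ha : ρ a m = 0
      · simp [ha]
      have h := hd ![a, x 0, x 1, x 2] m (by
        intro i
        fin_cases i
        exacts [hm a m ha, hx 0, hx 1, hx 2])
      have e₀ : ![a, x 0, x 1, x 2] ∘ (0 : Fin 4).succAbove = x := by
        ext i; fin_cases i <;> rfl
      have e₁ : ![a, x 0, x 1, x 2] ∘ (1 : Fin 4).succAbove = ![a, x 1, x 2] := by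
        ext i; fin_cases i <;> rfl
      have e₂ : ![a, x 0, x 1, x 2] ∘ (2 : Fin 4).succAbove = ![a, x 0, x 2] := by
        ext i; fin_cases i <;> rfl
      have e₃ : ![a, x 0, x 1, x 2] ∘ (3 : Fin 4).succAbove = ![a, x 0, x 1] := by
        ext i; fin_cases i <;> rfl
      rw [Fin.sum_univ_four, e₀, e₁, e₂, e₃] at h
      simp only [smul_eq_mul]
      norm_num [pow_succ] at h
      linear_combination (-ρ a m) * h
    rw [Finset.sum_congr rfl fun a _ => key a, ← Finset.sum_mul, ρ.sum_finsupport m (Set.mem_univ m),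
      one_mul]

lemma d_apply (V : PointCover M) {p : ℕ} (β : V.Cochain p) (x : Fin (p + 2) → M)
    (m : V.inter x) : V.d p β x m =
      ∑ i : Fin (p + 2), (-1) ^ (i : ℕ) * β (x ∘ i.succAbove) ⟨m, V.inter_subset_face x i m.2⟩ := by
  have h : ∀ (s : Finset (Fin (p + 2))), (∑ i ∈ s, (-1 : ℤ) ^ (i : ℕ) •
    restrict (V.inter_subset_face x i) (β (x ∘ i.succAbove))) m =
    ∑ i ∈ s, (-1) ^ (i : ℕ) * β (x ∘ i.succAbove) ⟨m, V.inter_subset_face x i m.2⟩ := by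
    classical
    intro s
    induction s using Finset.induction_on with
    | empty => rfl
    | insert a s ha ih => rw [Finset.sum_insert ha, Finset.sum_insert ha, ← ih]; rfl
  exact h Finset.univ

open Classical in
/-- The extension by zero of a locally constant function, as a real function. -/
def extend {A : Set M} (f : LocallyConstant A ℤ) (m : M) : ℝ := if h : m ∈ A then f ⟨m, h⟩ else 0

lemma extend_of_mem {A : Set M} (f : LocallyConstant A ℤ) {m : M} (h : m ∈ A) :
    extend f m = f ⟨m, h⟩ := dif_pos h

lemma contMDiffOn_extend {A : Set M} (f : LocallyConstant A ℤ) :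
    ContMDiffOn IM 𝓘(ℝ, ℝ) ∞ (extend f) A := by
  intro m hm
  refine (contMDiffWithinAt_const (c := (f ⟨m, hm⟩ : ℝ))).congr_of_eventuallyEq ?_
    (extend_of_mem f hm)
  have h : ∀ᶠ m' : A in nhds ⟨m, hm⟩, extend f m' = f ⟨m, hm⟩ := by
    filter_upwards [f.isLocallyConstant.eventually_eq ⟨m, hm⟩] with m' hm'
    rw [extend_of_mem f m'.2]
    exact congrArg (fun n : ℤ => (n : ℝ)) hm'
  exact (eventually_nhds_subtype_iff A ⟨m, hm⟩ _).mp h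

open Classical in
/-- An index of a set of the cover containing `m`, which is `x` if possible. -/
def idx (V : PointCover M) (x m : M) : M := if m ∈ V.set x then x else m

lemma mem_idx (V : PointCover M) (x m : M) : m ∈ V.set (V.idx x m) := by
  unfold idx
  split_ifs with h
  exacts [h, V.mem_set m]

lemma idx_of_mem (V : PointCover M) {x m : M} (h : m ∈ V.set x) : V.idx x m = x := if_pos h

lemma eventually_idx (V : PointCover M) {x : M} {m : (Set.univ : Set M)} (h : (m : M) ∈ V.set x) :
    ∀ᶠ m' : (Set.univ : Set M) in nhds m, V.idx x m' = x :=
  (continuous_subtype_val.continuousAt.eventually_mem ((V.isOpen_set x).mem_nhds h)).mono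
    fun _ hm => V.idx_of_mem hm

end PointCover

end CechCochains

/-! ### From equal Dixmier–Douady classes to a unit cocycle of L* ⊗ J -/

section DixmierDouady

variable {EM HM : Type*} [NormedAddCommGroup EM] [NormedSpace ℝ EM] [TopologicalSpace HM]
  {IM : ModelWithCorners ℝ EM HM} {M : Type*} [TopologicalSpace M] [ChartedSpace HM M]
  {E H : Type*} [NormedAddCommGroup E] [NormedSpace ℝ E] [TopologicalSpace H]
  {I : ModelWithCorners ℝ E H} {N : Type*} [TopologicalSpace N] [ChartedSpace H N]
  {E' H' : Type*} [NormedAddCommGroup E'] [NormedSpace ℝ E'] [TopologicalSpace H']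
  {I' : ModelWithCorners ℝ E' H'} {N' : Type*} [TopologicalSpace N'] [ChartedSpace H' N']
  {𝒴 : SplitSpace IM M I N} {𝒳 : SplitSpace IM M I' N'}

open SplitSpace PointCover

/-- The coboundaries of w and w' are the integral cocycles, whose difference is dβ. So w - w' - β is
a smooth real cocycle, and hence the coboundary of some g. -/
lemma DixmierDouadyData.exists_integral_difference [FiniteDimensional ℝ EM] [IsManifold IM ∞ M]
    [T2Space M] [SigmaCompactSpace M] {L : BundleGerbe 𝒴} {J : BundleGerbe 𝒳}
    (D : DixmierDouadyData L) (D' : DixmierDouadyData J) {V : PointCover M}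
    (h : V.Refines D.cover) (h' : V.Refines D'.cover) (β : V.Cochain 2)
    (hβ : refine h 3 D.cocycle.1 - refine h' 3 D'.cocycle.1 = V.d 2 β) :
    ∃ g : M → M → M → ℝ,
      (∀ x y, ∀ m ∈ V.set x ∩ V.set y, ContMDiffAt IM 𝓘(ℝ, ℝ) ∞ (g x y) m) ∧
      ∀ x : Fin 3 → M, ∀ m ∈ V.inter x, ∃ n : ℤ,
        g (x 1) (x 2) m - g (x 0) (x 2) m + g (x 0) (x 1) m = D.w x m - D'.w x m + n := by
  obtain ⟨g, hg, hg'⟩ := V.exists_cobounding (IM := IM)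
    (c := fun x m => D.w x m - D'.w x m - extend (β x) m)
    (fun x => (((D.smooth_w x).mono (h.inter_subset x)).sub
      ((D'.smooth_w x).mono (h'.inter_subset x))).sub (contMDiffOn_extend _))
    (fun x m hm => by
      have e := congrArg (fun n : ℤ => (n : ℝ))
        (DFunLike.congr_fun (congrFun hβ x) (⟨m, hm⟩ : V.inter x))
      have e₁ : ((refine h 3 D.cocycle.1 - refine h' 3 D'.cocycle.1) x (⟨m, hm⟩ : V.inter x) : ℤ) =
        D.cocycle.1 x ⟨m, h.inter_subset x hm⟩ - D'.cocycle.1 x ⟨m, h'.inter_subset x hm⟩ := rfl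
      have e₂ := V.d_apply β x ⟨m, hm⟩
      have e₃ := D.cocycle_eq x ⟨m, h.inter_subset x hm⟩
      have e₄ := D'.cocycle_eq x ⟨m, h'.inter_subset x hm⟩
      rw [e₁, e₂] at e
      push_cast at e
      rw [e₃, e₄] at e
      have e₅ : ∀ i : Fin 4, extend (β (x ∘ i.succAbove)) m =
          (β (x ∘ i.succAbove) ⟨m, V.inter_subset_face x i hm⟩ : ℝ) := fun i =>
        extend_of_mem _ _
      simp only [mul_sub, Finset.sum_sub_distrib, e₅]
      exact sub_eq_zero.mpr e)
  -- The integer by which the coboundary of g misses w - w' is the value of -β.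
  refine ⟨g, hg, fun x m hm => ⟨-β x ⟨m, hm⟩, ?_⟩⟩
  rw [hg' x m hm, extend_of_mem _ hm]
  push_cast
  ring

/-- Local sections `s_x` of `Y → M`, smooth near the points of the sets of a cover, with unit
sections `σ_xy` of `(s_x, s_y)^{-1} L` and functions `w` with
`σ_xy σ_yz = exp (2 π i w_xyz) σ_xz`. -/
structure LocalData (L : BundleGerbe 𝒴) (V : PointCover M) where
  point : M → M → 𝒴.carrier
  proj_point : ∀ x m, 𝒴.proj (point x m) = m
  smooth_point : ∀ (x : M) (m : (Set.univ : Set M)), (m : M) ∈ V.set x →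
    SmAt IM I (fun m : (Set.univ : Set M) => (point x m : N)) m
  unit : ∀ x y m : M,
    L.bundle.fiber (𝒴.pair ((proj_point x m).trans (proj_point y m).symm))
  norm_unit : ∀ x y m, ‖unit x y m‖ = 1
  w : M → M → M → M → ℝ
  unit_mul : ∀ x y z m, L.mul ((proj_point x m).trans (proj_point y m).symm)
    ((proj_point y m).trans (proj_point z m).symm) (unit x y m) (unit y z m) =
      Complex.exp (2 * Real.pi * Complex.I * w x y z m) • unit x z m
  smooth_unit : ∀ (x y : M) (m : (Set.univ : Set M)), (m : M) ∈ V.set x → (m : M) ∈ V.set y →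
    SecAt IM L.bundle (fun m : (Set.univ : Set M) =>
      𝒴.pair ((proj_point x m).trans (proj_point y m).symm)) (fun m => unit x y m) m

namespace DixmierDouadyData

variable {L : BundleGerbe 𝒴} (D : DixmierDouadyData L) {V : PointCover M}

lemma smAt_sec (h : V.Refines D.cover) {x : M} {m : (Set.univ : Set M)} (hm : (m : M) ∈ V.set x) :
    SmAt IM I (fun m : (Set.univ : Set M) => D.sec (V.idx x m) m) m :=
  (SmAt.of_contMDiffAt (((D.smooth_sec x).mono (h x)).contMDiffAt
    ((V.isOpen_set x).mem_nhds hm))).congr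
      ((V.eventually_idx hm).mono fun m' hm' => by rw [hm'])

/-- For equal indices the two units still lie in differently presented fibres. Their coordinates are
complex numbers and can be compared directly. -/
lemma coef_unit {a b x y m : M} (ha : m ∈ D.cover.set a) (hb : m ∈ D.cover.set b)
    (hx : m ∈ D.cover.set x) (hy : m ∈ D.cover.set y) (hax : a = x) (hby : b = y) (q : 𝒴.sq)
    (i : L.bundle.ι q) : coef L.bundle q _ i (D.unit a b m ha hb) =
      coef L.bundle q _ i (D.unit x y m hx hy) := by
  subst hax hby
  rfl

/-- Near m the replaced indices are constantly x and y, so the coordinates agree there with those of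
the given smooth section σ_xy. -/
lemma secAt_unit (h : V.Refines D.cover) {x y : M} {m : (Set.univ : Set M)}
    (hx : (m : M) ∈ V.set x) (hy : (m : M) ∈ V.set y) :
    SecAt IM L.bundle (fun m : (Set.univ : Set M) =>
      𝒴.pair (y₁ := ⟨D.sec (V.idx x m) m, D.sec_mem _ _ (h _ (V.mem_idx x m))⟩)
        (y₂ := ⟨D.sec (V.idx y m) m, D.sec_mem _ _ (h _ (V.mem_idx y m))⟩)
        ((D.proj_sec _ _ (h _ (V.mem_idx x m))).trans (D.proj_sec _ _ (h _ (V.mem_idx y m))).symm))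
      (fun m => D.unit (V.idx x m) (V.idx y m) m (h _ (V.mem_idx x m)) (h _ (V.mem_idx y m))) m := by
  have hφ := (D.smAt_sec h hx).prodMk (D.smAt_sec h hy)
  let q : 𝒴.sq := 𝒴.pair (y₁ := ⟨D.sec (V.idx x m) m, D.sec_mem _ _ (h _ (V.mem_idx x m))⟩)
    (y₂ := ⟨D.sec (V.idx y m) m, D.sec_mem _ _ (h _ (V.mem_idx y m))⟩)
    ((D.proj_sec _ _ (h _ (V.mem_idx x m))).trans (D.proj_sec _ _ (h _ (V.mem_idx y m))).symm)
  refine SecAt.of_dom hφ q (L.bundle.mem_dom q) fun i => ?_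
  obtain ⟨g, hg, hgf⟩ := D.smooth_unit x y q i
  have hV : ∀ᶠ m' : M in nhds m, m' ∈ V.set x ∩ V.set y :=
    ((V.isOpen_set x).inter (V.isOpen_set y)).mem_nhds ⟨hx, hy⟩
  have hq : ∀ᶠ m' : M in nhds m, (D.sec x m', D.sec y m') ∈ L.bundle.dom q := by
    have hc : ∀ z, (m : M) ∈ V.set z → ContinuousAt (D.sec z) m := fun z hz =>
      (((D.smooth_sec z).mono (h z)).contMDiffAt ((V.isOpen_set z).mem_nhds hz)).continuousAt
    refine ((hc x hx).prodMk (hc y hy)).eventually_mem ((L.bundle.isOpen_dom q).mem_nhds ?_)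
    have e : (q : N × N) = (D.sec x m, D.sec y m) := by
      simp only [q, V.idx_of_mem hx, V.idx_of_mem hy]
    exact e ▸ L.bundle.mem_dom q
  have hN : (D.cover.set x ∩ D.cover.set y) ∩ {m | (D.sec x m, D.sec y m) ∈ L.bundle.dom q} ∈
      nhds (m : M) := by
    filter_upwards [hV, hq] with m' h₁ h₂
    exact ⟨⟨h _ h₁.1, h _ h₁.2⟩, h₂⟩
  refine (SmAt.of_contMDiffAt (hg.contMDiffAt hN)).congr ?_
  filter_upwards [continuous_subtype_val.continuousAt.eventually hV,
    continuous_subtype_val.continuousAt.eventually hq] with m' h₁ h₂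
  refine (D.coef_unit _ _ (h _ h₁.1) (h _ h₁.2) (V.idx_of_mem h₁.1) (V.idx_of_mem h₁.2) q i).trans ?_
  exact (coef_of_mem L.bundle h₂ i _).trans (hgf ⟨m', h _ h₁.1, h _ h₁.2⟩ h₂).symm

/-- The local data over a refinement of the cover. -/
def localData (h : V.Refines D.cover) : LocalData L V where
  -- Replacing x by `V.idx x m` makes sections, units and w total. The product relation persists at
  -- every m, because m lies in all the sets so indexed; smoothness is claimed only over the
  -- original sets.
  point x m := ⟨D.sec (V.idx x m) m, D.sec_mem _ _ (h _ (V.mem_idx x m))⟩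
  proj_point x m := D.proj_sec _ _ (h _ (V.mem_idx x m))
  smooth_point x m hm := D.smAt_sec h hm
  unit x y m := D.unit (V.idx x m) (V.idx y m) m (h _ (V.mem_idx x m)) (h _ (V.mem_idx y m))
  norm_unit x y m := D.norm_unit _ _ _ _ _
  w x y z m := D.w ![V.idx x m, V.idx y m, V.idx z m] m
  unit_mul x y z m := D.product_unit ![V.idx x m, V.idx y m, V.idx z m] m (by
    intro i
    fin_cases i
    exacts [h _ (V.mem_idx x m), h _ (V.mem_idx y m), h _ (V.mem_idx z m)])
  smooth_unit x y m hx hy := D.secAt_unit h hx hy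

end DixmierDouadyData

lemma norm_smul_tmul_unit {A B : Type*} [NormedAddCommGroup A] [InnerProductSpace ℂ A]
    [NormedAddCommGroup B] [InnerProductSpace ℂ B] {c : ℂ} {v : A} {w : B} (hc : ‖c‖ = 1)
    (hv : ‖v‖ = 1) (hw : ‖w‖ = 1) : ‖c • (v ⊗ₜ[ℂ] w)‖ = 1 := by
  rw [TensorProduct.smul_tmul', TensorProduct.norm_tmul, norm_smul, hc, hv, hw, one_mul, one_mul]

lemma norm_exp_two_pi (r : ℝ) : ‖Complex.exp (2 * Real.pi * Complex.I * r)‖ = 1 := by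
  rw [show (2 * Real.pi * Complex.I * r : ℂ) = ((2 * Real.pi * r : ℝ) : ℂ) * Complex.I by
    push_cast; ring, Complex.norm_exp_ofReal_mul_I]

/-- The phase computation behind τ_xy τ_yz = τ_xz. The factor of w is conjugated because L enters
dually, and the integer n disappears under the exponential. -/
lemma exp_cocycle {a b c w w' : ℝ} {n : ℤ} (h : b - c + a = w - w' + n) :
    Complex.exp (2 * Real.pi * Complex.I * a) * Complex.exp (2 * Real.pi * Complex.I * b) *
      ((starRingEnd ℂ) (Complex.exp (2 * Real.pi * Complex.I * w)) *
        Complex.exp (2 * Real.pi * Complex.I * w')) =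
    Complex.exp (2 * Real.pi * Complex.I * c) := by
  have h' : (b - c + a : ℂ) = w - w' + n := by exact_mod_cast h
  rw [← Complex.exp_conj, ← Complex.exp_add, ← Complex.exp_add, ← Complex.exp_add,
    Complex.exp_eq_exp_iff_exists_int]
  refine ⟨n, ?_⟩
  simp only [map_mul, Complex.conj_ofReal, Complex.conj_I, map_ofNat]
  linear_combination (2 * Real.pi * Complex.I) * h'

lemma smAt_exp {T : Set N} {f : T → ℝ} {t₀ : T} (hf : SmAt I 𝓘(ℝ, ℝ) f t₀) :
    SmAt I 𝓘(ℝ, ℂ) (fun t => Complex.exp (2 * Real.pi * Complex.I * f t)) t₀ := by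
  have h : ContDiff ℝ ∞ (fun r : ℝ => Complex.exp (2 * Real.pi * Complex.I * r)) :=
    (contDiff_const.mul Complex.ofRealCLM.contDiff).cexp
  exact SmAt.contMDiffAt_comp (g := fun r : ℝ => Complex.exp (2 * Real.pi * Complex.I * r))
    h.contMDiff.contMDiffAt hf

/-- Local data of `L` and `J` whose functions `w` differ by the coboundary of `g` up to integers
define a unit cocycle of `L* ⊗ J`. -/
def LocalData.unitCocycle {L : BundleGerbe 𝒴} {J : BundleGerbe 𝒳} {V : PointCover M}
    (D : LocalData L V) (D' : LocalData J V) (g : M → M → M → ℝ)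
    (hg : ∀ (x y : M) (m : (Set.univ : Set M)), (m : M) ∈ V.set x → (m : M) ∈ V.set y →
      SmAt IM 𝓘(ℝ, ℝ) (fun m : (Set.univ : Set M) => g x y m) m)
    (hw : ∀ x y z m, ∃ n : ℤ,
      g y z m - g x z m + g x y m = D.w x y z m - D'.w x y z m + n) :
    UnitCocycle (L.dual.prod J) V where
  point x m := mkPt (y := D.point x m) (x := D'.point x m)
    ((D.proj_point x m).trans (D'.proj_point x m).symm)
  proj_point x m := D.proj_point x m
  smooth_point x m hm := (D.smooth_point x m hm).prodMk (D'.smooth_point x m hm)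
  -- The product of two sections σ* ⊗ σ' carries the defect exp(2πi(w' - w)). The factor exp(2πi g)
  -- removes it, since the coboundary of g is w - w' up to integers.
  unit x y m := Complex.exp (2 * Real.pi * Complex.I * g x y m) •
    (HDual.riesz (L.bundle.fiber (𝒴.pair ((D.proj_point x m).trans (D.proj_point y m).symm)))
      (D.unit x y m) ⊗ₜ[ℂ] D'.unit x y m)
  norm_unit x y m := by
    exact norm_smul_tmul_unit (norm_exp_two_pi _) (norm_riesz (D.norm_unit x y m))
      (D'.norm_unit x y m)
  unit_mul x y z m := by
    obtain ⟨n, hn⟩ := hw x y z m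
    refine (BundleGerbe.smul_mul _ _ _).trans ((congrArg _ (BundleGerbe.mul_smul _ _ _)).trans ?_)
    have e := dual_prod_mul (L := L) (J := J)
      (z₁ := mkPt (y := D.point x m) (x := D'.point x m)
        ((D.proj_point x m).trans (D'.proj_point x m).symm))
      (z₂ := mkPt (y := D.point y m) (x := D'.point y m)
        ((D.proj_point y m).trans (D'.proj_point y m).symm))
      (z₃ := mkPt (y := D.point z m) (x := D'.point z m)
        ((D.proj_point z m).trans (D'.proj_point z m).symm))
      ((D.proj_point x m).trans (D.proj_point y m).symm)
      ((D.proj_point y m).trans (D.proj_point z m).symm) (D.unit x y m) (D.unit y z m)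
      (D'.unit x y m) (D'.unit y z m)
    have e' : HDual.riesz (L.bundle.fiber (𝒴.pair ((D.proj_point x m).trans
        (D.proj_point z m).symm))) (L.mul _ _ (D.unit x y m) (D.unit y z m)) ⊗ₜ[ℂ]
        J.mul _ _ (D'.unit x y m) (D'.unit y z m) =
        ((starRingEnd ℂ) (Complex.exp (2 * Real.pi * Complex.I * D.w x y z m)) *
          Complex.exp (2 * Real.pi * Complex.I * D'.w x y z m)) •
        (HDual.riesz (L.bundle.fiber (𝒴.pair ((D.proj_point x m).trans
          (D.proj_point z m).symm))) (D.unit x z m) ⊗ₜ[ℂ] D'.unit x z m) := by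
      rw [D.unit_mul, D'.unit_mul, map_smulₛₗ, TensorProduct.smul_tmul_smul]
    refine (congrArg (fun v => Complex.exp (2 * Real.pi * Complex.I * g x y m) •
      Complex.exp (2 * Real.pi * Complex.I * g y z m) • v) (e.trans e')).trans ?_
    refine (smul_smul _ _ _).trans ((smul_smul _ _ _).trans
      (congrArg (fun c : ℂ => c • _) ?_))
    exact exp_cocycle hn
  smooth_unit x y m hx hy := by
    have h₁ := (D.smooth_point x m hx).prodMk (D'.smooth_point x m hx)
    have h₂ := (D.smooth_point y m hy).prodMk (D'.smooth_point y m hy)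
    have hφ : ∀ (m : (Set.univ : Set M)), (𝒴.prod 𝒳).proj (mkPt
        ((D.proj_point x m).trans (D'.proj_point x m).symm)) = (𝒴.prod 𝒳).proj (mkPt
        ((D.proj_point y m).trans (D'.proj_point y m).symm)) :=
      fun m => (D.proj_point x m).trans (D.proj_point y m).symm
    refine SecAt.smul (smAt_exp (hg x y m hx hy)) (SecAt.tensor ?_ ?_)
    · exact SecAt.pullFst (L := L.dual) (h := hφ) h₁ h₂ (D.smooth_unit x y m hx hy).riesz
    · exact SecAt.pullSnd (J := J) (h := hφ) h₁ h₂ (D'.smooth_unit x y m hx hy)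

/-- Bundle gerbes with the same Dixmier-Douady class are stably isomorphic. -/
theorem nonempty_stableIso [FiniteDimensional ℝ EM] [IsManifold IM ∞ M] [T2Space M]
    [SigmaCompactSpace M] {L : BundleGerbe 𝒴} {J : BundleGerbe 𝒳} {κ : CechH M 2}
    (hL : IsDixmierDouadyClass L κ) (hJ : IsDixmierDouadyClass J κ) : Nonempty (StableIso L J) := by
  obtain ⟨D, rfl⟩ := hL
  obtain ⟨D', hD'⟩ := hJ
  obtain ⟨V, h, h', β, hβ⟩ := Quotient.exact hD'
  obtain ⟨g, hg, hw⟩ := D.exists_integral_difference D' h h' β hβ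
  refine ⟨((D.localData h).unitCocycle (D'.localData h')
    (fun x y m => g (V.idx x m) (V.idx y m) m) (fun x y m hx hy => ?_)
    (fun x y z m => hw ![V.idx x m, V.idx y m, V.idx z m] m ?_)).trivialisation⟩
  · refine (SmAt.of_contMDiffAt (hg x y m ⟨hx, hy⟩)).congr ?_
    filter_upwards [V.eventually_idx hx, V.eventually_idx hy] with m' h₁ h₂
    rw [h₁, h₂]
  · intro i
    fin_cases i
    exacts [V.mem_idx x m, V.mem_idx y m, V.mem_idx z m]

end DixmierDouady

end BundleGerbeTheory

end

/-! ### The theorem -/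

theorem mainTheorem6
    {EM : Type*} [NormedAddCommGroup EM] [NormedSpace ℝ EM]
    {HM : Type*} [TopologicalSpace HM] (IM : ModelWithCorners ℝ EM HM)
    {M : Type*} [TopologicalSpace M] [ChartedSpace HM M] [IsManifold IM ∞ M]
    {EY : Type*} [NormedAddCommGroup EY] [NormedSpace ℝ EY]
    {HY : Type*} [TopologicalSpace HY] (IY : ModelWithCorners ℝ EY HY)
    {Y : Type*} [TopologicalSpace Y] [ChartedSpace HY Y] [IsManifold IY ∞ Y]
    {EX : Type*} [NormedAddCommGroup EX] [NormedSpace ℝ EX]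
    {HX : Type*} [TopologicalSpace HX] (IX : ModelWithCorners ℝ EX HX)
    {X : Type*} [TopologicalSpace X] [ChartedSpace HX X] [IsManifold IX ∞ X]
    (π : Y → M) (hπ : ContMDiff IY IM ∞ π) (sπ : IsLocallySplit IM IY π)
    (ρ : X → M) (hρ : ContMDiff IX IM ∞ ρ) (sρ : IsLocallySplit IM IX ρ)
    (L : BundleGerbe (SplitSpace.ofMap π hπ sπ)) (J : BundleGerbe (SplitSpace.ofMap ρ hρ sρ)) :
    (∀ T : StableIso L J, ∃ Φ : GerbeMod L ≃+ GerbeMod J,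
      (∀ E : GerbeModule L, ∃ F : GerbeModule J, T.Induces E F) ∧
      (∀ (E : GerbeModule L) (F : GerbeModule J), T.Induces E F → Φ (GerbeMod.mk E) = GerbeMod.mk F) ∧
      ∃ Ψ : GerbeK L ≃+ GerbeK J, ∀ m : GerbeMod L,
        Ψ (Algebra.GrothendieckAddGroup.of m) = Algebra.GrothendieckAddGroup.of (Φ m)) ∧
    (FiniteDimensional ℝ EM → T2Space M → SigmaCompactSpace M →
      ∀ κ : CechH M 2, IsDixmierDouadyClass L κ → IsDixmierDouadyClass J κ →
        Nonempty (GerbeK L ≃+ GerbeK J)) := by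
  refine ⟨fun T => ⟨T.modEquiv, T.exists_induces, fun _ _ h => T.modEquiv_mk h,
    grothendieckCongr T.modEquiv, grothendieckCongr_of T.modEquiv⟩, ?_⟩
  intro _ _ _ κ hL hJ
  obtain ⟨T⟩ := nonempty_stableIso hL hJ
  exact ⟨grothendieckCongr T.modEquiv⟩
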